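/- **Theorem 1.1 (Upward deviations).** Let $d\ge 3$, let $(S_n)_{n\ge 0}$ be the discrete-time simple random walk on $\mathbb Z^d$ started at $0$, and let $(Y_t)_{t\ge 0}$ be the continuous-time walk obtained from $(S_n)$ by attaching i.i.d. $\mathrm{Exp}(1)$ holding times, independent of $(S_n)$. For $x\in\mathbb Z^d$ let $$\xi(n,x):=\sum_{k=0}^n \mathbf 1_{\{S_k=x\}},\qquad \ell(t,x):=\int_0^t \mathbf 1_{\{Y_s=x\}}\,ds,$$ and let $\xi^*(n):=\max_{x\in\mathbb Z^d}\xi(n,x)$ and $\ell^*(t):=\max_{x\in\mathbb Z^d}\ell(t,x)$. Let $$\gamma:=\mathbb P(S_n\neq 0\text{ for all }n\ge 1),\qquad \alpha:=-\frac{1}{\log(1-\gamma)}.$$ Then for every $\beta>1$ and $u\in\mathbb R$, as $t\to\infty$ through the reals and as $n\to\infty$ through the integers, respectively, $$\mathbb P\bigl(\ell^*(t)>\beta\gamma^{-1}\log t+u\bigr)=(1+o(1))\,\gamma e^{-\gamma u}\,t^{-(\beta-1)},$$ $$\mathbb P\bigl(\xi^*(n)>\beta\alpha\log n+u\bigr)=(1+o(1))\,\gamma\,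 n\,(1-\gamma)^{\lfloor \beta\alpha\log n+u\rfloor}.$$ -/

import Mathlib

open MeasureTheory ProbabilityTheory Filter Asymptotics
open scoped ENNReal

namespace RandomWalk

/-- The law of one step of simple random walk on `ℤ^d`: the uniform distribution on the
`2d` unit vectors `± e_i`. -/
noncomputable def stepLaw (d : ℕ) : Measure (Fin d → ℤ) :=
  (2 * (d : ℝ≥0∞))⁻¹ •
    ∑ i : Fin d, (Measure.dirac (Pi.single i (1 : ℤ)) + Measure.dirac (-Pi.single i (1 : ℤ)))

/-- `S` is a (discrete-time) simple random walk on `ℤ^d` started at the origin, under `μ`. -/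
structure IsSimpleRandomWalk {Ω : Type*} [MeasurableSpace Ω] {d : ℕ}
    (S : ℕ → Ω → (Fin d → ℤ)) (μ : Measure Ω) : Prop where
  measurable : ∀ n, Measurable (S n)
  start : ∀ ω, S 0 ω = 0
  indep : iIndepFun (fun (n : ℕ) (ω : Ω) => S (n + 1) ω - S n ω) μ
  law : ∀ n : ℕ, HasLaw (fun ω => S (n + 1) ω - S n ω) (stepLaw d) μ

/-- `H 0, H 1, …` are i.i.d. `Exp(1)` holding times, independent of the walk `S`. -/
structure IsHoldingTimes {Ω : Type*} [MeasurableSpace Ω] {d : ℕ}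
    (H : ℕ → Ω → ℝ) (S : ℕ → Ω → (Fin d → ℤ)) (μ : Measure Ω) : Prop where
  measurable : ∀ n, Measurable (H n)
  indep : iIndepFun H μ
  law : ∀ n : ℕ, HasLaw (H n) (expMeasure 1) μ
  indep_walk : IndepFun (fun ω n => H n ω) (fun ω n => S n ω) μ

section Walk

variable {Ω : Type*} {d : ℕ}

/-- The time of the `n`-th jump of the continuous-time walk, `H 0 + … + H (n - 1)`. -/
def jumpTime (H : ℕ → Ω → ℝ) (n : ℕ) (ω : Ω) : ℝ :=
  ∑ k ∈ Finset.range n, H k ω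

/-- The number of jumps up to time `t`: the least `n` such that the `(n+1)`-st jump occurs
after time `t`. Almost surely such an `n` exists for all `t`. -/
noncomputable def jumpCount (H : ℕ → Ω → ℝ) (t : ℝ) (ω : Ω) : ℕ :=
  sInf {n : ℕ | t < jumpTime H (n + 1) ω}

/-- The continuous-time walk `Y_t`, which stays at `S n` during the `n`-th holding time. -/
noncomputable def contWalk (S : ℕ → Ω → (Fin d → ℤ)) (H : ℕ → Ω → ℝ) (t : ℝ) (ω : Ω) :
    Fin d → ℤ :=
  S (jumpCount H t ω) ω

/-- The discrete local time `ξ(n, x) = ∑_{k=0}^n 1{S_k = x}`. -/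
def discreteLocalTime (S : ℕ → Ω → (Fin d → ℤ)) (n : ℕ) (x : Fin d → ℤ) (ω : Ω) : ℕ :=
  ∑ k ∈ Finset.range (n + 1), if S k ω = x then 1 else 0

/-- The continuous local time `ℓ(t, x) = ∫_0^t 1{Y_s = x} ds`. -/
noncomputable def contLocalTime (S : ℕ → Ω → (Fin d → ℤ)) (H : ℕ → Ω → ℝ) (t : ℝ)
    (x : Fin d → ℤ) (ω : Ω) : ℝ :=
  ∫ s in (0 : ℝ)..t, if contWalk S H s ω = x then (1 : ℝ) else 0

/-- `ξ*(n) = max_x ξ(n, x)`; the family is bounded by `n + 1`. -/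
noncomputable def maxDiscreteLocalTime (S : ℕ → Ω → (Fin d → ℤ)) (n : ℕ) (ω : Ω) : ℕ :=
  ⨆ x : Fin d → ℤ, discreteLocalTime S n x ω

/-- `ℓ*(t) = max_x ℓ(t, x)`; for `t ≥ 0` the family is bounded by `t`. -/
noncomputable def maxContLocalTime (S : ℕ → Ω → (Fin d → ℤ)) (H : ℕ → Ω → ℝ) (t : ℝ)
    (ω : Ω) : ℝ :=
  ⨆ x : Fin d → ℤ, contLocalTime S H t x ω

/-- The escape probability `γ`: the walk never returns to the origin. -/
noncomputable def escapeProb [MeasurableSpace Ω] (S : ℕ → Ω → (Fin d → ℤ)) (μ : Measure Ω) : ℝ :=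
  μ.real {ω | ∀ n : ℕ, 1 ≤ n → S n ω ≠ 0}

/-- `α = -1 / log (1 - γ)`. -/
noncomputable def alpha [MeasurableSpace Ω] (S : ℕ → Ω → (Fin d → ℤ)) (μ : Measure Ω) : ℝ :=
  -1 / Real.log (1 - escapeProb S μ)

end Walk

end RandomWalk

/-! Attach to each step of the walk an independent mark with law `κ`: the constant 1 for `ξ*`, an
`Exp(1)` variable for `ℓ*`. Both asymptotics come from one estimate,
`isEquivalent_measureReal_maxEvent`. With `r = 1 - γ` the return probability, the probability that
some site collects total mark above `s` before step `n` is equivalent to `γ n T(r, s)`, provided `s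
→ ∞`, `⌈s⌉ ^ 7 / n → 0` and `n T(r, s) → 0`. Here `T r` is the tail of the total mark collected at
the origin over all time, a geometric sum: `r ^ ⌊s⌋` for unit marks, `exp (-(1 - r) s)` for
exponential ones. Heuristically, the walk discovers about `γ n` sites, each new site starts a fresh
local time, and exceedances are rare and almost disjoint.

The upper bound (`measureReal_maxEvent_le`) is a union bound over first visits; the mean number of
new sites is computed exactly.

For the lower bound, time is cut into independent blocks of length about `m ^ 7`, `m = ⌈s⌉`, and
Bonferroni's inequality is applied in one block (`exists_block_bound`). Two facts make this work.
First, stopping each local time after about `m ^ 6` steps costs little, because the probability of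
return within `M` steps converges at rate `M ^ (-1/2)`, a consequence of the heat kernel bound for
`d ≥ 3`. Second, two given sites both exceed `s` with probability exponentially smaller than `T(r,
s)` (`exists_pair_bound`), so polynomially many pairs are harmless: if `q ≤ r` is the probability of
ever hitting one of the two sites from the other, the pair is revisited with probability `(r + q) /
(1 + q) ≤ 2 r / (1 + r)`. Blocks are recombined through `1 - (1 - p) ^ N ≥ N p / (1 + N p)`.

In continuous time the number of jumps up to `t` lies between `(1 - ε) t` and `(1 + ε) t` outside an
event of exponentially small probability, while the target decays only polynomially. As `ε` is
arbitrary, the estimate transfers. -/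

namespace RandomWalk

/-! ### I.i.d. sequences and their shifts -/

section Sequences

variable {E : Type*}

/-- The sequence `z` with its first `k` terms removed. -/
def shift (k : ℕ) (z : ℕ → E) : ℕ → E := fun n => z (k + n)

/-- The sequence with first term `a`, followed by `z`. -/
def consSeq (a : E) (z : ℕ → E) : ℕ → E
  | 0 => a
  | n + 1 => z n

@[simp] lemma consSeq_zero (a : E) (z : ℕ → E) : consSeq a z 0 = a := rfl

@[simp] lemma consSeq_succ (a : E) (z : ℕ → E) (n : ℕ) : consSeq a z (n + 1) = z n := rfl

lemma consSeq_shift (z : ℕ → E) : consSeq (z 0) (shift 1 z) = z := by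
  ext n
  cases n with
  | zero => rfl
  | succ n => simp [shift, add_comm]

@[simp] lemma shift_one_consSeq (a : E) (z : ℕ → E) : shift 1 (consSeq a z) = z := by
  ext n
  simp [shift, add_comm]

lemma shift_succ_consSeq (k : ℕ) (a : E) (z : ℕ → E) :
    shift (k + 1) (consSeq a z) = shift k z := by
  ext n
  simp only [shift]
  rw [show k + 1 + n = (k + n) + 1 by ring, consSeq_succ]

lemma shift_shift (j k : ℕ) (z : ℕ → E) : shift k (shift j z) = shift (j + k) z := by
  ext n
  simp [shift, add_assoc]

@[simp] lemma shift_zero (z : ℕ → E) : shift 0 z = z := by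
  ext n
  simp [shift]

variable [MeasurableSpace E]

@[fun_prop]
lemma measurable_shift (k : ℕ) : Measurable (shift k : (ℕ → E) → ℕ → E) := by
  unfold shift
  fun_prop

lemma measurable_consSeq : Measurable (fun p : E × (ℕ → E) => consSeq p.1 p.2) := by
  refine measurable_pi_iff.2 fun n => ?_
  cases n with
  | zero => exact measurable_fst
  | succ n => exact (measurable_pi_apply n).comp measurable_snd

/-- `Q` is the law of a sequence of independent variables with common law `ρ`. -/
structure IsIIDLaw (Q : Measure (ℕ → E)) (ρ : Measure E) : Prop where
  prob : IsProbabilityMeasure Q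
  prob_marginal : IsProbabilityMeasure ρ
  -- This one-step self-similarity is all that is used of independence: conditioning on the first
  -- term, stationarity and independence of past and future follow from it.
  split : MeasurePreserving (fun z : ℕ → E => (z 0, shift 1 z)) Q (ρ.prod Q)

variable {Q : Measure (ℕ → E)} {ρ : Measure E}

lemma IsIIDLaw.map_consSeq (h : IsIIDLaw Q ρ) :
    MeasurePreserving (fun p : E × (ℕ → E) => consSeq p.1 p.2) (ρ.prod Q) Q := by
  refine ⟨measurable_consSeq, ?_⟩
  rw [← h.split.map_eq, Measure.map_map measurable_consSeq h.split.measurable]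
  convert Measure.map_id using 2
  ext1 z
  exact consSeq_shift z

lemma IsIIDLaw.lintegral_eq (h : IsIIDLaw Q ρ) {f : (ℕ → E) → ℝ≥0∞} (hf : Measurable f) :
    ∫⁻ z, f z ∂Q = ∫⁻ a, ∫⁻ z, f (consSeq a z) ∂Q ∂ρ := by
  have := h.prob
  have := h.prob_marginal
  rw [← h.map_consSeq.map_eq, lintegral_map hf measurable_consSeq, h.map_consSeq.map_eq,
    lintegral_prod (fun p : E × (ℕ → E) => f (consSeq p.1 p.2))
      (hf.comp measurable_consSeq).aemeasurable]

lemma IsIIDLaw.measure_eq (h : IsIIDLaw Q ρ) {A : Set (ℕ → E)} (hA : MeasurableSet A) :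
    Q A = ∫⁻ a, Q {z | consSeq a z ∈ A} ∂ρ := by
  have := h.prob
  have := h.prob_marginal
  rw [← h.map_consSeq.measure_preimage hA.nullMeasurableSet,
    Measure.prod_apply (measurable_consSeq hA)]
  rfl

lemma IsIIDLaw.measureReal_eq (h : IsIIDLaw Q ρ) {A : Set (ℕ → E)} (hA : MeasurableSet A) :
    Q.real A = ∫ a, Q.real {z | consSeq a z ∈ A} ∂ρ := by
  have := h.prob
  have := h.prob_marginal
  have hm : Measurable fun a => Q {z | consSeq a z ∈ A} :=
    measurable_measure_prodMk_left (ν := Q) (measurable_consSeq hA)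
  rw [integral_eq_lintegral_of_nonneg_ae (.of_forall fun _ => measureReal_nonneg)
    hm.ennreal_toReal.aestronglyMeasurable, measureReal_def, h.measure_eq hA]
  congr 1
  refine lintegral_congr fun a => ?_
  simp

lemma IsIIDLaw.integrable_section (h : IsIIDLaw Q ρ) {A : Set (ℕ → E)} (hA : MeasurableSet A) :
    Integrable (fun a => Q.real {z | consSeq a z ∈ A}) ρ := by
  have := h.prob
  have := h.prob_marginal
  have hm : Measurable fun a => Q {z | consSeq a z ∈ A} :=
    measurable_measure_prodMk_left (ν := Q) (measurable_consSeq hA)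
  refine Integrable.of_bound hm.ennreal_toReal.aestronglyMeasurable 1 (.of_forall fun a => ?_)
  rw [Real.norm_of_nonneg measureReal_nonneg]
  exact measureReal_le_one

lemma IsIIDLaw.measurePreserving_shift (h : IsIIDLaw Q ρ) (k : ℕ) :
    MeasurePreserving (shift k : (ℕ → E) → ℕ → E) Q Q := by
  have := h.prob
  have := h.prob_marginal
  induction k with
  | zero =>
    convert MeasurePreserving.id Q
    exact funext shift_zero
  | succ k ih =>
    have h1 : MeasurePreserving (shift 1 : (ℕ → E) → ℕ → E) Q Q :=
      measurePreserving_snd.comp h.split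
    have h2 := h1.comp ih
    convert h2
    exact funext fun z => (shift_shift k 1 z).symm

/-- The past up to time `k` is independent of the future after time `k`. -/
lemma IsIIDLaw.measure_inter_shift (h : IsIIDLaw Q ρ) (k : ℕ) {A B : Set (ℕ → E)}
    (hA : MeasurableSet A) (hB : MeasurableSet B)
    (hdep : ∀ z w, (∀ j < k, z j = w j) → z ∈ A → w ∈ A) :
    Q (A ∩ shift k ⁻¹' B) = Q A * Q B := by
  have := h.prob
  have := h.prob_marginal
  induction k generalizing A with
  | zero =>
    by_cases hne : A.Nonempty
    · obtain ⟨z, hz⟩ := hne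
      have : A = Set.univ := Set.eq_univ_of_forall fun w => hdep z w (by simp) hz
      subst this
      have e : (shift 0 ⁻¹' B : Set (ℕ → E)) = B := by ext z; simp
      simp [e]
    · rw [Set.not_nonempty_iff_eq_empty.1 hne]
      simp
  | succ k ih =>
    -- Conditioning on the first term turns `A` into an event depending on `k` terms of the
    -- remaining sequence, and `shift (k + 1)` into `shift k`.
    rw [h.measure_eq (hA.inter (measurable_shift _ hB)), h.measure_eq hA,
      ← lintegral_mul_const']
    · refine lintegral_congr fun a => ?_
      have hm : Measurable (consSeq a : (ℕ → E) → ℕ → E) :=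
        measurable_consSeq.comp measurable_prodMk_left
      rw [← ih (A := {z | consSeq a z ∈ A}) (hm hA)]
      · congr 1
        ext z
        simp [shift_succ_consSeq]
      · intro z w hzw hz
        refine hdep _ _ (fun j hj => ?_) hz
        cases j with
        | zero => rfl
        | succ j => exact hzw j (by omega)
    · exact measure_ne_top _ _

lemma IsIIDLaw.measureReal_inter_shift (h : IsIIDLaw Q ρ) (k : ℕ) {A B : Set (ℕ → E)}
    (hA : MeasurableSet A) (hB : MeasurableSet B)
    (hdep : ∀ z w, (∀ j < k, z j = w j) → z ∈ A → w ∈ A) :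
    Q.real (A ∩ shift k ⁻¹' B) = Q.real A * Q.real B := by
  simp only [measureReal_def, h.measure_inter_shift k hA hB hdep, ENNReal.toReal_mul]

/-- A cylinder is padded with `Set.univ` to an initial segment of coordinates, so that the factor of
index 0 splits off; the splitting map inverts `consSeq`. -/
lemma isIIDLaw_infinitePi (p : Measure E) [IsProbabilityMeasure p] :
    IsIIDLaw (Measure.infinitePi fun _ : ℕ => p) p := by
  refine ⟨inferInstance, inferInstance, ?_⟩
  have key : (p.prod (Measure.infinitePi fun _ : ℕ => p)).map
      (fun q : E × (ℕ → E) => consSeq q.1 q.2) = Measure.infinitePi fun _ : ℕ => p := by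
    refine Measure.eq_infinitePi _ fun s t ht => ?_
    classical
    obtain ⟨N, hN⟩ := s.exists_nat_subset_range
    set t' : ℕ → Set E := fun i => if i ∈ s then t i else Set.univ with ht'
    have hN' : s ⊆ Finset.range (N + 1) := hN.trans (Finset.range_mono (Nat.le_succ N))
    have hprod : ∏ i ∈ s, p (t i) = ∏ i ∈ Finset.range (N + 1), p (t' i) := by
      rw [← Finset.prod_subset hN' (f := fun i => p (t' i))]
      · exact Finset.prod_congr rfl fun i hi => by simp [ht', hi]
      · intro i _ hi
        simp [ht', hi]
    have hmt' : ∀ i, MeasurableSet (t' i) := fun i => by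
      by_cases hi : i ∈ s <;> simp [ht', hi, ht]
    rw [hprod, Finset.prod_range_succ', Measure.map_apply measurable_consSeq
      (MeasurableSet.pi s.countable_toSet fun i _ => ht i)]
    have : (fun q : E × (ℕ → E) => consSeq q.1 q.2) ⁻¹' (Set.pi s t)
        = t' 0 ×ˢ Set.pi (Finset.range N : Set ℕ) (fun i => t' (i + 1)) := by
      ext ⟨a, w⟩
      simp only [Set.mem_preimage, Set.mem_pi, Set.mem_prod, Finset.mem_coe, Finset.mem_range]
      constructor
      · intro hh
        refine ⟨?_, fun i _ => ?_⟩
        · by_cases h0 : 0 ∈ s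
          · simpa [ht', h0] using hh 0 h0
          · simp [ht', h0]
        · by_cases h0 : i + 1 ∈ s
          · simpa [ht', h0] using hh (i + 1) h0
          · simp [ht', h0]
      · rintro ⟨h1, h2⟩ i hi
        cases i with
        | zero => simpa [ht', hi] using h1
        | succ i =>
          have := h2 i (by have := Finset.mem_range.1 (hN' hi); omega)
          simpa [ht', hi] using this
    rw [this, Measure.prod_prod, Measure.infinitePi_pi _ (fun i _ => hmt' _), mul_comm]
  have h2 : MeasurePreserving (fun q : E × (ℕ → E) => consSeq q.1 q.2)
      (p.prod (Measure.infinitePi fun _ : ℕ => p)) (Measure.infinitePi fun _ : ℕ => p) :=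
    ⟨measurable_consSeq, key⟩
  refine ⟨by fun_prop, ?_⟩
  nth_rewrite 1 [← key]
  rw [Measure.map_map (by fun_prop) measurable_consSeq]
  convert Measure.map_id using 2
  ext1 q
  simp

/-- Zipping two independent i.i.d. sequences gives an i.i.d. sequence. -/
lemma IsIIDLaw.zip {F : Type*} [MeasurableSpace F] {P : Measure (ℕ → F)} {σ : Measure F}
    (h : IsIIDLaw Q ρ) (h' : IsIIDLaw P σ) :
    IsIIDLaw ((Q.prod P).map fun q n => (q.1 n, q.2 n)) (ρ.prod σ) := by
  have := h.prob
  have := h.prob_marginal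
  have := h'.prob
  have := h'.prob_marginal
  have hz : Measurable (fun (q : (ℕ → E) × (ℕ → F)) (n : ℕ) => (q.1 n, q.2 n)) := by fun_prop
  refine ⟨Measure.isProbabilityMeasure_map hz.aemeasurable, inferInstance, by fun_prop, ?_⟩
  have hZ : MeasurePreserving (fun (q : (ℕ → E) × (ℕ → F)) (n : ℕ) => (q.1 n, q.2 n))
    (Q.prod P) ((Q.prod P).map fun q n => (q.1 n, q.2 n)) := ⟨hz, rfl⟩
  have h1 := h.split.prod h'.split
  -- Exchanging the two middle factors preserves the product measure; it suffices to compare on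
  -- products of rectangles.
  have h2 : MeasurePreserving (fun q : (E × (ℕ → E)) × (F × (ℕ → F)) =>
      ((q.1.1, q.2.1), (q.1.2, q.2.2))) ((ρ.prod Q).prod (σ.prod P))
      ((ρ.prod σ).prod (Q.prod P)) := by
    refine ⟨by fun_prop, ?_⟩
    have hspan : ∀ {α β : Type _} [MeasurableSpace α] [MeasurableSpace β] (m : Measure (α × β))
        [IsFiniteMeasure m], m.FiniteSpanningSetsIn
          (Set.image2 (· ×ˢ ·) {s : Set α | MeasurableSet s} {t : Set β | MeasurableSet t}) := by
      intro α β _ _ m _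
      exact ⟨fun _ => Set.univ, fun _ => ⟨Set.univ, MeasurableSet.univ, Set.univ,
        MeasurableSet.univ, by simp⟩, fun _ => measure_lt_top _ _, by simp [Set.iUnion_const]⟩
    refine (Measure.prod_eq_generateFrom generateFrom_prod generateFrom_prod isPiSystem_prod
      isPiSystem_prod (hspan _) (hspan _) ?_).symm
    · rintro _ ⟨a, ha, b, hb, rfl⟩ _ ⟨a', ha', b', hb', rfl⟩
      simp only [Set.mem_ofPred_eq] at ha hb ha' hb'
      rw [Measure.map_apply (by fun_prop) ((ha.prod hb).prod (ha'.prod hb'))]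
      have : (fun q : (E × (ℕ → E)) × (F × (ℕ → F)) => ((q.1.1, q.2.1), (q.1.2, q.2.2))) ⁻¹'
          ((a ×ˢ b) ×ˢ (a' ×ˢ b')) = (a ×ˢ a') ×ˢ (b ×ˢ b') := by
        ext ⟨⟨_, _⟩, ⟨_, _⟩⟩
        simp
        tauto
      rw [this]
      simp only [Measure.prod_prod]
      ring
  have h3 := ((MeasurePreserving.id (ρ.prod σ)).prod hZ).comp (h2.comp h1)
  rw [Measure.map_map (by fun_prop) hz]
  exact h3.map_eq

end Sequences

/-! ### The averaging operator of the walk -/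

section Average

variable {d : ℕ}

/-- The mean of `f` over the `2d` lattice neighbours of `x`. -/
noncomputable def avg (f : (Fin d → ℤ) → ℝ) (x : Fin d → ℤ) : ℝ :=
  (2 * (d : ℝ))⁻¹ * ∑ i, (f (x + Pi.single i 1) + f (x - Pi.single i 1))

lemma avg_mono {f g : (Fin d → ℤ) → ℝ} (h : ∀ x, f x ≤ g x) (x : Fin d → ℤ) :
    avg f x ≤ avg g x := by
  unfold avg
  gcongr <;> apply h

lemma avg_nonneg {f : (Fin d → ℤ) → ℝ} (h : ∀ x, 0 ≤ f x) (x : Fin d → ℤ) : 0 ≤ avg f x := by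
  unfold avg
  exact mul_nonneg (by positivity) (Finset.sum_nonneg fun i _ => add_nonneg (h _) (h _))

lemma avg_const (hd : d ≠ 0) (c : ℝ) (x : Fin d → ℤ) : avg (fun _ => c) x = c := by
  have : (d : ℝ) ≠ 0 := by exact_mod_cast hd
  simp only [avg, Finset.sum_const, Finset.card_univ, Fintype.card_fin, nsmul_eq_mul]
  field_simp
  ring

lemma avg_add (f g : (Fin d → ℤ) → ℝ) (x : Fin d → ℤ) :
    avg (fun y => f y + g y) x = avg f x + avg g x := by
  simp only [avg, ← mul_add, ← Finset.sum_add_distrib]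
  congr 1
  exact Finset.sum_congr rfl fun i _ => by ring

lemma avg_const_mul (c : ℝ) (f : (Fin d → ℤ) → ℝ) (x : Fin d → ℤ) :
    avg (fun y => c * f y) x = c * avg f x := by
  simp only [avg, Finset.mul_sum]
  exact Finset.sum_congr rfl fun i _ => by ring

lemma avg_mul_const (c : ℝ) (f : (Fin d → ℤ) → ℝ) (x : Fin d → ℤ) :
    avg (fun y => f y * c) x = avg f x * c := by
  simp only [mul_comm _ c, avg_const_mul]

lemma avg_comp_add (f : (Fin d → ℤ) → ℝ) (a x : Fin d → ℤ) :
    avg (fun y => f (a + y)) x = avg f (a + x) := by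
  simp only [avg, add_assoc, add_sub_assoc]

lemma avg_comp_sub (f : (Fin d → ℤ) → ℝ) (a x : Fin d → ℤ) :
    avg (fun y => f (y - a)) x = avg f (x - a) := by
  have := avg_comp_add f (-a) x
  simpa only [neg_add_eq_sub] using this

lemma avg_comp_neg (f : (Fin d → ℤ) → ℝ) (x : Fin d → ℤ) :
    avg (fun y => f (-y)) x = avg f (-x) := by
  simp only [avg, neg_add', neg_sub', add_comm, sub_neg_eq_add]

lemma avg_comp_perm (f : (Fin d → ℤ) → ℝ) (σ : Equiv.Perm (Fin d)) (x : Fin d → ℤ) :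
    avg (fun y => f (y ∘ σ)) x = avg f (x ∘ σ) := by
  have h (i : Fin d) : (Pi.single i (1 : ℤ)) ∘ σ = Pi.single (σ.symm i) (1 : ℤ) := by
    ext j
    simp [Pi.single_apply, Equiv.eq_symm_apply]
  have h1 (i : Fin d) : (x + Pi.single i (1 : ℤ)) ∘ σ = x ∘ σ + Pi.single (σ.symm i) (1 : ℤ) := by
    rw [← h]; rfl
  have h2 (i : Fin d) : (x - Pi.single i (1 : ℤ)) ∘ σ = x ∘ σ - Pi.single (σ.symm i) (1 : ℤ) := by
    rw [← h]; rfl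
  simp only [avg, h1, h2]
  congr 1
  exact Equiv.sum_comp σ.symm
    (fun i => f (x ∘ σ + Pi.single i (1 : ℤ)) + f (x ∘ σ - Pi.single i (1 : ℤ)))

lemma tendsto_avg {f : ℕ → (Fin d → ℤ) → ℝ} {g : (Fin d → ℤ) → ℝ}
    (h : ∀ x, Tendsto (fun n => f n x) atTop (nhds (g x))) (x : Fin d → ℤ) :
    Tendsto (fun n => avg (f n) x) atTop (nhds (avg g x)) :=
  (tendsto_finsetSum _ fun _ _ => (h _).add (h _)).const_mul _

lemma isProbabilityMeasure_stepLaw (hd : d ≠ 0) : IsProbabilityMeasure (stepLaw d) := by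
  constructor
  have : (d : ℝ≥0∞) ≠ 0 := by exact_mod_cast hd
  simp only [stepLaw, Measure.smul_apply, Measure.finsetSum_apply, Measure.add_apply,
    measure_univ, Finset.sum_const, Finset.card_univ, Fintype.card_fin, smul_eq_mul, nsmul_eq_mul]
  rw [one_add_one_eq_two, mul_comm (d : ℝ≥0∞)]
  exact ENNReal.inv_mul_cancel (mul_ne_zero two_ne_zero this)
    (ENNReal.mul_ne_top (by simp) (by simp))

lemma lintegral_stepLaw (f : (Fin d → ℤ) → ℝ≥0∞) :
    ∫⁻ e, f e ∂(stepLaw d)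
      = (2 * (d : ℝ≥0∞))⁻¹ * ∑ i, (f (Pi.single i 1) + f (-Pi.single i 1)) := by
  simp only [stepLaw, lintegral_smul_measure, lintegral_finsetSum_measure, lintegral_add_measure,
    lintegral_dirac, smul_eq_mul]

lemma lintegral_stepLaw_ofReal (hd : d ≠ 0) {f : (Fin d → ℤ) → ℝ} (hf : ∀ x, 0 ≤ f x) :
    ∫⁻ e, ENNReal.ofReal (f e) ∂(stepLaw d) = ENNReal.ofReal (avg f 0) := by
  have hd' : (0 : ℝ) < 2 * d := by have := Nat.pos_of_ne_zero hd; positivity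
  simp only [lintegral_stepLaw, avg, zero_add, zero_sub]
  rw [ENNReal.ofReal_mul (by positivity), ENNReal.ofReal_inv_of_pos hd',
    ENNReal.ofReal_sum_of_nonneg fun i _ => add_nonneg (hf _) (hf _),
    ENNReal.ofReal_mul (by norm_num)]
  simp only [ENNReal.ofReal_add (hf _) (hf _), ENNReal.ofReal_natCast, ENNReal.ofReal_ofNat]

lemma integral_stepLaw (hd : d ≠ 0) {f : (Fin d → ℤ) → ℝ} (hf : ∀ x, 0 ≤ f x) :
    ∫ e, f e ∂(stepLaw d) = avg f 0 := by
  rw [integral_eq_lintegral_of_nonneg_ae (.of_forall hf)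
    (Measurable.of_discrete).aestronglyMeasurable, lintegral_stepLaw_ofReal hd hf,
    ENNReal.toReal_ofReal (avg_nonneg hf 0)]

end Average

/-! ### Hitting and return probabilities as functions on the lattice -/

section Hitting

variable {d : ℕ}

/-- The probability that the walk started at `x` visits `0` before time `n`. -/
noncomputable def hit : ℕ → (Fin d → ℤ) → ℝ
  | 0, _ => 0
  | n + 1, x => if x = 0 then 1 else avg (hit n) x

lemma hit_succ (n : ℕ) (x : Fin d → ℤ) :
    hit (n + 1) x = if x = 0 then 1 else avg (hit n) x := rfl

lemma hit_nonneg (n : ℕ) (x : Fin d → ℤ) : 0 ≤ hit n x := by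
  induction n generalizing x with
  | zero => exact le_rfl
  | succ n ih =>
    rw [hit_succ]
    split_ifs
    · exact zero_le_one
    · exact avg_nonneg ih x

lemma hit_le_one (hd : d ≠ 0) (n : ℕ) (x : Fin d → ℤ) : hit n x ≤ 1 := by
  induction n generalizing x with
  | zero => exact zero_le_one
  | succ n ih =>
    rw [hit_succ]
    split_ifs
    · exact le_rfl
    · exact (avg_mono ih x).trans (avg_const hd 1 x).le

lemma hit_le_succ (n : ℕ) (x : Fin d → ℤ) : hit n x ≤ hit (n + 1) x := by
  induction n generalizing x with
  | zero => exact hit_nonneg _ _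
  | succ n ih =>
    rw [hit_succ, hit_succ (n + 1)]
    split_ifs
    · exact le_rfl
    · exact avg_mono ih x

lemma monotone_hit (x : Fin d → ℤ) : Monotone fun n => hit n x :=
  monotone_nat_of_le_succ fun n => hit_le_succ n x

lemma hit_neg (n : ℕ) (x : Fin d → ℤ) : hit n (-x) = hit n x := by
  induction n generalizing x with
  | zero => rfl
  | succ n ih =>
    simp only [hit_succ, neg_eq_zero]
    rw [← avg_comp_neg, show (fun y => hit n (-y)) = hit n from funext ih]

lemma hit_perm (n : ℕ) (σ : Equiv.Perm (Fin d)) (x : Fin d → ℤ) :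
    hit n (x ∘ σ) = hit n x := by
  induction n generalizing x with
  | zero => rfl
  | succ n ih =>
    have : x ∘ σ = 0 ↔ x = 0 := by
      constructor
      · intro h
        ext i
        simpa using congrFun h (σ.symm i)
      · rintro rfl
        rfl
    simp only [hit_succ, this]
    rw [← avg_comp_perm, show (fun y : Fin d → ℤ => hit n (y ∘ σ)) = hit n from funext ih]

lemma hit_single (n : ℕ) (i j : Fin d) :
    hit n (Pi.single i (1 : ℤ)) = hit n (Pi.single j (1 : ℤ)) := by
  rw [← hit_perm n (Equiv.swap i j) (Pi.single i (1 : ℤ))]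
  congr 1
  ext k
  simp only [Function.comp, Pi.single_apply]
  congr 1
  rw [Equiv.swap_apply_eq_iff, Equiv.swap_apply_left]

/-- The probability that the walk returns to its starting point within `n` steps. -/
noncomputable def returnProb (d n : ℕ) : ℝ := avg (d := d) (hit n) 0

/-- Reflection and permutation of coordinates make all `2d` neighbours of the origin equivalent, so
the average over them is any one of the values. -/
lemma hit_single_eq_returnProb (n : ℕ) (i : Fin d) :
    hit n (Pi.single i (1 : ℤ)) = returnProb d n := by
  have hd : d ≠ 0 := fun h => by subst h; exact i.elim0
  have : (d : ℝ) ≠ 0 := by exact_mod_cast hd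
  simp only [returnProb, avg, zero_add, zero_sub, hit_neg, hit_single n _ i, Finset.sum_const,
    Finset.card_univ, Fintype.card_fin, nsmul_eq_mul]
  field_simp
  ring

lemma returnProb_mono : Monotone (returnProb d) :=
  fun _ _ h => avg_mono (fun x => monotone_hit x h) 0

lemma returnProb_nonneg (n : ℕ) : 0 ≤ returnProb d n := avg_nonneg (hit_nonneg n) 0

lemma returnProb_le_one (hd : d ≠ 0) (n : ℕ) : returnProb d n ≤ 1 :=
  (avg_mono (hit_le_one hd n) 0).trans (avg_const hd 1 0).le

/-- One step out and one step back. -/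
lemma returnProb_two_pos (hd : d ≠ 0) : 0 < returnProb d 2 := by
  have hd' : 0 < (d : ℝ) := by exact_mod_cast Nat.pos_of_ne_zero hd
  set i : Fin d := ⟨0, Nat.pos_of_ne_zero hd⟩
  rw [← hit_single_eq_returnProb 2 i, hit_succ]
  split_ifs
  · exact one_pos
  · refine mul_pos (by positivity) (Finset.sum_pos' (fun j _ =>
      add_nonneg (hit_nonneg _ _) (hit_nonneg _ _)) ⟨i, Finset.mem_univ _, ?_⟩)
    simp only [sub_self]
    exact add_pos_of_nonneg_of_pos (hit_nonneg _ _) (by simp [hit_succ])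

/-- Away from the origin the hitting probability is at most the return probability. -/
lemma hit_le_returnProb (hd : d ≠ 0) (n : ℕ) {x : Fin d → ℤ} (hx : x ≠ 0) :
    hit n x ≤ returnProb d n := by
  induction n generalizing x with
  | zero => exact returnProb_nonneg 0
  | succ n ih =>
    by_cases hnb : ∃ i : Fin d, x = Pi.single i 1 ∨ x = -Pi.single i 1
    · obtain ⟨i, rfl | rfl⟩ := hnb
      · exact (hit_single_eq_returnProb _ i).le
      · rw [hit_neg]
        exact (hit_single_eq_returnProb _ i).le
    -- A nonzero point that is not a neighbour of the origin has only nonzero neighbours, so the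
    -- induction hypothesis bounds every term of the average.
    · push Not at hnb
      rw [hit_succ, if_neg hx]
      refine le_trans ?_ (returnProb_mono (Nat.le_succ n))
      rw [← avg_const hd (returnProb d n) x]
      unfold avg
      gcongr with i
      · refine ih fun h => (hnb i).2 ?_
        exact eq_neg_of_add_eq_zero_left h
      · refine ih fun h => (hnb i).1 ?_
        exact sub_eq_zero.1 h

/-- The probability that the walk started at `x` ever visits `0`. -/
noncomputable def hitProb (x : Fin d → ℤ) : ℝ := ⨆ n, hit n x

lemma bddAbove_hit (hd : d ≠ 0) (x : Fin d → ℤ) : BddAbove (Set.range fun n => hit n x) :=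
  ⟨1, by rintro _ ⟨n, rfl⟩; exact hit_le_one hd n x⟩

lemma tendsto_hit (hd : d ≠ 0) (x : Fin d → ℤ) :
    Tendsto (fun n => hit n x) atTop (nhds (hitProb x)) :=
  tendsto_atTop_ciSup (monotone_hit x) (bddAbove_hit hd x)

lemma hit_le_hitProb (hd : d ≠ 0) (n : ℕ) (x : Fin d → ℤ) : hit n x ≤ hitProb x :=
  le_ciSup (bddAbove_hit hd x) n

lemma hitProb_nonneg (hd : d ≠ 0) (x : Fin d → ℤ) : 0 ≤ hitProb x :=
  (hit_nonneg 0 x).trans (hit_le_hitProb hd 0 x)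

lemma hitProb_eq (hd : d ≠ 0) (x : Fin d → ℤ) :
    hitProb x = if x = 0 then 1 else avg hitProb x := by
  have h1 := (tendsto_hit hd x).comp (tendsto_add_atTop_nat 1)
  refine tendsto_nhds_unique h1 ?_
  simp only [Function.comp_def, hit_succ]
  split_ifs
  · exact tendsto_const_nhds
  · exact tendsto_avg (tendsto_hit hd) x

lemma hitProb_zero (hd : d ≠ 0) : hitProb (0 : Fin d → ℤ) = 1 := by
  rw [hitProb_eq hd, if_pos rfl]

lemma avg_hitProb (hd : d ≠ 0) {x : Fin d → ℤ} (hx : x ≠ 0) : avg hitProb x = hitProb x := by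
  rw [hitProb_eq hd x, if_neg hx]

lemma hitProb_neg (x : Fin d → ℤ) : hitProb (-x) = hitProb x := by
  simp only [hitProb, hit_neg]

/-- The probability that the walk ever returns to its starting point. -/
noncomputable def returnProbTop (d : ℕ) : ℝ := avg (d := d) hitProb 0

lemma tendsto_returnProb (hd : d ≠ 0) :
    Tendsto (returnProb d) atTop (nhds (returnProbTop d)) :=
  tendsto_avg (tendsto_hit hd) 0

lemma returnProb_le_returnProbTop (hd : d ≠ 0) (n : ℕ) : returnProb d n ≤ returnProbTop d :=
  returnProb_mono.ge_of_tendsto (tendsto_returnProb hd) n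

lemma returnProbTop_pos (hd : d ≠ 0) : 0 < returnProbTop d :=
  (returnProb_two_pos hd).trans_le (returnProb_le_returnProbTop hd 2)

lemma hitProb_le_returnProbTop (hd : d ≠ 0) {x : Fin d → ℤ} (hx : x ≠ 0) :
    hitProb x ≤ returnProbTop d :=
  ciSup_le fun n => (hit_le_returnProb hd n hx).trans (returnProb_le_returnProbTop hd n)

end Hitting

/-! ### Marked paths, their positions and occupation sums -/

section Paths

variable {d : ℕ}

/-- The position at time `k` of the walk with steps `(z j).1`, started at `0`. -/
def pos (z : ℕ → (Fin d → ℤ) × ℝ) (k : ℕ) : Fin d → ℤ := ∑ j ∈ Finset.range k, (z j).1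

/-- The total mark `(z k).2`, weighted by `f`, collected by the walk before time `n`. -/
def occ (z : ℕ → (Fin d → ℤ) × ℝ) (n : ℕ) (f : (Fin d → ℤ) → ℝ) : ℝ :=
  ∑ k ∈ Finset.range n, f (pos z k) * (z k).2

@[simp] lemma pos_zero (z : ℕ → (Fin d → ℤ) × ℝ) : pos z 0 = 0 := by simp [pos]

@[simp] lemma occ_zero (z : ℕ → (Fin d → ℤ) × ℝ) (f : (Fin d → ℤ) → ℝ) : occ z 0 f = 0 := by
  simp [occ]

lemma pos_consSeq (a : (Fin d → ℤ) × ℝ) (z : ℕ → (Fin d → ℤ) × ℝ) (k : ℕ) :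
    pos (consSeq a z) (k + 1) = a.1 + pos z k := by
  simp [pos, Finset.sum_range_succ', add_comm]

lemma pos_add (z : ℕ → (Fin d → ℤ) × ℝ) (j k : ℕ) :
    pos z (j + k) = pos z j + pos (shift j z) k := by
  simp [pos, Finset.sum_range_add, shift]

lemma occ_consSeq (a : (Fin d → ℤ) × ℝ) (z : ℕ → (Fin d → ℤ) × ℝ) (n : ℕ)
    (f : (Fin d → ℤ) → ℝ) :
    occ (consSeq a z) (n + 1) f = f 0 * a.2 + occ z n fun y => f (a.1 + y) := by
  simp only [occ, Finset.sum_range_succ', pos_consSeq, consSeq_succ, pos_zero, consSeq_zero]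
  rw [add_comm]

lemma occ_add (z : ℕ → (Fin d → ℤ) × ℝ) (j n : ℕ) (f : (Fin d → ℤ) → ℝ) :
    occ z (j + n) f = occ z j f + occ (shift j z) n fun y => f (pos z j + y) := by
  simp [occ, Finset.sum_range_add, pos_add, shift]

lemma occ_mono {z : ℕ → (Fin d → ℤ) × ℝ} (hz : ∀ k, 0 ≤ (z k).2) {m n : ℕ} (hmn : m ≤ n)
    {f : (Fin d → ℤ) → ℝ} (hf : ∀ x, 0 ≤ f x) : occ z m f ≤ occ z n f :=
  Finset.sum_le_sum_of_subset_of_nonneg (Finset.range_mono hmn)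
    fun k _ _ => mul_nonneg (hf _) (hz k)

lemma occ_nonneg {z : ℕ → (Fin d → ℤ) × ℝ} (hz : ∀ k, 0 ≤ (z k).2) (n : ℕ)
    {f : (Fin d → ℤ) → ℝ} (hf : ∀ x, 0 ≤ f x) : 0 ≤ occ z n f :=
  Finset.sum_nonneg fun k _ => mul_nonneg (hf _) (hz k)

@[fun_prop]
lemma measurable_pos (k : ℕ) : Measurable fun z : ℕ → (Fin d → ℤ) × ℝ => pos z k := by
  unfold pos
  fun_prop

@[fun_prop]
lemma measurable_occ (n : ℕ) (f : (Fin d → ℤ) → ℝ) :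
    Measurable fun z : ℕ → (Fin d → ℤ) × ℝ => occ z n f := by
  unfold occ
  refine Finset.measurable_sum _ fun k _ => Measurable.mul ?_ (by fun_prop)
  exact (Measurable.of_discrete (f := f)).comp (measurable_pos k)

lemma pos_congr {z w : ℕ → (Fin d → ℤ) × ℝ} {k : ℕ} (h : ∀ j < k, z j = w j) :
    pos z k = pos w k :=
  Finset.sum_congr rfl fun j hj => by rw [h j (Finset.mem_range.1 hj)]

lemma occ_congr {z w : ℕ → (Fin d → ℤ) × ℝ} {n : ℕ} (h : ∀ j < n, z j = w j)
    (f : (Fin d → ℤ) → ℝ) : occ z n f = occ w n f :=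
  Finset.sum_congr rfl fun j hj => by
    have hj := Finset.mem_range.1 hj
    rw [h j hj, pos_congr fun i hi => h i (hi.trans hj)]

/-- The indicator function of the point `x`. -/
def pt (x : Fin d → ℤ) : (Fin d → ℤ) → ℝ := fun y => if y = x then 1 else 0

lemma pt_nonneg (x y : Fin d → ℤ) : 0 ≤ pt x y := by
  unfold pt
  split_ifs <;> simp

lemma pt_comp_add (x a : Fin d → ℤ) : (fun y => pt x (a + y)) = pt (x - a) := by
  ext y
  simp only [pt, eq_sub_iff_add_eq, add_comm a y]

variable {Q : Measure (ℕ → (Fin d → ℤ) × ℝ)} {κ : Measure ℝ}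

lemma IsIIDLaw.measureReal_eq_avg (hd : d ≠ 0) (h : IsIIDLaw Q ((stepLaw d).prod κ))
    [IsProbabilityMeasure κ] {A : Set (ℕ → (Fin d → ℤ) × ℝ)} (hA : MeasurableSet A) :
    Q.real A = ∫ r, avg (fun e => Q.real {z | consSeq (e, r) z ∈ A}) 0 ∂κ := by
  have := isProbabilityMeasure_stepLaw hd
  rw [h.measureReal_eq hA, integral_prod_symm _ (h.integrable_section hA)]
  exact integral_congr_ae (.of_forall fun r => integral_stepLaw hd fun _ => measureReal_nonneg)

lemma integrable_avg (hd : d ≠ 0) (h : IsIIDLaw Q ((stepLaw d).prod κ))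
    [IsProbabilityMeasure κ] {A : Set (ℕ → (Fin d → ℤ) × ℝ)} (hA : MeasurableSet A) :
    Integrable (fun r => avg (fun e => Q.real {z | consSeq (e, r) z ∈ A}) 0) κ := by
  have := isProbabilityMeasure_stepLaw hd
  refine (h.integrable_section hA).integral_prod_right.congr (.of_forall fun r => ?_)
  exact integral_stepLaw hd fun _ => measureReal_nonneg

lemma measurableSet_pos_eq (k : ℕ) (x : Fin d → ℤ) :
    MeasurableSet {z : ℕ → (Fin d → ℤ) × ℝ | pos z k = x} :=
  measurable_pos k (MeasurableSet.singleton x)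

lemma measureReal_pos_succ (hd : d ≠ 0) (h : IsIIDLaw Q ((stepLaw d).prod κ))
    [IsProbabilityMeasure κ] (k : ℕ) (x : Fin d → ℤ) :
    Q.real {z | x + pos z (k + 1) = 0} = avg (fun y => Q.real {z | y + pos z k = 0}) x := by
  have hA (y : Fin d → ℤ) (k : ℕ) : MeasurableSet {z : ℕ → (Fin d → ℤ) × ℝ | y + pos z k = 0} :=
    (measurable_pos k) (MeasurableSet.of_discrete (s := {w | y + w = 0}))
  rw [h.measureReal_eq_avg hd (hA x (k + 1))]
  simp only [Set.mem_ofPred_eq, pos_consSeq, ← add_assoc]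
  rw [integral_const, avg_comp_add (fun y => Q.real {z | y + pos z k = 0})]
  simp

lemma measurableSet_hit (n : ℕ) (x : Fin d → ℤ) :
    MeasurableSet {z : ℕ → (Fin d → ℤ) × ℝ | ∃ k < n, x + pos z k = 0} := by
  have : {z : ℕ → (Fin d → ℤ) × ℝ | ∃ k < n, x + pos z k = 0}
      = ⋃ k ∈ Finset.range n, {z | pos z k = -x} := by
    ext z
    simp [add_eq_zero_iff_eq_neg']
  rw [this]
  exact Finset.measurableSet_biUnion _ fun k _ => measurableSet_pos_eq k _

/-- As `hit` is given by a recursion, hitting constants are the same for every mark law;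
conditioning on the first step identifies them with probabilities. -/
lemma measureReal_hit (hd : d ≠ 0) (h : IsIIDLaw Q ((stepLaw d).prod κ))
    [IsProbabilityMeasure κ] (n : ℕ) (x : Fin d → ℤ) :
    Q.real {z | ∃ k < n, x + pos z k = 0} = hit n x := by
  have := h.prob
  induction n generalizing x with
  | zero => simp [hit]
  | succ n ih =>
    rw [hit_succ]
    split_ifs with hx
    · rw [← probReal_univ (μ := Q)]
      congr 1
      refine Set.eq_univ_of_forall fun z => ⟨0, by omega, by simp [hx]⟩
    · rw [h.measureReal_eq_avg hd (measurableSet_hit _ _)]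
      have key (e : Fin d → ℤ) (r : ℝ) : Q.real {z | consSeq (e, r) z ∈
          {z : ℕ → (Fin d → ℤ) × ℝ | ∃ k < n + 1, x + pos z k = 0}} = hit n (x + e) := by
        rw [← ih]
        congr 1
        ext z
        constructor
        · rintro ⟨k, hk, h0⟩
          cases k with
          | zero => simp [hx] at h0
          | succ k => exact ⟨k, by omega, by rw [pos_consSeq] at h0; rw [← h0, add_assoc]⟩
        · rintro ⟨k, hk, h0⟩
          exact ⟨k + 1, by omega, by rw [pos_consSeq, ← h0, add_assoc]⟩
      simp only [key]
      rw [integral_const, avg_comp_add (hit n)]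
      simp

lemma measurableSet_return (n : ℕ) :
    MeasurableSet {z : ℕ → (Fin d → ℤ) × ℝ | ∃ k < n, pos z (k + 1) = 0} := by
  have : {z : ℕ → (Fin d → ℤ) × ℝ | ∃ k < n, pos z (k + 1) = 0}
      = ⋃ k ∈ Finset.range n, {z | pos z (k + 1) = 0} := by
    ext z
    simp
  rw [this]
  exact Finset.measurableSet_biUnion _ fun k _ => measurableSet_pos_eq _ _

lemma measureReal_return (hd : d ≠ 0) (h : IsIIDLaw Q ((stepLaw d).prod κ))
    [IsProbabilityMeasure κ] (n : ℕ) :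
    Q.real {z | ∃ k < n, pos z (k + 1) = 0} = returnProb d n := by
  rw [h.measureReal_eq_avg hd (measurableSet_return n)]
  simp only [Set.mem_ofPred_eq, pos_consSeq, measureReal_hit hd h]
  rw [integral_const]
  simp [returnProb]

lemma measureReal_return_top (hd : d ≠ 0) (h : IsIIDLaw Q ((stepLaw d).prod κ))
    [IsProbabilityMeasure κ] :
    Q.real {z | ∃ k, pos z (k + 1) = 0} = returnProbTop d := by
  have := h.prob
  have hmono : Monotone fun n => {z : ℕ → (Fin d → ℤ) × ℝ | ∃ k < n, pos z (k + 1) = 0} :=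
    fun m n hmn z ⟨k, hk, h0⟩ => ⟨k, hk.trans_le hmn, h0⟩
  have h1 := tendsto_measure_iUnion_atTop (μ := Q) hmono
  have h2 : (⋃ n, {z : ℕ → (Fin d → ℤ) × ℝ | ∃ k < n, pos z (k + 1) = 0})
      = {z | ∃ k, pos z (k + 1) = 0} := by
    ext z
    simp only [Set.mem_iUnion, Set.mem_ofPred_eq]
    exact ⟨fun ⟨n, k, _, h⟩ => ⟨k, h⟩, fun ⟨k, h⟩ => ⟨k + 1, k, by omega, h⟩⟩
  rw [h2] at h1
  have h3 := (ENNReal.tendsto_toReal (measure_ne_top Q _)).comp h1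
  refine tendsto_nhds_unique h3 ((tendsto_returnProb hd).congr fun n => ?_)
  exact (measureReal_return hd h n).symm

end Paths

/-! ### Fourier inversion and the heat kernel bound -/

section Fourier

variable {d : ℕ}

/-- Lebesgue measure on the torus `(-π, π]^d`. -/
noncomputable def torus (d : ℕ) : Measure (Fin d → ℝ) :=
  Measure.pi fun _ => volume.restrict (Set.Ioc (-Real.pi) Real.pi)

instance : IsFiniteMeasure (torus d) := by
  unfold torus
  infer_instance

/-- The scalar product of a frequency and a lattice point. -/
def phase (θ : Fin d → ℝ) (x : Fin d → ℤ) : ℝ := ∑ i, θ i * x i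

/-- The characteristic function of one step of the walk. -/
noncomputable def charStep (θ : Fin d → ℝ) : ℝ := (d : ℝ)⁻¹ * ∑ i, Real.cos (θ i)

@[fun_prop]
lemma continuous_phase (x : Fin d → ℤ) : Continuous fun θ : Fin d → ℝ => phase θ x := by
  unfold phase
  fun_prop

@[fun_prop]
lemma continuous_charStep : Continuous (charStep : (Fin d → ℝ) → ℝ) := by
  unfold charStep
  fun_prop

/-- Cosine waves are eigenfunctions of `avg`, since the sine terms of opposite neighbours cancel.
Hence `fourierInt` obeys the recursion of the transition probabilities. -/
lemma avg_cos_phase (θ : Fin d → ℝ) (x : Fin d → ℤ) :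
    avg (fun y => Real.cos (phase θ y)) x = charStep θ * Real.cos (phase θ x) := by
  have h1 (i : Fin d) : phase θ (x + Pi.single i 1) = phase θ x + θ i := by
    simp [phase, mul_add, Finset.sum_add_distrib, Pi.single_apply]
  have h2 (i : Fin d) : phase θ (x - Pi.single i 1) = phase θ x - θ i := by
    simp [phase, mul_sub, Finset.sum_sub_distrib, Pi.single_apply]
  simp only [avg, h1, h2, charStep, Real.cos_add, Real.cos_sub, mul_inv, Finset.mul_sum,
    Finset.sum_mul]
  exact Finset.sum_congr rfl fun i _ => by ring

lemma abs_charStep_le (θ : Fin d → ℝ) : |charStep θ| ≤ 1 := by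
  rcases Nat.eq_zero_or_pos d with rfl | hd
  · simp [charStep]
  have hd' : (0 : ℝ) < d := by exact_mod_cast hd
  rw [charStep, abs_mul, abs_of_pos (inv_pos.2 hd')]
  calc (d : ℝ)⁻¹ * |∑ i, Real.cos (θ i)| ≤ (d : ℝ)⁻¹ * ∑ _i : Fin d, (1 : ℝ) := by
        gcongr
        exact (Finset.abs_sum_le_sum_abs _ _).trans
          (Finset.sum_le_sum fun i _ => Real.abs_cos_le_one _)
    _ = 1 := by simp [hd'.ne']

lemma integrable_charStep_pow_mul_cos (k : ℕ) (x : Fin d → ℤ) :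
    Integrable (fun θ => charStep θ ^ k * Real.cos (phase θ x)) (torus d) := by
  refine Integrable.of_bound (Continuous.aestronglyMeasurable (by fun_prop)) 1
    (.of_forall fun θ => ?_)
  rw [norm_mul, norm_pow, Real.norm_eq_abs, Real.norm_eq_abs]
  exact mul_le_one₀ (pow_le_one₀ (abs_nonneg _) (abs_charStep_le θ)) (abs_nonneg _)
    (Real.abs_cos_le_one _)

/-- The Fourier integral of the `k`-step transition probability. -/
noncomputable def fourierInt (k : ℕ) (x : Fin d → ℤ) : ℝ :=
  ∫ θ, charStep θ ^ k * Real.cos (phase θ x) ∂(torus d)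

lemma fourierInt_succ (k : ℕ) (x : Fin d → ℤ) :
    fourierInt (k + 1) x = avg (fourierInt k) x := by
  have hI := integrable_charStep_pow_mul_cos (d := d) k
  simp only [avg, fourierInt]
  simp_rw [← integral_add (hI _) (hI _)]
  have hI2 (i : Fin d) : Integrable
      (fun θ => charStep θ ^ k * Real.cos (phase θ (x + Pi.single i 1))
      + charStep θ ^ k * Real.cos (phase θ (x - Pi.single i 1))) (torus d) := (hI _).add (hI _)
  rw [← integral_finsetSum _ fun i _ => hI2 i, ← integral_const_mul]
  congr 1
  ext θ
  have := avg_cos_phase θ x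
  rw [pow_succ, mul_assoc, ← this, avg]
  simp only [← mul_add, ← Finset.mul_sum]
  ring

lemma integral_exp_int_mul (n : ℤ) :
    ∫ t in Set.Ioc (-Real.pi) Real.pi, Complex.exp ((n : ℂ) * Complex.I * t)
      = if n = 0 then ((2 * Real.pi : ℝ) : ℂ) else 0 := by
  rw [← intervalIntegral.integral_of_le (by linarith [Real.pi_pos])]
  split_ifs with h
  · subst h
    simp
    ring
  · have hc : (n : ℂ) * Complex.I ≠ 0 := mul_ne_zero (by exact_mod_cast h) Complex.I_ne_zero
    rw [integral_exp_mul_complex hc, div_eq_zero_iff]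
    left
    rw [sub_eq_zero, Complex.exp_eq_exp_iff_exists_int]
    exact ⟨n, by push_cast; ring⟩

lemma fourierInt_zero (x : Fin d → ℤ) :
    fourierInt 0 x = if x = 0 then (2 * Real.pi) ^ d else 0 := by
  have h1 : ∫ θ, Complex.exp ((phase θ x : ℂ) * Complex.I) ∂(torus d)
      = ∏ i, (if x i = 0 then ((2 * Real.pi : ℝ) : ℂ) else 0) := by
    have : ∀ θ : Fin d → ℝ, Complex.exp ((phase θ x : ℂ) * Complex.I)
        = ∏ i, Complex.exp ((x i : ℂ) * Complex.I * (θ i : ℂ)) := by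
      intro θ
      rw [← Complex.exp_sum, phase]
      push_cast
      rw [Finset.sum_mul]
      congr 1
      exact Finset.sum_congr rfl fun i _ => by ring
    simp_rw [this]
    rw [torus, integral_fintype_prod_eq_prod
      (f := fun i (t : ℝ) => Complex.exp ((x i : ℂ) * Complex.I * (t : ℂ)))]
    exact Finset.prod_congr rfl fun i _ => integral_exp_int_mul _
  have hint : Integrable (fun θ => Complex.exp ((phase θ x : ℂ) * Complex.I)) (torus d) := by
    refine Integrable.of_bound (Continuous.aestronglyMeasurable (by fun_prop)) 1
      (.of_forall fun θ => ?_)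
    rw [Complex.norm_exp_ofReal_mul_I]
  have h2 : fourierInt 0 x = (∫ θ, Complex.exp ((phase θ x : ℂ) * Complex.I) ∂(torus d)).re := by
    have := integral_re (𝕜 := ℂ) hint
    simp only [RCLike.re_to_complex] at this
    rw [← this]
    simp [fourierInt, Complex.exp_ofReal_mul_I_re]
  rw [h2, h1]
  split_ifs with hx
  · subst hx
    simp only [Pi.zero_apply, if_true, Finset.prod_const, Finset.card_univ, Fintype.card_fin]
    rw [← Complex.ofReal_pow, Complex.ofReal_re]
  · obtain ⟨i, hi⟩ := Function.ne_iff.1 hx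
    rw [Finset.prod_eq_zero (Finset.mem_univ i) (if_neg hi), Complex.zero_re]

/-- From `|cos t| ≤ 1 - sin² t / 2` and `1 + x ≤ exp x`. The exponent has `sin²` and not `t²`
because `|charStep|` also equals 1 when all frequencies are `±π`. The product form reduces the
integral to one dimension. -/
lemma charStep_pow_le (hd : d ≠ 0) (k : ℕ) (θ : Fin d → ℝ) :
    charStep θ ^ k ≤ ∏ i, Real.exp (-((k : ℝ) / (2 * d)) * Real.sin (θ i) ^ 2) := by
  have hd' : (0 : ℝ) < d := by exact_mod_cast Nat.pos_of_ne_zero hd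
  have h1 : |charStep θ| ≤ Real.exp (-(∑ i, Real.sin (θ i) ^ 2) / (2 * d)) := by
    refine le_trans ?_ (Real.add_one_le_exp _)
    rw [charStep, abs_mul, abs_of_pos (inv_pos.2 hd')]
    have h2 : |∑ i, Real.cos (θ i)| ≤ ∑ i, (1 - Real.sin (θ i) ^ 2 / 2) := by
      refine (Finset.abs_sum_le_sum_abs _ _).trans (Finset.sum_le_sum fun i _ => ?_)
      have := Real.sin_sq_add_cos_sq (θ i)
      rw [← sq_abs (Real.cos _)] at this
      nlinarith [sq_nonneg (1 - |Real.cos (θ i)|)]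
    rw [Finset.sum_sub_distrib] at h2
    simp only [Finset.sum_const, Finset.card_univ, Fintype.card_fin, nsmul_eq_mul, mul_one,
      ← Finset.sum_div] at h2
    calc (d : ℝ)⁻¹ * |∑ i, Real.cos (θ i)|
        ≤ (d : ℝ)⁻¹ * (d - (∑ i, Real.sin (θ i) ^ 2) / 2) := by gcongr
      _ = _ := by field_simp; ring
  calc charStep θ ^ k ≤ |charStep θ| ^ k := by rw [← abs_pow]; exact le_abs_self _
    _ ≤ Real.exp (-(∑ i, Real.sin (θ i) ^ 2) / (2 * d)) ^ k := by gcongr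
    _ = _ := by
      rw [← Real.exp_nat_mul, ← Real.exp_sum]
      congr 1
      rw [← Finset.mul_sum]
      ring

/-- One of `t`, `t - π`, `t + π` lies in `[-π/2, π/2]`, where Jordan's inequality `|sin s| ≥ 2 |s| /
π` applies; `sin²` has period `π`. -/
lemma exp_neg_sin_sq_le {a : ℝ} (ha : 0 ≤ a) {t : ℝ} (ht : t ∈ Set.Ioc (-Real.pi) Real.pi) :
    Real.exp (-a * Real.sin t ^ 2)
      ≤ Real.exp (-(a * (4 / Real.pi ^ 2)) * t ^ 2)
        + Real.exp (-(a * (4 / Real.pi ^ 2)) * (t - Real.pi) ^ 2)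
        + Real.exp (-(a * (4 / Real.pi ^ 2)) * (t - -Real.pi) ^ 2) := by
  have hpi := Real.pi_pos
  have key (s : ℝ) (hs : |s| ≤ Real.pi / 2) (hst : Real.sin t ^ 2 = Real.sin s ^ 2) :
      Real.exp (-a * Real.sin t ^ 2) ≤ Real.exp (-(a * (4 / Real.pi ^ 2)) * s ^ 2) := by
    apply Real.exp_le_exp.2
    have h1 := Real.mul_abs_le_abs_sin hs
    have h2 : (2 / Real.pi * |s|) ^ 2 ≤ |Real.sin s| ^ 2 := by gcongr
    rw [mul_pow, sq_abs, sq_abs] at h2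
    have h3 : (2 / Real.pi) ^ 2 = 4 / Real.pi ^ 2 := by ring
    rw [h3] at h2
    rw [hst]
    nlinarith
  have e1 := Real.exp_pos (-(a * (4 / Real.pi ^ 2)) * t ^ 2)
  have e2 := Real.exp_pos (-(a * (4 / Real.pi ^ 2)) * (t - Real.pi) ^ 2)
  have e3 := Real.exp_pos (-(a * (4 / Real.pi ^ 2)) * (t - -Real.pi) ^ 2)
  rcases le_or_gt |t| (Real.pi / 2) with h | h
  · linarith [key t h rfl]
  rcases lt_abs.1 h with h | h
  · have := key (t - Real.pi) (abs_le.2 ⟨by linarith [ht.2], by linarith [ht.2]⟩)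
      (by rw [Real.sin_sub_pi]; ring)
    linarith
  · have := key (t - -Real.pi) (abs_le.2 ⟨by linarith [ht.1], by linarith [ht.1]⟩)
      (by rw [sub_neg_eq_add, Real.sin_add_pi]; ring)
    linarith

lemma integral_exp_neg_sin_sq_le {a : ℝ} (ha : 0 < a) :
    ∫ t in Set.Ioc (-Real.pi) Real.pi, Real.exp (-a * Real.sin t ^ 2)
      ≤ 3 * √(Real.pi / (a * (4 / Real.pi ^ 2))) := by
  have hpi := Real.pi_pos
  set b := a * (4 / Real.pi ^ 2) with hb
  have hb0 : 0 < b := by positivity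
  have hg := integrable_exp_neg_mul_sq hb0
  have hg1 := hg.comp_sub_right Real.pi
  have hg2 := hg.comp_sub_right (-Real.pi)
  calc ∫ t in Set.Ioc (-Real.pi) Real.pi, Real.exp (-a * Real.sin t ^ 2)
      ≤ ∫ t in Set.Ioc (-Real.pi) Real.pi, (Real.exp (-b * t ^ 2)
        + Real.exp (-b * (t - Real.pi) ^ 2) + Real.exp (-b * (t - -Real.pi) ^ 2)) := by
        refine setIntegral_mono_on ?_ (((hg.add hg1).add hg2).integrableOn) measurableSet_Ioc
          fun t ht => exp_neg_sin_sq_le ha.le ht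
        exact ((by fun_prop : Continuous fun t => Real.exp (-a * Real.sin t ^ 2)).integrableOn_Ioc)
    _ ≤ ∫ t, (Real.exp (-b * t ^ 2)
        + Real.exp (-b * (t - Real.pi) ^ 2) + Real.exp (-b * (t - -Real.pi) ^ 2)) := by
        refine setIntegral_le_integral ((hg.add hg1).add hg2) (.of_forall fun t => ?_)
        simp only [Pi.zero_apply]
        positivity
    _ = 3 * √(Real.pi / b) := by
        have hg01 : Integrable fun t => Real.exp (-b * t ^ 2)
          + Real.exp (-b * (t - Real.pi) ^ 2) := hg.add hg1
        rw [integral_add hg01 hg2, integral_add hg hg1,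
          integral_sub_right_eq_self (fun t => Real.exp (-b * t ^ 2)),
          integral_sub_right_eq_self (fun t => Real.exp (-b * t ^ 2)), integral_gaussian]
        ring

lemma fourierInt_le (hd : d ≠ 0) {k : ℕ} (hk : k ≠ 0) :
    fourierInt k (0 : Fin d → ℤ)
      ≤ (3 * √(Real.pi / ((k : ℝ) / (2 * d) * (4 / Real.pi ^ 2)))) ^ d := by
  have hd' : (0 : ℝ) < d := by exact_mod_cast Nat.pos_of_ne_zero hd
  have hk' : (0 : ℝ) < k := by exact_mod_cast Nat.pos_of_ne_zero hk
  calc fourierInt k (0 : Fin d → ℤ)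
      ≤ ∫ θ, ∏ i, Real.exp (-((k : ℝ) / (2 * d)) * Real.sin (θ i) ^ 2) ∂(torus d) := by
        refine integral_mono (integrable_charStep_pow_mul_cos k 0) ?_ fun θ => ?_
        · refine Integrable.of_bound (Continuous.aestronglyMeasurable (by fun_prop)) 1
            (.of_forall fun θ => ?_)
          rw [Real.norm_of_nonneg (Finset.prod_nonneg fun i _ => (Real.exp_pos _).le)]
          refine Finset.prod_le_one (fun i _ => (Real.exp_pos _).le) fun i _ => ?_
          rw [Real.exp_le_one_iff, neg_mul]
          exact neg_nonpos.2 (by positivity)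
        · simpa [phase] using charStep_pow_le hd k θ
    _ = ∏ i : Fin d, ∫ t in Set.Ioc (-Real.pi) Real.pi,
          Real.exp (-((k : ℝ) / (2 * d)) * Real.sin t ^ 2) :=
        integral_fintype_prod_eq_prod
          (f := fun (_ : Fin d) t => Real.exp (-((k : ℝ) / (2 * d)) * Real.sin t ^ 2))
    _ = (∫ t in Set.Ioc (-Real.pi) Real.pi,
          Real.exp (-((k : ℝ) / (2 * d)) * Real.sin t ^ 2)) ^ d := by simp
    _ ≤ _ := by
        gcongr
        exact integral_exp_neg_sin_sq_le (by positivity)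

variable {Q : Measure (ℕ → (Fin d → ℤ) × ℝ)} {κ : Measure ℝ}

lemma measureReal_pos_eq_fourierInt (hd : d ≠ 0) (h : IsIIDLaw Q ((stepLaw d).prod κ))
    [IsProbabilityMeasure κ] (k : ℕ) (x : Fin d → ℤ) :
    Q.real {z | x + pos z k = 0} = ((2 * Real.pi) ^ d)⁻¹ * fourierInt k x := by
  have := h.prob
  induction k generalizing x with
  | zero =>
    rw [fourierInt_zero]
    by_cases hx : x = 0
    · simp [hx]
    · simp [hx]
  | succ k ih =>
    rw [measureReal_pos_succ hd h, fourierInt_succ, ← avg_const_mul]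
    simp only [ih]

/-- The on-diagonal heat kernel bound in dimension at least three. -/
lemma exists_measureReal_pos_eq_zero_le (hd : 3 ≤ d) (h : IsIIDLaw Q ((stepLaw d).prod κ))
    [IsProbabilityMeasure κ] :
    ∃ C > 0, ∀ k : ℕ, k ≠ 0 → Q.real {z | pos z k = 0} ≤ C * (k : ℝ) ^ (-(3 / 2) : ℝ) := by
  have hd0 : d ≠ 0 := by omega
  have hd' : (0 : ℝ) < d := by exact_mod_cast Nat.pos_of_ne_zero hd0
  have hpi := Real.pi_pos
  set c : ℝ := (2 * Real.pi)⁻¹ * (3 * √(Real.pi / (1 / (2 * d) * (4 / Real.pi ^ 2)))) with hc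
  have hc0 : 0 < c := by positivity
  refine ⟨c ^ d, by positivity, fun k hk => ?_⟩
  have hk' : (1 : ℝ) ≤ k := by exact_mod_cast Nat.one_le_iff_ne_zero.2 hk
  have h1 := measureReal_pos_eq_fourierInt hd0 h k 0
  simp only [zero_add] at h1
  rw [h1]
  have h2 : √(Real.pi / ((k : ℝ) / (2 * d) * (4 / Real.pi ^ 2)))
      = √(Real.pi / (1 / (2 * d) * (4 / Real.pi ^ 2))) * (√k)⁻¹ := by
    rw [← Real.sqrt_inv, ← Real.sqrt_mul (by positivity)]
    congr 1
    field_simp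
  have hs : (√(k : ℝ))⁻¹ ≤ 1 := inv_le_one_of_one_le₀ (Real.one_le_sqrt.2 hk')
  calc ((2 * Real.pi) ^ d)⁻¹ * fourierInt k (0 : Fin d → ℤ)
      ≤ ((2 * Real.pi) ^ d)⁻¹
        * (3 * √(Real.pi / ((k : ℝ) / (2 * d) * (4 / Real.pi ^ 2)))) ^ d := by
        gcongr
        exact fourierInt_le hd0 hk
    _ = c ^ d * (√k)⁻¹ ^ d := by
        rw [h2, hc, ← inv_pow, ← mul_pow, ← mul_pow]
        ring
    -- The decay `k ^ (-d/2)` is weakened to the summable `k ^ (-3/2)`, which is where `d ≥ 3`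
    -- matters.
    _ ≤ c ^ d * (√k)⁻¹ ^ 3 := by
        gcongr ?_ * ?_
        exact pow_le_pow_of_le_one (by positivity) hs hd
    _ = c ^ d * (k : ℝ) ^ (-(3 / 2) : ℝ) := by
        congr 1
        rw [Real.rpow_neg (by positivity), inv_pow, Real.sqrt_eq_rpow, ← Real.rpow_natCast,
          ← Real.rpow_mul (by positivity)]
        norm_num

end Fourier

/-! ### Transience and the rate of convergence of the return probability -/

section Transience

variable {d : ℕ} {Q : Measure (ℕ → (Fin d → ℤ) × ℝ)} {κ : Measure ℝ}

/-- Makes sums of `k ^ (-3/2)` telescope, so that their tails are of order `n ^ (-1/2)`. -/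
lemma inv_sqrt_sub_inv_sqrt_succ_ge {n : ℕ} (hn : n ≠ 0) :
    ((n + 1 : ℕ) : ℝ) ^ (-(3 / 2) : ℝ)
      ≤ 2 * ((√(n : ℝ))⁻¹ - (√((n + 1 : ℕ) : ℝ))⁻¹) := by
  have hn' : (0 : ℝ) < n := by exact_mod_cast Nat.pos_of_ne_zero hn
  have h0 : (0 : ℝ) ≤ ((n + 1 : ℕ) : ℝ) := by positivity
  have e : ((n + 1 : ℕ) : ℝ) ^ (-(3 / 2) : ℝ) = (√((n + 1 : ℕ) : ℝ) ^ 3)⁻¹ := by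
    rw [Real.rpow_neg h0, Real.sqrt_eq_rpow, ← Real.rpow_natCast, ← Real.rpow_mul h0]
    norm_num
  rw [e]
  set a := √(n : ℝ) with ha
  set b := √((n + 1 : ℕ) : ℝ) with hb
  have ha0 : 0 < a := Real.sqrt_pos.2 hn'
  have hab : a ≤ b := Real.sqrt_le_sqrt (by push_cast; linarith)
  have hb0 : 0 < b := ha0.trans_le hab
  have hsq : b ^ 2 = a ^ 2 + 1 := by
    rw [ha, hb, Real.sq_sqrt hn'.le, Real.sq_sqrt (by positivity)]
    push_cast
    ring
  have h1 : a⁻¹ - b⁻¹ = (a * b * (a + b))⁻¹ := by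
    field_simp
    linarith
  have h2 : a * b * (a + b) ≤ 2 * b ^ 3 := by nlinarith [mul_pos ha0 hb0, sq_nonneg b]
  rw [h1]
  calc (b ^ 3)⁻¹ = 2 * (2 * b ^ 3)⁻¹ := by field_simp
    _ ≤ 2 * (a * b * (a + b))⁻¹ := by gcongr

lemma returnProb_succ_le (hd : d ≠ 0) (h : IsIIDLaw Q ((stepLaw d).prod κ))
    [IsProbabilityMeasure κ] (n : ℕ) :
    returnProb d (n + 1) ≤ returnProb d n + Q.real {z | pos z (n + 1) = 0} := by
  have := h.prob
  rw [← measureReal_return hd h, ← measureReal_return hd h]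
  refine le_trans (measureReal_mono ?_) (measureReal_union_le _ _)
  rintro z ⟨k, hk, h0⟩
  rcases Nat.lt_succ_iff_lt_or_eq.1 hk with hk | rfl
  · exact Or.inl ⟨k, hk, h0⟩
  · exact Or.inr h0

/-- The return probability within `n` steps converges at rate `n ^ (-1/2)`. -/
lemma exists_returnProbTop_le (hd : 3 ≤ d) (h : IsIIDLaw Q ((stepLaw d).prod κ))
    [IsProbabilityMeasure κ] :
    ∃ C > 0, ∀ n : ℕ, n ≠ 0 → returnProbTop d ≤ returnProb d n + C * (√(n : ℝ))⁻¹ := by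
  have hd0 : d ≠ 0 := by omega
  obtain ⟨C, hC, hp⟩ := exists_measureReal_pos_eq_zero_le hd h
  refine ⟨2 * C, by positivity, fun n hn => ?_⟩
  -- The subtracted term lets the induction telescope; it is discarded in the limit.
  have key (j : ℕ) : returnProb d (n + j) ≤ returnProb d n + 2 * C * (√(n : ℝ))⁻¹
      - 2 * C * (√((n + j : ℕ) : ℝ))⁻¹ := by
    induction j with
    | zero => simp
    | succ j ih =>
      have h1 := returnProb_succ_le hd0 h (n + j)
      have h2 := hp (n + j + 1) (by omega)
      have h3 := inv_sqrt_sub_inv_sqrt_succ_ge (n := n + j) (by omega)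
      have h4 := mul_le_mul_of_nonneg_left h3 hC.le
      rw [← add_assoc]
      linarith
  refine le_of_tendsto ((tendsto_returnProb hd0).comp (tendsto_add_atTop_nat n))
    (.of_forall fun j => ?_)
  have := key j
  have h5 : 0 ≤ 2 * C * (√((n + j : ℕ) : ℝ))⁻¹ := by positivity
  simp only [Function.comp, add_comm j n]
  linarith

/-- Simple random walk is transient in dimension at least three. -/
lemma returnProbTop_lt_one (hd : 3 ≤ d) (h : IsIIDLaw Q ((stepLaw d).prod κ))
    [IsProbabilityMeasure κ] : returnProbTop d < 1 := by
  have hd0 : d ≠ 0 := by omega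
  have := h.prob
  have hle : returnProbTop d ≤ 1 :=
    le_of_tendsto' (tendsto_returnProb hd0) (returnProb_le_one hd0)
  refine lt_of_le_of_ne hle fun heq => ?_
  have hmeas : MeasurableSet {z : ℕ → (Fin d → ℤ) × ℝ | ∃ k, pos z (k + 1) = 0} := by
    have : {z : ℕ → (Fin d → ℤ) × ℝ | ∃ k, pos z (k + 1) = 0}
        = ⋃ k, {z | pos z (k + 1) = 0} := by
      ext z
      simp
    rw [this]
    exact MeasurableSet.iUnion fun k => measurableSet_pos_eq _ _
  have h1 : ∀ᵐ z ∂Q, ∃ k, pos z (k + 1) = 0 := by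
    refine (mem_ae_iff_prob_eq_one hmeas).2 ((ENNReal.toReal_eq_one_iff _).1 ?_)
    exact (measureReal_return_top hd0 h).trans heq
  -- If return were certain, then by stationarity the walk would revisit its position at every time
  -- `j`, hence visit the origin infinitely often, against Borel–Cantelli.
  have h2 : ∀ᵐ z ∂Q, ∀ j, ∃ k, pos (shift j z) (k + 1) = 0 :=
    ae_all_iff.2 fun j => (h.measurePreserving_shift j).quasiMeasurePreserving.ae h1
  obtain ⟨C, hC, hp⟩ := exists_measureReal_pos_eq_zero_le hd h
  have hsum : Summable fun k : ℕ => Q.real {z | pos z k = 0} := by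
    refine (summable_nat_add_iff 1).1 (Summable.of_nonneg_of_le (fun _ => measureReal_nonneg)
      (fun k => hp (k + 1) (by omega)) ?_)
    exact (summable_nat_add_iff 1).2
      ((Real.summable_nat_rpow.2 (by norm_num : (-(3 / 2) : ℝ) < -1)).mul_left C)
  have h3 : ∀ᵐ z ∂Q, ∀ᶠ k in atTop, z ∉ {z | pos z k = 0} := by
    refine ae_eventually_notMem ?_
    have : ∀ k : ℕ, Q {z | pos z k = 0} = ENNReal.ofReal (Q.real {z | pos z k = 0}) :=
      fun k => by rw [ofReal_measureReal]
    simp_rw [this]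
    exact hsum.tsum_ofReal_ne_top
  obtain ⟨z, hz2, hz3⟩ := (h2.and h3).exists
  obtain ⟨N, hN⟩ := eventually_atTop.1 hz3
  have hinf : ∀ n, ∃ k ≥ n, pos z k = 0 := by
    intro n
    induction n with
    | zero => exact ⟨0, le_rfl, by simp⟩
    | succ n ih =>
      obtain ⟨k, hk, h0⟩ := ih
      obtain ⟨i, hi⟩ := hz2 k
      exact ⟨k + (i + 1), by omega, by rw [pos_add, h0, hi, add_zero]⟩
  obtain ⟨k, hk, h0⟩ := hinf N
  exact hN k hk h0

end Transience

/-- `T θ` is the tail function of a geometric sum of independent marks with law `κ`, in which each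
mark is followed by a further one with probability `θ`. -/
structure IsMarkTail (κ : Measure ℝ) (T : ℝ → ℝ → ℝ) : Prop where
  prob : IsProbabilityMeasure κ
  mark_nonneg : ∀ᵐ h ∂κ, 0 ≤ h
  measurable : ∀ θ, Measurable (T θ)
  nonneg : ∀ θ s, 0 ≤ θ → 0 ≤ T θ s
  le_one : ∀ θ s, 0 ≤ θ → θ < 1 → 0 ≤ s → T θ s ≤ 1
  -- Either the first mark alone exceeds `s`, or a further mark must follow.
  renewal : ∀ θ s, 0 ≤ θ → θ < 1 → 0 ≤ s →
    ∫ h, (if s < h then 1 else θ * T θ (s - h)) ∂κ = T θ s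
  -- Lowering the continuation probability from `r` to `θ` costs a relative error at most linear in
  -- `s`.
  comparison : ∀ θ r s, 0 ≤ θ → θ ≤ r → 0 < r → r < 1 → 0 ≤ s →
    T r s * (1 - s * ((r - θ) / r)) ≤ T θ s
  -- `2 r / (1 + r)` bounds the chance of returning to a pair of sites, so the condition on `Λ`
  -- controls the exponential moment of order `c` of the pair's total mark. Then `b < 2 * c` makes
  -- its tail at `2 s` negligible against the one-site tail at `s`.
  exp_moment : ∀ r, 0 < r → r < 1 → ∃ b c Λ : ℝ, 0 < b ∧ b < 2 * c ∧
    (∀ s, 0 ≤ s → Real.exp (-b * s) ≤ T r s) ∧ 1 ≤ Λ ∧ Λ * (2 * r / (1 + r)) < 1 ∧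
    ∫⁻ h, ENNReal.ofReal (Real.exp (c * h)) ∂κ ≤ ENNReal.ofReal Λ

/-! ### Local time at one site -/

section Local

variable {d : ℕ} {Q : Measure (ℕ → (Fin d → ℤ) × ℝ)} {κ : Measure ℝ} {T : ℝ → ℝ → ℝ}

lemma IsIIDLaw.ae_all {E : Type*} [MeasurableSpace E] {Q : Measure (ℕ → E)} {ρ : Measure E}
    (h : IsIIDLaw Q ρ) {p : E → Prop} (hp : ∀ᵐ a ∂ρ, p a) : ∀ᵐ z ∂Q, ∀ k, p (z k) := by
  have := h.prob
  have := h.prob_marginal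
  have h0 : ∀ᵐ z ∂Q, p (z 0) :=
    (measurePreserving_fst.comp h.split).quasiMeasurePreserving.ae hp
  refine ae_all_iff.2 fun k => ?_
  have := (h.measurePreserving_shift k).quasiMeasurePreserving.ae h0
  simpa [shift] using this

lemma ae_mark_nonneg (hd : d ≠ 0) (hT : IsMarkTail κ T)
    (h : IsIIDLaw Q ((stepLaw d).prod κ)) : ∀ᵐ z ∂Q, ∀ k, 0 ≤ (z k).2 := by
  have := hT.prob
  have := isProbabilityMeasure_stepLaw hd
  exact h.ae_all (measurePreserving_snd.quasiMeasurePreserving.ae hT.mark_nonneg)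

/-- The probability that the local time at `x` before time `n` exceeds `s`. -/
noncomputable def locTail (Q : Measure (ℕ → (Fin d → ℤ) × ℝ)) (n : ℕ) (s : ℝ)
    (x : Fin d → ℤ) : ℝ := Q.real {z | s < occ z n (pt x)}

lemma measurableSet_lt_occ (n : ℕ) (s : ℝ) (f : (Fin d → ℤ) → ℝ) :
    MeasurableSet {z : ℕ → (Fin d → ℤ) × ℝ | s < occ z n f} :=
  measurableSet_lt measurable_const (measurable_occ n f)

lemma locTail_nonneg (n : ℕ) (s : ℝ) (x : Fin d → ℤ) : 0 ≤ locTail Q n s x :=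
  measureReal_nonneg

lemma locTail_le_one [IsProbabilityMeasure Q] (n : ℕ) (s : ℝ) (x : Fin d → ℤ) :
    locTail Q n s x ≤ 1 :=
  measureReal_le_one

/-- After a first step `e` the target is `x - e`; symmetry of the steps turns the mean over `e` into
`avg` at `x`. -/
lemma measureReal_section_locTail (n : ℕ) (s : ℝ) (x : Fin d → ℤ) (r : ℝ) :
    avg (fun e => Q.real {z | consSeq (e, r) z ∈ {z | s < occ z (n + 1) (pt x)}}) 0
      = avg (locTail Q n (s - pt x 0 * r)) x := by
  have (e : Fin d → ℤ) : Q.real {z | consSeq (e, r) z ∈ {z | s < occ z (n + 1) (pt x)}}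
      = locTail Q n (s - pt x 0 * r) (x + -e) := by
    simp only [locTail, Set.mem_ofPred_eq, occ_consSeq, pt_comp_add, sub_lt_iff_lt_add',
      sub_eq_add_neg x]
  simp only [this]
  rw [avg_comp_neg (fun e => locTail Q n (s - pt x 0 * r) (x + e)), avg_comp_add, neg_zero,
    add_zero]

lemma locTail_succ (hd : d ≠ 0) [IsProbabilityMeasure κ] (h : IsIIDLaw Q ((stepLaw d).prod κ))
    (n : ℕ) (s : ℝ) (x : Fin d → ℤ) :
    locTail Q (n + 1) s x = ∫ r, avg (locTail Q n (s - pt x 0 * r)) x ∂κ := by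
  rw [locTail, h.measureReal_eq_avg hd (measurableSet_lt_occ _ _ _)]
  simp only [measureReal_section_locTail]

lemma locTail_succ_of_ne (hd : d ≠ 0) [IsProbabilityMeasure κ]
    (h : IsIIDLaw Q ((stepLaw d).prod κ)) (n : ℕ) (s : ℝ) {x : Fin d → ℤ} (hx : x ≠ 0) :
    locTail Q (n + 1) s x = avg (locTail Q n s) x := by
  rw [locTail_succ hd h]
  simp [pt, hx.symm]

lemma locTail_succ_zero (hd : d ≠ 0) [IsProbabilityMeasure κ]
    (h : IsIIDLaw Q ((stepLaw d).prod κ)) (n : ℕ) (s : ℝ) :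
    locTail Q (n + 1) s 0 = ∫ r, avg (locTail Q n (s - r)) 0 ∂κ := by
  rw [locTail_succ hd h]
  simp [pt]

lemma integrable_avg_locTail (hd : d ≠ 0) [IsProbabilityMeasure κ]
    (h : IsIIDLaw Q ((stepLaw d).prod κ)) (n : ℕ) (s : ℝ) :
    Integrable (fun r => avg (locTail Q n (s - r)) 0) κ := by
  refine (integrable_avg hd h (measurableSet_lt_occ (n + 1) s (pt 0))).congr
    (.of_forall fun r => ?_)
  beta_reduce
  rw [measureReal_section_locTail]
  simp [pt]

lemma IsMarkTail.integrable (hT : IsMarkTail κ T) {θ s : ℝ} (h0 : 0 ≤ θ) (h1 : θ < 1) :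
    Integrable (fun h => if s < h then 1 else θ * T θ (s - h)) κ := by
  have := hT.prob
  refine Integrable.of_bound (Measurable.aestronglyMeasurable ?_) 1 (.of_forall fun h => ?_)
  · exact Measurable.ite (measurableSet_lt measurable_const measurable_id) measurable_const
      (((hT.measurable θ).comp (measurable_const.sub measurable_id)).const_mul θ)
  · split_ifs with hs
    · simp
    · rw [Real.norm_of_nonneg (mul_nonneg h0 (hT.nonneg θ _ h0))]
      exact mul_le_one₀ h1.le (hT.nonneg θ _ h0)
        (hT.le_one θ _ h0 h1 (sub_nonneg.2 (not_lt.1 hs)))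

/-- The local time at `x` is dominated by a geometric sum of marks, if `x` is hit at all. -/
lemma locTail_le (hd : d ≠ 0) (hT : IsMarkTail κ T) (h : IsIIDLaw Q ((stepLaw d).prod κ))
    (hr : returnProbTop d < 1) (n : ℕ) {s : ℝ} (hs : 0 ≤ s) (x : Fin d → ℤ) :
    locTail Q n s x ≤ hitProb x * T (returnProbTop d) s := by
  have := hT.prob
  have := h.prob
  have hr0 := (returnProbTop_pos hd).le
  induction n generalizing s x with
  | zero =>
    have : locTail Q 0 s x = 0 := by simp [locTail, not_lt.2 hs]
    rw [this]
    exact mul_nonneg (hitProb_nonneg hd x) (hT.nonneg _ _ hr0)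
  | succ n ih =>
    by_cases hx : x = 0
    · subst hx
      rw [locTail_succ_zero hd h, hitProb_zero hd, one_mul, ← hT.renewal _ s hr0 hr hs]
      -- For a first mark `a ≤ s`, averaging the induction hypothesis produces `avg hitProb 0`,
      -- which is `returnProbTop d` by definition: the integrand of the renewal equation.
      refine integral_mono (integrable_avg_locTail hd h n s) (hT.integrable hr0 hr) fun a => ?_
      beta_reduce
      split_ifs with ha
      · exact (avg_mono (fun y => locTail_le_one n _ y) 0).trans (avg_const hd 1 0).le
      · exact (avg_mono (ih (sub_nonneg.2 (not_lt.1 ha))) 0).trans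
          (avg_mul_const _ _ 0).le
    · rw [locTail_succ_of_ne hd h n s hx, ← avg_hitProb hd hx, ← avg_mul_const]
      exact avg_mono (ih hs) x

lemma locTail_mono (hd : d ≠ 0) (hT : IsMarkTail κ T) (h : IsIIDLaw Q ((stepLaw d).prod κ))
    {m n : ℕ} (hmn : m ≤ n) (s : ℝ) (x : Fin d → ℤ) : locTail Q m s x ≤ locTail Q n s x := by
  have := h.prob
  refine ENNReal.toReal_mono (measure_ne_top _ _) (measure_mono_ae ?_)
  filter_upwards [ae_mark_nonneg hd hT h] with z hz hzs
  exact lt_of_lt_of_le hzs (occ_mono hz hmn (pt_nonneg x))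

lemma locTail_of_neg (hd : d ≠ 0) (hT : IsMarkTail κ T) (h : IsIIDLaw Q ((stepLaw d).prod κ))
    (n : ℕ) {s : ℝ} (hs : s < 0) (x : Fin d → ℤ) : locTail Q n s x = 1 := by
  have := h.prob
  have h1 : {z | s < occ z n (pt x)} =ᵐ[Q] Set.univ := by
    rw [eventuallyEq_univ]
    filter_upwards [ae_mark_nonneg hd hT h] with z hz
    exact hs.trans_le (occ_nonneg hz n (pt_nonneg x))
  rw [locTail, measureReal_congr h1, probReal_univ]

/-- Waiting for the first visit to `x`. -/
lemma hit_mul_locTail_le (hd : d ≠ 0) (hT : IsMarkTail κ T)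
    (h : IsIIDLaw Q ((stepLaw d).prod κ)) (m j : ℕ) (s : ℝ) (x : Fin d → ℤ) :
    hit j x * locTail Q m s 0 ≤ locTail Q (m + j) s x := by
  have := hT.prob
  induction j generalizing x with
  | zero => simpa [hit] using locTail_nonneg _ _ _
  | succ j ih =>
    rw [hit_succ]
    split_ifs with hx
    · rw [hx, one_mul]
      exact locTail_mono hd hT h (Nat.le_add_right _ _) s 0
    · rw [← add_assoc, locTail_succ_of_ne hd h _ s hx, ← avg_mul_const]
      exact avg_mono ih x

/-- The local time at the origin up to time `i * (M + 1)` dominates a geometric sum of marks with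
continuation probability `returnProb d M`, up to an error from more than `i` terms. -/
lemma le_locTail (hd : d ≠ 0) (hT : IsMarkTail κ T) (h : IsIIDLaw Q ((stepLaw d).prod κ))
    (hr : returnProbTop d < 1) (M i : ℕ) {s : ℝ} (hs : 0 ≤ s) :
    T (returnProb d M) s - returnProb d M ^ i ≤ locTail Q (i * (M + 1)) s 0 := by
  have := hT.prob
  have := h.prob
  have h0 := returnProb_nonneg (d := d) M
  have h1 : returnProb d M < 1 := (returnProb_le_returnProbTop hd M).trans_lt hr
  induction i generalizing s with
  | zero =>
    have := hT.le_one _ s h0 h1 hs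
    have := locTail_nonneg (Q := Q) (0 * (M + 1)) s 0
    rw [pow_zero]
    linarith
  | succ i ih =>
    set θ := returnProb d M
    have hstep : ∫ a, ((if s < a then 1 else θ * T θ (s - a)) - θ ^ (i + 1)) ∂κ
        ≤ ∫ a, avg (locTail Q (i * (M + 1) + M) (s - a)) 0 ∂κ := by
      refine integral_mono ((hT.integrable h0 h1).sub (integrable_const _))
        (integrable_avg_locTail hd h _ s) fun a => ?_
      have hp : 0 ≤ θ ^ (i + 1) := pow_nonneg h0 _
      beta_reduce
      split_ifs with ha
      · have : avg (locTail Q (i * (M + 1) + M) (s - a)) 0 = 1 := by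
          rw [show locTail Q (i * (M + 1) + M) (s - a) = fun _ => 1 from
            funext fun y => locTail_of_neg hd hT h _ (sub_neg.2 ha) y, avg_const hd]
        linarith
      -- The next return is allowed `M` steps, which leaves `i * (M + 1)` steps for the rest of the
      -- sum.
      · have h2 : θ * locTail Q (i * (M + 1)) (s - a) 0
            ≤ avg (locTail Q (i * (M + 1) + M) (s - a)) 0 := by
          refine le_trans (avg_mul_const _ _ 0).ge
            (avg_mono (fun y => hit_mul_locTail_le hd hT h _ M _ y) 0)
        have h3 := mul_le_mul_of_nonneg_left (ih (sub_nonneg.2 (not_lt.1 ha))) h0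
        rw [pow_succ']
        linarith
    rw [integral_sub (hT.integrable h0 h1) (integrable_const _), hT.renewal θ s h0 h1 hs,
      integral_const, probReal_univ, one_smul] at hstep
    refine hstep.trans_eq ?_
    rw [← locTail_succ_zero hd h, add_mul, one_mul, add_assoc]

end Local

/-! ### Exponential moments for pairs of sites -/

section Pairs

variable {d : ℕ} {Q : Measure (ℕ → (Fin d → ℤ) × ℝ)} {κ : Measure ℝ} {T : ℝ → ℝ → ℝ}

/-- A bound for the exponential moments of the occupation of the set `{f = 1}` by means of a
function `g` which is superharmonic off this set. -/
lemma lintegral_exp_occ_le (hd : d ≠ 0) [IsProbabilityMeasure κ]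
    (h : IsIIDLaw Q ((stepLaw d).prod κ)) {f g : (Fin d → ℤ) → ℝ} {c σ Λ : ℝ}
    (hf : ∀ x, f x = 0 ∨ f x = 1) (hg : ∀ x, 0 ≤ g x)
    (hg0 : ∀ x, f x = 0 → avg g x ≤ g x) (hg1 : ∀ x, f x = 1 → 1 ≤ g x ∧ avg g x ≤ σ)
    (hΛ : 1 ≤ Λ) (hσ : Λ * σ < 1)
    (hκ : ∫⁻ a, ENNReal.ofReal (Real.exp (c * a)) ∂κ ≤ ENNReal.ofReal Λ) (n : ℕ)
    (x : Fin d → ℤ) :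
    ∫⁻ z, ENNReal.ofReal (Real.exp (c * occ z n fun y => f (x + y))) ∂Q
      ≤ ENNReal.ofReal (1 + (Λ - 1) / (1 - Λ * σ) * g x) := by
  have := h.prob
  have := isProbabilityMeasure_stepLaw hd
  -- `C` solves `Λ * (1 + C * σ) = 1 + C`, so the bound `1 + C * g` survives the collection of a
  -- mark.
  set C := (Λ - 1) / (1 - Λ * σ) with hC
  have hC0 : 0 ≤ C := div_nonneg (by linarith) (by linarith)
  have hC1 : C * (1 - Λ * σ) = Λ - 1 := div_mul_cancel₀ _ (by linarith)
  have hCg (y : Fin d → ℤ) : 0 ≤ 1 + C * g y := by have := mul_nonneg hC0 (hg y); linarith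
  induction n generalizing x with
  | zero =>
    simp only [occ_zero, mul_zero, Real.exp_zero, lintegral_const, measure_univ, mul_one]
    exact ENNReal.ofReal_le_ofReal (by have := mul_nonneg hC0 (hg x); linarith)
  | succ n ih =>
    have havg : avg (fun e => 1 + C * g (x + e)) 0 = 1 + C * avg g x := by
      rw [avg_add, avg_const hd, avg_const_mul, avg_comp_add, add_zero]
    rw [h.lintegral_eq (by fun_prop)]
    calc ∫⁻ a, ∫⁻ z, ENNReal.ofReal (Real.exp
            (c * occ (consSeq a z) (n + 1) fun y => f (x + y))) ∂Q ∂((stepLaw d).prod κ)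
        ≤ ∫⁻ a : (Fin d → ℤ) × ℝ, ENNReal.ofReal (1 + C * g (x + a.1))
            * ENNReal.ofReal (Real.exp (c * (f x * a.2))) ∂((stepLaw d).prod κ) := by
          refine lintegral_mono fun a => ?_
          simp only [occ_consSeq, add_zero, mul_add c, Real.exp_add,
            ENNReal.ofReal_mul (Real.exp_pos _).le, ← add_assoc]
          rw [lintegral_const_mul _ (by fun_prop), mul_comm]
          gcongr
          exact ih (x + a.1)
      _ = ENNReal.ofReal (1 + C * avg g x)
            * ∫⁻ a, ENNReal.ofReal (Real.exp (c * (f x * a))) ∂κ := by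
          rw [lintegral_prod_mul (f := fun e => ENNReal.ofReal (1 + C * g (x + e)))
            (g := fun a => ENNReal.ofReal (Real.exp (c * (f x * a))))
            (Measurable.of_discrete.aemeasurable) (by fun_prop),
            lintegral_stepLaw_ofReal hd fun e => hCg _, havg]
      _ ≤ _ := by
          have hav := avg_nonneg hg x
          have hav' : 0 ≤ 1 + C * avg g x := by have := mul_nonneg hC0 hav; linarith
          rcases hf x with hx | hx
          · simp only [hx, zero_mul, mul_zero, Real.exp_zero, ENNReal.ofReal_one, lintegral_const,
              measure_univ, mul_one]
            have := mul_le_mul_of_nonneg_left (hg0 x hx) hC0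
            exact ENNReal.ofReal_le_ofReal (by linarith)
          · simp only [hx, one_mul]
            obtain ⟨h1, h2⟩ := hg1 x hx
            refine (mul_le_mul_right hκ _).trans ?_
            rw [← ENNReal.ofReal_mul hav']
            refine ENNReal.ofReal_le_ofReal ?_
            have h3 := mul_le_mul_of_nonneg_left h1 hC0
            have h4 := mul_le_mul_of_nonneg_left h2 (mul_nonneg hC0 (by linarith : 0 ≤ Λ))
            nlinarith

/-- Exponential decay of the total local time at a pair of points, faster than that of the square
of the exponential lower bound of the tail of the local time at one point. -/
lemma exists_pair_bound (hd : d ≠ 0) (hT : IsMarkTail κ T) (h : IsIIDLaw Q ((stepLaw d).prod κ))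
    (hr : returnProbTop d < 1) :
    ∃ b c D : ℝ, 0 < b ∧ b < 2 * c ∧ 0 < D ∧
      (∀ s, 0 ≤ s → Real.exp (-b * s) ≤ T (returnProbTop d) s) ∧
      ∀ n s, ∀ y : Fin d → ℤ, y ≠ 0 →
        Q.real {z | 2 * s < occ z n (pt 0) + occ z n (pt y)} ≤ D * Real.exp (-(2 * c) * s) := by
  have := hT.prob
  have := h.prob
  set r := returnProbTop d with hrdef
  have hr0 : 0 < r := returnProbTop_pos hd
  obtain ⟨b, c, Λ, hb, hbc, hbT, hΛ, hΛr, hκ⟩ := hT.exp_moment r hr0 hr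
  set C := (Λ - 1) / (1 - Λ * (2 * r / (1 + r))) with hC
  have hC0 : 0 ≤ C := div_nonneg (by linarith) (by linarith)
  refine ⟨b, c, 1 + C, hb, hbc, by linarith, hbT, fun n s y hy => ?_⟩
  set q := hitProb y with hq
  have hq0 : 0 ≤ q := hitProb_nonneg hd y
  have hqr : q ≤ r := hitProb_le_returnProbTop hd hy
  set f : (Fin d → ℤ) → ℝ := fun x => pt 0 x + pt y x with hf
  -- `g x` is the probability of ever hitting `{0, y}` from `x`: whichever point is hit first, the
  -- other is hit later with probability `q`, so `hitProb x + hitProb (x - y)` counts the event with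
  -- weight `1 + q`.
  set g : (Fin d → ℤ) → ℝ := fun x => (1 + q)⁻¹ * (hitProb x + hitProb (x - y)) with hg
  have hfval (x : Fin d → ℤ) : (f x = 0 ∧ x ≠ 0 ∧ x ≠ y) ∨ (f x = 1 ∧ (x = 0 ∨ x = y)) := by
    by_cases h0 : x = 0
    · right
      subst h0
      simp [hf, pt, hy.symm]
    · by_cases h1 : x = y
      · right
        simp [hf, pt, h1, hy]
      · left
        simp [hf, pt, h0, h1]
  have havg (x : Fin d → ℤ) : avg g x = (1 + q)⁻¹ * (avg hitProb x + avg hitProb (x - y)) := by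
    rw [hg, avg_const_mul, avg_add, avg_comp_sub]
  have hσ : (1 + q)⁻¹ * (r + q) ≤ 2 * r / (1 + r) := by
    rw [inv_mul_eq_div, div_le_div_iff₀ (by linarith) (by linarith)]
    nlinarith
  have key := lintegral_exp_occ_le hd h (f := f) (g := g) (σ := 2 * r / (1 + r))
    (fun x => (hfval x).imp And.left And.left)
    (fun x => mul_nonneg (by positivity) (add_nonneg (hitProb_nonneg hd _) (hitProb_nonneg hd _)))
    (fun x hx => ?_) (fun x hx => ?_) hΛ hΛr hκ n 0
  · have hg00 : g 0 = 1 := by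
      simp only [hg, zero_sub, hitProb_neg, hitProb_zero hd, ← hq]
      exact inv_mul_cancel₀ (by linarith)
    rw [← hC, hg00, mul_one] at key
    simp only [zero_add] at key
    have hsub : {z : ℕ → (Fin d → ℤ) × ℝ | 2 * s < occ z n (pt 0) + occ z n (pt y)}
        ⊆ {z | ENNReal.ofReal (Real.exp (2 * c * s))
          ≤ ENNReal.ofReal (Real.exp (c * occ z n f))} := by
      intro z hz
      have e : occ z n f = occ z n (pt 0) + occ z n (pt y) := by
        simp only [occ, hf, add_mul, Finset.sum_add_distrib]
      refine ENNReal.ofReal_le_ofReal (Real.exp_le_exp.2 ?_)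
      rw [e]
      have : 2 * s < occ z n (pt 0) + occ z n (pt y) := hz
      nlinarith
    have hmark := (mul_meas_ge_le_lintegral (μ := Q)
      (f := fun z => ENNReal.ofReal (Real.exp (c * occ z n f))) (by fun_prop)
      (ENNReal.ofReal (Real.exp (2 * c * s)))).trans key
    have h2 := ENNReal.toReal_mono ENNReal.ofReal_ne_top hmark
    rw [ENNReal.toReal_mul, ENNReal.toReal_ofReal (Real.exp_pos _).le,
      ENNReal.toReal_ofReal (by linarith)] at h2
    have h3 := (measureReal_mono (μ := Q) hsub).trans
      ((le_div_iff₀' (Real.exp_pos (2 * c * s))).2 h2)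
    rwa [div_eq_mul_inv, ← Real.exp_neg, ← neg_mul] at h3
  · obtain ⟨_, h0, h1⟩ | ⟨h1, _⟩ := hfval x
    · rw [havg, avg_hitProb hd h0, avg_hitProb hd (sub_ne_zero.2 h1)]
    · simp [h1] at hx
  · obtain ⟨h1, _⟩ | ⟨_, rfl | rfl⟩ := hfval x
    · simp [h1] at hx
    · rw [havg, zero_sub, avg_hitProb hd (neg_ne_zero.2 hy), hitProb_neg]
      refine ⟨?_, hσ⟩
      simp only [hg, zero_sub, hitProb_neg, hitProb_zero hd, ← hq]
      rw [inv_mul_cancel₀ (by linarith)]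
    · rw [havg, sub_self, avg_hitProb hd hy, add_comm _ (avg hitProb 0)]
      refine ⟨?_, hσ⟩
      simp only [hg, sub_self, hitProb_zero hd, ← hq]
      rw [add_comm q, inv_mul_cancel₀ (by linarith)]

end Pairs

/-! ### New sites, independent blocks and Bonferroni bounds -/

section Range

/-- Counting distinct values by first and by last occurrence. -/
lemma card_filter_first_eq_card_filter_last {α : Type*} [DecidableEq α] (f : ℕ → α) (n : ℕ) :
    ((Finset.range n).filter fun k => ∀ j < k, f j ≠ f k).card
      = ((Finset.range n).filter fun k => ∀ j < n, k < j → f j ≠ f k).card := by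
  have h1 : ((Finset.range n).filter fun k => ∀ j < k, f j ≠ f k).card
      = ((Finset.range n).image f).card := by
    rw [← Finset.card_image_of_injOn (f := f)]
    · congr 1
      ext y
      simp only [Finset.mem_image, Finset.mem_filter, Finset.mem_range]
      constructor
      · rintro ⟨k, ⟨hk, _⟩, rfl⟩
        exact ⟨k, hk, rfl⟩
      · rintro ⟨k, hk, rfl⟩
        have hex : ∃ i, f i = f k := ⟨k, rfl⟩
        refine ⟨Nat.find hex, ⟨(Nat.find_min' hex rfl).trans_lt hk, fun j hj h => ?_⟩,
          Nat.find_spec hex⟩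
        exact Nat.find_min hex hj (h.trans (Nat.find_spec hex))
    · intro i hi j hj hij
      simp only [Finset.coe_filter, Set.mem_ofPred_eq] at hi hj
      rcases lt_trichotomy i j with h | h | h
      · exact absurd hij (hj.2 i h)
      · exact h
      · exact absurd hij.symm (hi.2 j h)
  have h2 : ((Finset.range n).filter fun k => ∀ j < n, k < j → f j ≠ f k).card
      = ((Finset.range n).image f).card := by
    rw [← Finset.card_image_of_injOn (f := f)]
    · congr 1
      ext y
      simp only [Finset.mem_image, Finset.mem_filter, Finset.mem_range]
      constructor
      · rintro ⟨k, ⟨hk, _⟩, rfl⟩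
        exact ⟨k, hk, rfl⟩
      · rintro ⟨k, hk, rfl⟩
        set P : ℕ → Prop := fun i => f i = f k ∧ i < n
        classical
        have hP : P k := ⟨rfl, hk⟩
        have hs := Nat.findGreatest_spec (P := P) hk.le hP
        refine ⟨Nat.findGreatest P n, ⟨hs.2, fun j hjn hj h => ?_⟩, hs.1⟩
        exact Nat.findGreatest_is_greatest hj hjn.le ⟨h.trans hs.1, hjn⟩
    · intro i hi j hj hij
      simp only [Finset.coe_filter, Set.mem_ofPred_eq, Finset.mem_range] at hi hj
      rcases lt_trichotomy i j with h | h | h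
      · exact absurd hij.symm (hi.2 j hj.1 h)
      · exact h
      · exact absurd hij (hj.2 i hi.1 h)
  rw [h1, h2]

variable {d : ℕ} {Q : Measure (ℕ → (Fin d → ℤ) × ℝ)} {κ : Measure ℝ} {T : ℝ → ℝ → ℝ}

/-- The event that the walk is at a new site at time `k`. -/
def newSite (d k : ℕ) : Set (ℕ → (Fin d → ℤ) × ℝ) := {z | ∀ j < k, pos z j ≠ pos z k}

lemma measurableSet_newSite (k : ℕ) : MeasurableSet (newSite d k) := by
  have : newSite d k = ⋂ j ∈ Finset.range k, {z | pos z j = pos z k}ᶜ := by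
    ext z
    simp [newSite]
  rw [this]
  exact Finset.measurableSet_biInter _ fun j _ =>
    (measurableSet_eq_fun (measurable_pos j) (measurable_pos k)).compl

/-- The expected number of sites visited before time `n`. -/
noncomputable def meanRange (d n : ℕ) : ℝ := ∑ j ∈ Finset.range n, (1 - returnProb d j)

/-- Counting last visits in place of first visits leaves the total unchanged, and a last visit at
time `k` means no return within the next `n - 1 - k` steps, an event of the shifted walk. -/
lemma sum_measureReal_newSite (hd : d ≠ 0) [IsProbabilityMeasure κ]
    (h : IsIIDLaw Q ((stepLaw d).prod κ)) (n : ℕ) :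
    ∑ k ∈ Finset.range n, Q.real (newSite d k) = meanRange d n := by
  have := h.prob
  have e (k : ℕ) (hk : k < n) : {z : ℕ → (Fin d → ℤ) × ℝ | ∀ j < n, k < j → pos z j ≠ pos z k}
      = shift k ⁻¹' {z | ∃ i < n - 1 - k, pos z (i + 1) = 0}ᶜ := by
    ext z
    simp only [Set.mem_ofPred_eq, Set.mem_preimage, Set.mem_compl_iff, not_exists, not_and]
    constructor
    · intro hz i hi h0
      exact hz (k + (i + 1)) (by omega) (by omega) (by rw [pos_add, h0, add_zero])
    · intro hz j hjn hkj h0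
      obtain ⟨i, rfl⟩ := Nat.exists_eq_add_of_lt hkj
      refine hz i (by omega) ?_
      rw [add_assoc, pos_add] at h0
      simpa using h0
  have hlast (k : ℕ) (hk : k < n) :
      MeasurableSet {z : ℕ → (Fin d → ℤ) × ℝ | ∀ j < n, k < j → pos z j ≠ pos z k} := by
    rw [e k hk]
    exact measurable_shift k (measurableSet_return _).compl
  have hint (A : Set (ℕ → (Fin d → ℤ) × ℝ)) (hA : MeasurableSet A) :
      Integrable (A.indicator (1 : (ℕ → (Fin d → ℤ) × ℝ) → ℝ)) Q :=
    (integrable_const (1 : ℝ)).indicator hA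
  calc ∑ k ∈ Finset.range n, Q.real (newSite d k)
      = ∑ k ∈ Finset.range n, ∫ z, (newSite d k).indicator 1 z ∂Q :=
        Finset.sum_congr rfl fun k _ => (integral_indicator_one (measurableSet_newSite k)).symm
    _ = ∫ z, ∑ k ∈ Finset.range n, (newSite d k).indicator 1 z ∂Q :=
        (integral_finsetSum _ fun k _ => hint _ (measurableSet_newSite k)).symm
    _ = ∫ z, ∑ k ∈ Finset.range n,
          {z | ∀ j < n, k < j → pos z j ≠ pos z k}.indicator 1 z ∂Q := by
        congr 1
        ext z
        have := card_filter_first_eq_card_filter_last (pos z) n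
        simp only [Set.indicator_apply, newSite, Set.mem_ofPred_eq, Pi.one_apply]
        rw [Finset.sum_boole, Finset.sum_boole]
        exact_mod_cast (by convert this)
    _ = ∑ k ∈ Finset.range n, ∫ z,
          {z | ∀ j < n, k < j → pos z j ≠ pos z k}.indicator 1 z ∂Q :=
        integral_finsetSum _ fun k hk => hint _ (hlast k (Finset.mem_range.1 hk))
    _ = ∑ k ∈ Finset.range n, (1 - returnProb d (n - 1 - k)) := by
        refine Finset.sum_congr rfl fun k hk => ?_
        have hk := Finset.mem_range.1 hk
        rw [integral_indicator_one (hlast k hk), e k hk,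
          (h.measurePreserving_shift k).measureReal_preimage
            (measurableSet_return _).compl.nullMeasurableSet,
          probReal_compl_eq_one_sub (measurableSet_return _), measureReal_return hd h]
    _ = meanRange d n := Finset.sum_range_reflect (fun j => 1 - returnProb d j) n

/-- The event that some site has local time exceeding `s` before time `n`. -/
def maxEvent (d n : ℕ) (s : ℝ) : Set (ℕ → (Fin d → ℤ) × ℝ) := {z | ∃ x, s < occ z n (pt x)}

lemma measurableSet_maxEvent (n : ℕ) (s : ℝ) : MeasurableSet (maxEvent d n s) := by
  have : maxEvent d n s = ⋃ x, {z | s < occ z n (pt x)} := by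
    ext z
    simp [maxEvent]
  rw [this]
  exact MeasurableSet.iUnion fun x => measurableSet_lt_occ n s _

lemma newSite_congr (k : ℕ) (z w : ℕ → (Fin d → ℤ) × ℝ) (h : ∀ j < k, z j = w j)
    (hz : z ∈ newSite d k) : w ∈ newSite d k := by
  intro j hj
  rw [← pos_congr h, ← pos_congr fun i hi => h i (hi.trans hj)]
  exact hz j hj

lemma maxEvent_congr (n : ℕ) (s : ℝ) (z w : ℕ → (Fin d → ℤ) × ℝ) (h : ∀ j < n, z j = w j)
    (hz : z ∈ maxEvent d n s) : w ∈ maxEvent d n s := by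
  obtain ⟨x, hx⟩ := hz
  exact ⟨x, by rwa [← occ_congr h]⟩

lemma occ_pt_eq_zero {z : ℕ → (Fin d → ℤ) × ℝ} {k : ℕ} {x : Fin d → ℤ}
    (h : ∀ j < k, pos z j ≠ x) : occ z k (pt x) = 0 :=
  Finset.sum_eq_zero fun j hj => by simp [pt, h j (Finset.mem_range.1 hj)]

/-- The path is split at the first visit `k` to the exceeding site: nothing was collected there
before, so the exceedance belongs to the walk after `k`, which is independent of `newSite d k`. -/
lemma maxEvent_subset (n : ℕ) {s : ℝ} (hs : 0 ≤ s) :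
    maxEvent d n s ⊆ ⋃ k ∈ Finset.range n,
      newSite d k ∩ shift k ⁻¹' {z | s < occ z (n - k) (pt 0)} := by
  rintro z ⟨x, hx⟩
  have hex : ∃ k, k < n ∧ pos z k = x := by
    by_contra! hcon
    rw [occ_pt_eq_zero hcon] at hx
    linarith
  have hk := Nat.find_spec hex
  set k := Nat.find hex with hkdef
  have hmin : ∀ j < k, pos z j ≠ x := fun j hj hjx =>
    Nat.find_min hex hj ⟨hj.trans hk.1, hjx⟩
  simp only [Set.mem_iUnion, Finset.mem_range]
  refine ⟨k, hk.1, fun j hj => by rw [hk.2]; exact hmin j hj, ?_⟩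
  have := occ_add z k (n - k) (pt x)
  rw [Nat.add_sub_cancel' hk.1.le, occ_pt_eq_zero hmin, pt_comp_add, hk.2, sub_self,
    zero_add] at this
  rw [this] at hx
  exact hx

/-- The upper bound for the tail of the maximal local time. -/
lemma measureReal_maxEvent_le (hd : d ≠ 0) (hT : IsMarkTail κ T)
    (h : IsIIDLaw Q ((stepLaw d).prod κ)) (hr : returnProbTop d < 1) (n : ℕ) {s : ℝ}
    (hs : 0 ≤ s) :
    Q.real (maxEvent d n s) ≤ meanRange d n * T (returnProbTop d) s := by
  have := hT.prob
  have := h.prob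
  rw [← sum_measureReal_newSite hd h, Finset.sum_mul]
  refine (measureReal_mono (maxEvent_subset n hs) (measure_ne_top _ _)).trans
    ((measureReal_biUnion_finset_le _ _).trans (Finset.sum_le_sum fun k _ => ?_))
  rw [h.measureReal_inter_shift k (measurableSet_newSite k) (measurableSet_lt_occ _ _ _)
    (newSite_congr k)]
  refine mul_le_mul_of_nonneg_left ?_ measureReal_nonneg
  have := locTail_le hd hT h hr (n - k) hs 0
  rwa [hitProb_zero hd, one_mul] at this

/-- Disjoint time blocks are independent. -/
lemma measureReal_maxEvent_compl_le (hd : d ≠ 0) (hT : IsMarkTail κ T)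
    (h : IsIIDLaw Q ((stepLaw d).prod κ)) (L N : ℕ) {s : ℝ} :
    Q.real (maxEvent d (N * L) s)ᶜ ≤ (1 - Q.real (maxEvent d L s)) ^ N := by
  have := h.prob
  induction N with
  | zero => simp
  | succ N ih =>
    -- Sites seen by the second block are relative to `pos z L`; as marks are nonnegative, the local
    -- time within a block is at most the total.
    have hsub : (maxEvent d ((N + 1) * L) s)ᶜ ≤ᵐ[Q]
        ((maxEvent d L s)ᶜ ∩ shift L ⁻¹' (maxEvent d (N * L) s)ᶜ : Set _) := by
      filter_upwards [ae_mark_nonneg hd hT h] with z hz hzc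
      have e : (N + 1) * L = L + N * L := by ring
      have hz' : ∀ x, occ z (L + N * L) (pt x) ≤ s := by
        intro x
        by_contra! hcon
        exact hzc ⟨x, by rwa [e]⟩
      constructor
      · rintro ⟨x, hx⟩
        exact absurd ((occ_mono hz (Nat.le_add_right L (N * L)) (pt_nonneg x)).trans (hz' x))
          (not_le.2 hx)
      · rintro ⟨x, hx⟩
        have h1 := hz' (pos z L + x)
        rw [occ_add, pt_comp_add, add_sub_cancel_left] at h1
        have h2 := occ_nonneg hz L (pt_nonneg (pos z L + x))
        linarith
    have h1 : Q.real (maxEvent d ((N + 1) * L) s)ᶜ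
        ≤ Q.real ((maxEvent d L s)ᶜ ∩ shift L ⁻¹' (maxEvent d (N * L) s)ᶜ) :=
      ENNReal.toReal_mono (measure_ne_top _ _) (measure_mono_ae hsub)
    rw [h.measureReal_inter_shift L (measurableSet_maxEvent L s).compl
      (measurableSet_maxEvent _ s).compl fun z w hzw hz hw => hz (maxEvent_congr L s w z
        (fun j hj => (hzw j hj).symm) hw), probReal_compl_eq_one_sub (measurableSet_maxEvent L s)]
      at h1
    rw [pow_succ']
    refine h1.trans (mul_le_mul_of_nonneg_left ih ?_)
    linarith [measureReal_le_one (μ := Q) (s := maxEvent d L s)]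

lemma measureReal_maxEvent_mono (hd : d ≠ 0) (hT : IsMarkTail κ T)
    (h : IsIIDLaw Q ((stepLaw d).prod κ)) {m n : ℕ} (hmn : m ≤ n) (s : ℝ) :
    Q.real (maxEvent d m s) ≤ Q.real (maxEvent d n s) := by
  have := h.prob
  refine ENNReal.toReal_mono (measure_ne_top _ _) (measure_mono_ae ?_)
  filter_upwards [ae_mark_nonneg hd hT h] with z hz ⟨x, hx⟩
  exact ⟨x, hx.trans_le (occ_mono hz hmn (pt_nonneg x))⟩

/-- A Bonferroni inequality. -/
lemma sum_measureReal_sub_le {Ω : Type*} [MeasurableSpace Ω] (P : Measure Ω) [IsFiniteMeasure P]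
    (B : ℕ → Set Ω) (hB : ∀ k, MeasurableSet (B k)) (n : ℕ) :
    ∑ k ∈ Finset.range n, P.real (B k)
        - ∑ k ∈ Finset.range n, ∑ j ∈ Finset.range k, P.real (B j ∩ B k)
      ≤ P.real (⋃ k ∈ Finset.range n, B k) := by
  induction n with
  | zero => simp
  | succ n ih =>
    rw [Finset.sum_range_succ, Finset.sum_range_succ]
    have e : (⋃ k ∈ Finset.range (n + 1), B k) = (⋃ k ∈ Finset.range n, B k) ∪ B n := by
      rw [Finset.range_add_one, Finset.set_biUnion_insert, Set.union_comm]
    have h1 := measureReal_union_add_inter (μ := P) (s := ⋃ k ∈ Finset.range n, B k) (hB n)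
      (measure_ne_top _ _) (measure_ne_top _ _)
    have h2 : P.real ((⋃ k ∈ Finset.range n, B k) ∩ B n)
        ≤ ∑ j ∈ Finset.range n, P.real (B j ∩ B n) := by
      rw [Set.iUnion₂_inter]
      exact measureReal_biUnion_finset_le _ _
    rw [e]
    linarith

lemma ae_stepLaw_abs_le : ∀ᵐ e ∂(stepLaw d), ∀ i, |e i| ≤ 1 := by
  rw [ae_iff]
  have h1 (j : Fin d) : ∀ i, |(Pi.single j 1 : Fin d → ℤ) i| ≤ 1 := by
    intro i
    rw [Pi.single_apply]
    split_ifs <;> simp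
  simp only [stepLaw, Measure.smul_apply, Measure.finsetSum_apply, Measure.add_apply,
    Measure.dirac_apply, Set.indicator_apply, Set.mem_ofPred_eq, h1, Pi.neg_apply, abs_neg]
  simp

/-- The probability of two sites with large local times in a block. -/
lemma measureReal_two_sites_le (hd : d ≠ 0) (hT : IsMarkTail κ T)
    (h : IsIIDLaw Q ((stepLaw d).prod κ)) {s η : ℝ} {M j k K : ℕ}
    (hjk : j < k) (hkK : k < K)
    (hpair : ∀ n, ∀ y : Fin d → ℤ, y ≠ 0 →
      Q.real {z | 2 * s < occ z n (pt 0) + occ z n (pt y)} ≤ η) :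
    Q.real ((newSite d j ∩ shift j ⁻¹' {z | s < occ z M (pt 0)}) ∩
      (newSite d k ∩ shift k ⁻¹' {z | s < occ z M (pt 0)})) ≤ (2 * K + 1) ^ d * η := by
  have := hT.prob
  have := h.prob
  have := isProbabilityMeasure_stepLaw hd
  obtain ⟨i, rfl⟩ := Nat.exists_eq_add_of_lt hjk
  -- Sites are relative to the position at time `j`. Steps have sup norm at most 1, so the second
  -- site lies in this box, and it is not the origin because it is new at time `k`.
  set box : Finset (Fin d → ℤ) := (Fintype.piFinset fun _ => Finset.Icc (-(K : ℤ)) K).erase 0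
  set A : (Fin d → ℤ) → Set (ℕ → (Fin d → ℤ) × ℝ) := fun y =>
    {z | 2 * s < occ z (i + 1 + M) (pt 0) + occ z (i + 1 + M) (pt y)}
  have hA (y) : MeasurableSet (A y) :=
    measurableSet_lt measurable_const (by fun_prop)
  have hη : 0 ≤ η := measureReal_nonneg.trans
    (hpair 0 (Pi.single ⟨0, Nat.pos_of_ne_zero hd⟩ 1) (by simp))
  have hsub : ((newSite d j ∩ shift j ⁻¹' {z | s < occ z M (pt 0)}) ∩
      (newSite d (j + i + 1) ∩ shift (j + i + 1) ⁻¹' {z | s < occ z M (pt 0)}) : Set _)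
      ≤ᵐ[Q] (shift j ⁻¹' ⋃ y ∈ box, A y : Set _) := by
    have hstep : ∀ᵐ z ∂Q, ∀ k, ∀ i, |(z k).1 i| ≤ 1 :=
      h.ae_all (measurePreserving_fst.quasiMeasurePreserving.ae ae_stepLaw_abs_le)
    filter_upwards [ae_mark_nonneg hd hT h, hstep] with z hz hzs ⟨⟨_, h1⟩, ⟨h2, h3⟩⟩
    set w := shift j z with hw
    have hwn : ∀ k, 0 ≤ (w k).2 := fun k => hz _
    have h1 : s < occ w M (pt 0) := h1
    have h3 : s < occ (shift (i + 1) w) M (pt 0) := by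
      rw [hw, shift_shift, ← add_assoc]
      exact h3
    have hy : pos w (i + 1) ≠ 0 := by
      have := h2 j (by omega)
      rw [add_assoc, pos_add] at this
      simpa using this
    refine Set.mem_iUnion₂.2 ⟨pos w (i + 1), ?_, ?_⟩
    · refine Finset.mem_erase.2 ⟨hy, Fintype.mem_piFinset.2 fun l => Finset.mem_Icc.2 ?_⟩
      rw [← abs_le]
      have : |pos w (i + 1) l| ≤ ((i + 1 : ℕ) : ℤ) := by
        rw [pos, Finset.sum_apply]
        refine (Finset.abs_sum_le_sum_abs _ _).trans ?_
        refine (Finset.sum_le_sum fun m _ => hzs (j + m) l).trans ?_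
        simp
      refine this.trans ?_
      exact_mod_cast (by omega : i + 1 ≤ K)
    · have e1 : occ w M (pt 0) ≤ occ w (i + 1 + M) (pt 0) :=
        occ_mono hwn (by omega) (pt_nonneg 0)
      have e2 : occ (shift (i + 1) w) M (pt 0) ≤ occ w (i + 1 + M) (pt (pos w (i + 1))) := by
        rw [occ_add, pt_comp_add, sub_self]
        have := occ_nonneg hwn (i + 1) (pt_nonneg (pos w (i + 1)))
        linarith
      change 2 * s < occ w (i + 1 + M) (pt 0) + occ w (i + 1 + M) (pt (pos w (i + 1)))
      linarith
  calc _ ≤ Q.real (shift j ⁻¹' ⋃ y ∈ box, A y) :=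
        ENNReal.toReal_mono (measure_ne_top _ _) (measure_mono_ae hsub)
    _ = Q.real (⋃ y ∈ box, A y) := (h.measurePreserving_shift j).measureReal_preimage
        (Finset.measurableSet_biUnion _ fun y _ => hA y).nullMeasurableSet
    _ ≤ ∑ y ∈ box, Q.real (A y) := measureReal_biUnion_finset_le _ _
    _ ≤ ∑ _y ∈ box, η := Finset.sum_le_sum fun y hy => hpair _ y (Finset.ne_of_mem_erase hy)
    _ = box.card * η := by simp
    _ ≤ (2 * K + 1) ^ d * η := by
        gcongr
        have hc : box.card ≤ (2 * K + 1) ^ d := by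
          refine (Finset.card_erase_le).trans_eq ?_
          rw [Fintype.card_piFinset_const, Int.card_Icc]
          congr 1
          omega
        exact_mod_cast hc

lemma mul_le_meanRange (hd : d ≠ 0) (n : ℕ) : (1 - returnProbTop d) * n ≤ meanRange d n := by
  have : ∑ _j ∈ Finset.range n, (1 - returnProbTop d) ≤ meanRange d n :=
    Finset.sum_le_sum fun j _ => by linarith [returnProb_le_returnProbTop hd j]
  rwa [Finset.sum_const, Finset.card_range, nsmul_eq_mul, mul_comm] at this

/-- The lower bound for the tail of the maximal local time in one block. -/
lemma le_measureReal_maxEvent (hd : d ≠ 0) (hT : IsMarkTail κ T)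
    (h : IsIIDLaw Q ((stepLaw d).prod κ)) {s η : ℝ} (K M : ℕ)
    (hpair : ∀ n, ∀ y : Fin d → ℤ, y ≠ 0 →
      Q.real {z | 2 * s < occ z n (pt 0) + occ z n (pt y)} ≤ η) :
    (1 - returnProbTop d) * K * locTail Q M s 0 - K ^ 2 * ((2 * K + 1) ^ d * η)
      ≤ Q.real (maxEvent d (K + M) s) := by
  have := hT.prob
  have := h.prob
  set B : ℕ → Set (ℕ → (Fin d → ℤ) × ℝ) := fun k =>
    newSite d k ∩ shift k ⁻¹' {z | s < occ z M (pt 0)} with hBdef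
  have hBm (k : ℕ) : MeasurableSet (B k) :=
    (measurableSet_newSite k).inter (measurable_shift k (measurableSet_lt_occ _ _ _))
  have hη : 0 ≤ η := measureReal_nonneg.trans
    (hpair 0 (Pi.single ⟨0, Nat.pos_of_ne_zero hd⟩ 1) (by simp))
  have h1 : Q.real (⋃ k ∈ Finset.range K, B k) ≤ Q.real (maxEvent d (K + M) s) := by
    refine ENNReal.toReal_mono (measure_ne_top _ _) (measure_mono_ae ?_)
    filter_upwards [ae_mark_nonneg hd hT h] with z hz hzB
    obtain ⟨k, hk, _, hzk⟩ := Set.mem_iUnion₂.1 hzB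
    have hk := Finset.mem_range.1 hk
    refine ⟨pos z k, ?_⟩
    have h2 := occ_mono hz (show k + M ≤ K + M by omega) (pt_nonneg (pos z k))
    rw [occ_add, pt_comp_add, sub_self] at h2
    have h3 := occ_nonneg hz k (pt_nonneg (pos z k))
    have h4 : s < occ (shift k z) M (pt 0) := hzk
    linarith
  have h2 : ∑ k ∈ Finset.range K, Q.real (B k) = meanRange d K * locTail Q M s 0 := by
    rw [← sum_measureReal_newSite hd h, Finset.sum_mul]
    exact Finset.sum_congr rfl fun k _ => h.measureReal_inter_shift k (measurableSet_newSite k)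
      (measurableSet_lt_occ _ _ _) (newSite_congr k)
  have h3 : ∑ k ∈ Finset.range K, ∑ j ∈ Finset.range k, Q.real (B j ∩ B k)
      ≤ K ^ 2 * ((2 * K + 1) ^ d * η) := by
    have hc : 0 ≤ (2 * (K : ℝ) + 1) ^ d * η := by positivity
    calc _ ≤ ∑ k ∈ Finset.range K, ∑ _j ∈ Finset.range K, (2 * (K : ℝ) + 1) ^ d * η := by
          refine Finset.sum_le_sum fun k hk => ?_
          have hk := Finset.mem_range.1 hk
          refine (Finset.sum_le_sum fun j hj => measureReal_two_sites_le hd hT h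
            (Finset.mem_range.1 hj) hk hpair).trans ?_
          exact Finset.sum_le_sum_of_subset_of_nonneg (Finset.range_mono hk.le) fun _ _ _ => hc
      _ = _ := by
          simp only [Finset.sum_const, Finset.card_range, nsmul_eq_mul]
          ring
  have h4 := sum_measureReal_sub_le Q B hBm K
  have h5 := mul_le_mul_of_nonneg_right (mul_le_meanRange hd K) (locTail_nonneg (Q := Q) M s 0)
  linarith

end Range

/-! ### Block estimate and asymptotics of the maximum -/

section Asymptotics

variable {d : ℕ} {Q : Measure (ℕ → (Fin d → ℤ) × ℝ)} {κ : Measure ℝ} {T : ℝ → ℝ → ℝ}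

/-- For the pair term of Bonferroni's bound: a polynomial number of pairs against an exponential
gap. -/
lemma tendsto_pow_mul_exp_neg {a : ℝ} (ha : 0 < a) (p q : ℕ) :
    Tendsto (fun m : ℕ => (m : ℝ) ^ p * (2 * (m : ℝ) ^ p + 1) ^ q * Real.exp (-a * (m - 1)))
      atTop (nhds 0) := by
  have h1 : Tendsto (fun m : ℕ => Real.exp a * 3 ^ q
      * ((m : ℝ) ^ (p + p * q) * Real.exp (-(a * m)))) atTop (nhds 0) := by
    rw [← mul_zero (Real.exp a * 3 ^ q)]
    refine Tendsto.const_mul _ ?_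
    have h2 := (tendsto_rpow_mul_exp_neg_mul_atTop_nhds_zero ((p + p * q : ℕ) : ℝ) a ha).comp
      tendsto_natCast_atTop_atTop
    refine h2.congr fun m => ?_
    simp only [Function.comp, Real.rpow_natCast, neg_mul]
  refine tendsto_of_tendsto_of_tendsto_of_le_of_le' tendsto_const_nhds h1
    (.of_forall fun m => by positivity) ?_
  filter_upwards [eventually_ge_atTop 1] with m hm
  have hm' : (1 : ℝ) ≤ (m : ℝ) ^ p := one_le_pow₀ (by exact_mod_cast hm)
  have e : Real.exp (-a * (m - 1)) = Real.exp a * Real.exp (-(a * m)) := by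
    rw [← Real.exp_add]
    ring_nf
  rw [e]
  calc (m : ℝ) ^ p * (2 * (m : ℝ) ^ p + 1) ^ q * (Real.exp a * Real.exp (-(a * m)))
      ≤ (m : ℝ) ^ p * (3 * (m : ℝ) ^ p) ^ q * (Real.exp a * Real.exp (-(a * m))) := by
        gcongr
        linarith
    _ = _ := by
        rw [mul_pow, ← pow_mul, pow_add]
        ring

/-- For truncating the geometric sum at `m ^ 2` terms, relative to a tail of size at least `exp (-b
m)`. -/
lemma tendsto_pow_sq_mul_exp {r : ℝ} (hr0 : 0 < r) (hr1 : r < 1) (b : ℝ) :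
    Tendsto (fun m : ℕ => r ^ m ^ 2 * Real.exp (b * m)) atTop (nhds 0) := by
  have h1 : Tendsto (fun m : ℕ => r ^ m * Real.exp b) atTop (nhds 0) := by
    simpa using (tendsto_pow_atTop_nhds_zero_of_lt_one hr0.le hr1).mul_const (Real.exp b)
  have h2 : ∀ᶠ m : ℕ in atTop, r ^ m * Real.exp b ≤ 1 / 2 :=
    h1.eventually_le_const (by norm_num)
  refine tendsto_of_tendsto_of_tendsto_of_le_of_le' tendsto_const_nhds
    (tendsto_pow_atTop_nhds_zero_of_lt_one (r := (1 / 2 : ℝ)) (by norm_num) (by norm_num))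
    (.of_forall fun m => by positivity) ?_
  filter_upwards [h2] with m hm
  calc r ^ m ^ 2 * Real.exp (b * m) = (r ^ m * Real.exp b) ^ m := by
        rw [mul_pow, ← pow_mul, ← Real.exp_nat_mul, sq, mul_comm b]
    _ ≤ _ := by gcongr

/-- The tail of the maximal local time in a block of polynomial length. -/
lemma exists_block_bound (hd : 3 ≤ d) (hT : IsMarkTail κ T)
    (h : IsIIDLaw Q ((stepLaw d).prod κ)) (hr : returnProbTop d < 1) :
    ∃ ε : ℕ → ℝ, Tendsto ε atTop (nhds 0) ∧ (∀ m, 0 ≤ ε m) ∧ ∀ s : ℝ, 0 < s →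
      (1 - returnProbTop d) * (⌈s⌉₊ : ℝ) ^ 7 * T (returnProbTop d) s * (1 - ε ⌈s⌉₊)
        ≤ Q.real (maxEvent d (⌈s⌉₊ ^ 7 + ⌈s⌉₊ ^ 2 * (⌈s⌉₊ ^ 4 + 1)) s) := by
  have hd0 : d ≠ 0 := by omega
  have := hT.prob
  obtain ⟨C, hC, hrate⟩ := exists_returnProbTop_le hd h
  obtain ⟨b, c, D, hb, hbc, hD, hbT, hpair⟩ := exists_pair_bound hd0 hT h hr
  set r := returnProbTop d with hrdef
  have hr0 : 0 < r := returnProbTop_pos hd0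
  have hγ : 0 < 1 - r := by linarith
  -- Three relative errors: the deadline of `m ^ 4` steps for each return, costing `s * m ^ (-2)` up
  -- to constants; the truncation after `m ^ 2` returns; the pairs of sites. With `m ^ 7` starting
  -- times, the extra `m ^ 2 * (m ^ 4 + 1)` steps of a block are of lower order.
  refine ⟨fun m => C / r * (m : ℝ)⁻¹ + r ^ m ^ 2 * Real.exp (b * m) + D / (1 - r) *
    ((m : ℝ) ^ 7 * (2 * (m : ℝ) ^ 7 + 1) ^ d * Real.exp (-(2 * c - b) * (m - 1))), ?_,
    fun m => by positivity, fun s hs => ?_⟩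
  · have h1 := (tendsto_inv_atTop_nhds_zero_nat (𝕜 := ℝ)).const_mul (C / r)
    have h2 := tendsto_pow_sq_mul_exp hr0 hr b
    have h3 := (tendsto_pow_mul_exp_neg (a := 2 * c - b) (by linarith) 7 d).const_mul (D / (1 - r))
    simpa using (h1.add h2).add h3
  · set m := ⌈s⌉₊ with hm
    have hm1 : 1 ≤ m := Nat.one_le_iff_ne_zero.2 (Nat.ceil_pos.2 hs).ne'
    have hm0 : (0 : ℝ) < m := by exact_mod_cast hm1
    have hsm : s ≤ m := Nat.le_ceil s
    have hms : (m : ℝ) - 1 ≤ s := by have := Nat.ceil_lt_add_one hs.le; linarith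
    have hTs := hbT s hs.le
    have hT0 : 0 < T r s := (Real.exp_pos _).trans_le hTs
    set θ := returnProb d (m ^ 4) with hθ
    have hθ0 : 0 ≤ θ := returnProb_nonneg _
    have hθr : θ ≤ r := returnProb_le_returnProbTop hd0 _
    have hblock := le_measureReal_maxEvent hd0 hT h (m ^ 7) (m ^ 2 * (m ^ 4 + 1))
      (fun n y hy => hpair n s y hy)
    refine le_trans ?_ hblock
    have hloc := le_locTail hd0 hT h hr (m ^ 4) (m ^ 2) hs.le
    have hcomp := hT.comparison θ r s hθ0 hθr hr0 hr hs.le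
    have hθm : r - θ ≤ C * ((m : ℝ) ^ 2)⁻¹ := by
      have := hrate (m ^ 4) (by positivity)
      have e : √((m ^ 4 : ℕ) : ℝ) = (m : ℝ) ^ 2 := by
        rw [Nat.cast_pow, show (m : ℝ) ^ 4 = ((m : ℝ) ^ 2) ^ 2 by ring,
          Real.sqrt_sq (by positivity)]
      rw [e] at this
      linarith
    have e1 : s * ((r - θ) / r) ≤ C / r * (m : ℝ)⁻¹ := by
      calc s * ((r - θ) / r) ≤ m * (C * ((m : ℝ) ^ 2)⁻¹ / r) := by gcongr
        _ = C / r * (m : ℝ)⁻¹ := by field_simp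
    have e2 : θ ^ m ^ 2 ≤ T r s * (r ^ m ^ 2 * Real.exp (b * m)) := by
      calc θ ^ m ^ 2 ≤ r ^ m ^ 2 := by gcongr
        _ = Real.exp (-b * s) * (r ^ m ^ 2 * Real.exp (b * s)) := by
            rw [mul_left_comm, ← Real.exp_add]
            simp
        _ ≤ T r s * (r ^ m ^ 2 * Real.exp (b * m)) := by gcongr
    have e3 : (((m ^ 7 : ℕ) : ℝ)) ^ 2 * ((2 * ((m ^ 7 : ℕ) : ℝ) + 1) ^ d
        * (D * Real.exp (-(2 * c) * s)))
        ≤ (1 - r) * (m : ℝ) ^ 7 * T r s * (D / (1 - r) * ((m : ℝ) ^ 7 *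
          (2 * (m : ℝ) ^ 7 + 1) ^ d * Real.exp (-(2 * c - b) * (m - 1)))) := by
      have e4 : Real.exp (-(2 * c) * s) ≤ T r s * Real.exp (-(2 * c - b) * (m - 1)) := by
        calc Real.exp (-(2 * c) * s) = Real.exp (-b * s) * Real.exp (-(2 * c - b) * s) := by
              rw [← Real.exp_add]
              ring_nf
          _ ≤ _ := by
              refine mul_le_mul hTs (Real.exp_le_exp.2 ?_) (Real.exp_pos _).le hT0.le
              nlinarith
      push_cast
      calc ((m : ℝ) ^ 7) ^ 2 * ((2 * (m : ℝ) ^ 7 + 1) ^ d * (D * Real.exp (-(2 * c) * s)))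
          ≤ ((m : ℝ) ^ 7) ^ 2 * ((2 * (m : ℝ) ^ 7 + 1) ^ d
            * (D * (T r s * Real.exp (-(2 * c - b) * (m - 1))))) := by gcongr
        _ = _ := by
            field_simp
    have e5 : T r s * (1 - C / r * (m : ℝ)⁻¹ - r ^ m ^ 2 * Real.exp (b * m))
        ≤ locTail Q (m ^ 2 * (m ^ 4 + 1)) s 0 := by
      have := mul_le_mul_of_nonneg_left e1 hT0.le
      linarith
    have e6 := mul_le_mul_of_nonneg_left e5 (by positivity : 0 ≤ (1 - r) * (m : ℝ) ^ 7)
    push_cast at e3 ⊢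
    linarith

/-- Multiplying by `1 + N p ≤ (1 + p) ^ N` leaves `(1 - p ^ 2) ^ N ≤ 1`. The resulting bound `1 - (1
- p) ^ N ≥ N p / (1 + N p)` is sharp as `N p → 0`. -/
lemma one_sub_pow_le {p : ℝ} (h0 : 0 ≤ p) (h1 : p ≤ 1) (N : ℕ) :
    (1 - p) ^ N ≤ (1 + N * p)⁻¹ := by
  have hN : 0 < 1 + N * p := by positivity
  rw [← one_div, le_div_iff₀ hN]
  have h2 := one_add_mul_le_pow (a := p) (by linarith) N
  calc (1 - p) ^ N * (1 + N * p) ≤ (1 - p) ^ N * (1 + p) ^ N := by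
        have : 0 ≤ 1 - p := by linarith
        gcongr
    _ = (1 - p ^ 2) ^ N := by rw [← mul_pow]; ring
    _ ≤ 1 := pow_le_one₀ (by nlinarith) (by nlinarith)

lemma tendsto_meanRange_div (hd : d ≠ 0) :
    Tendsto (fun n : ℕ => meanRange d n / n) atTop (nhds (1 - returnProbTop d)) := by
  have h1 := ((tendsto_returnProb (d := d) hd).const_sub 1).cesaro
  refine h1.congr fun n => ?_
  rw [meanRange, div_eq_inv_mul]

/-- The asymptotics of the tail of the maximal local time of a marked walk. -/
theorem isEquivalent_measureReal_maxEvent (hd : 3 ≤ d) (hT : IsMarkTail κ T)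
    (h : IsIIDLaw Q ((stepLaw d).prod κ)) {ι : Type*} {l : Filter ι} {n : ι → ℕ} {s : ι → ℝ}
    (hn : Tendsto n l atTop) (hs : Tendsto s l atTop)
    (hns : Tendsto (fun i => (⌈s i⌉₊ : ℝ) ^ 7 / n i) l (nhds 0))
    (hnT : Tendsto (fun i => n i * T (returnProbTop d) (s i)) l (nhds 0)) :
    (fun i => Q.real (maxEvent d (n i) (s i))) ~[l]
      fun i => (1 - returnProbTop d) * n i * T (returnProbTop d) (s i) := by
  have hd0 : d ≠ 0 := by omega
  have := hT.prob
  have := h.prob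
  have hr := returnProbTop_lt_one hd h
  set r := returnProbTop d with hrdef
  have hr0 : 0 < r := returnProbTop_pos hd0
  have hγ : 0 < 1 - r := by linarith
  obtain ⟨ε, hε, hε0, hblock⟩ := exists_block_bound hd hT h hr
  obtain ⟨b, -, -, -, -, hbT, -⟩ := hT.exp_moment r hr0 hr
  have hpos : ∀ᶠ i in l, 0 < s i ∧ 0 < (n i : ℝ) := by
    filter_upwards [hs.eventually_gt_atTop 0, hn.eventually_gt_atTop 0] with i h1 h2
    exact ⟨h1, by exact_mod_cast h2⟩
  have hm : Tendsto (fun i => ⌈s i⌉₊) l atTop := tendsto_nat_ceil_atTop.comp hs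
  have hεm : Tendsto (fun i => ε ⌈s i⌉₊) l (nhds 0) := hε.comp hm
  have hTpos (x : ℝ) (hx : 0 < x) : 0 < T r x := (Real.exp_pos _).trans_le (hbT x hx.le)
  refine (isEquivalent_iff_tendsto_one ?_).2 ?_
  · filter_upwards [hpos] with i ⟨h1, h2⟩
    have := hTpos _ h1
    positivity
  -- With `L` the block length, the first factor is `m ^ 7 / L` minus `m ^ 7 / n`, the loss from
  -- rounding down the number of blocks. The others are the block error and the loss `1 / (1 + w)`
  -- in combining blocks, `w` being the claimed equivalent.
  have hlow : Tendsto (fun i => ((1 + (⌈s i⌉₊ : ℝ)⁻¹ + (⌈s i⌉₊ : ℝ)⁻¹ ^ 5)⁻¹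
      - (⌈s i⌉₊ : ℝ) ^ 7 / n i) * (1 - ε ⌈s i⌉₊)
      * (1 + (1 - r) * (n i * T r (s i)))⁻¹) l (nhds 1) := by
    have hinv : Tendsto (fun i => (⌈s i⌉₊ : ℝ)⁻¹) l (nhds 0) :=
      (tendsto_inv_atTop_nhds_zero_nat (𝕜 := ℝ)).comp hm
    have h1 : Tendsto (fun i => (1 + (⌈s i⌉₊ : ℝ)⁻¹ + (⌈s i⌉₊ : ℝ)⁻¹ ^ 5)⁻¹) l (nhds 1) := by
      simpa using ((hinv.const_add 1).add (hinv.pow 5)).inv₀ (by simp)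
    have h2 : Tendsto (fun i => (1 + (1 - r) * (n i * T r (s i)))⁻¹) l (nhds 1) := by
      simpa using ((hnT.const_mul (1 - r)).const_add 1).inv₀ (by simp)
    simpa using ((h1.sub hns).mul (hεm.const_sub 1)).mul h2
  have hup : Tendsto (fun i => (1 - r)⁻¹ * (meanRange d (n i) / n i)) l (nhds 1) := by
    have := ((tendsto_meanRange_div (d := d) hd0).comp hn).const_mul (1 - r)⁻¹
    rwa [inv_mul_cancel₀ hγ.ne'] at this
  refine tendsto_of_tendsto_of_tendsto_of_le_of_le' hlow hup ?_ ?_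
  · have hεlt : ∀ᶠ i in l, ε ⌈s i⌉₊ < 1 := hεm.eventually_lt_const one_pos
    filter_upwards [hpos, hεlt] with i ⟨h1, h2⟩ h3
    have hTi := hTpos _ h1
    set m := ⌈s i⌉₊ with hmdef
    have hm1 : 1 ≤ m := Nat.one_le_iff_ne_zero.2 (Nat.ceil_pos.2 h1).ne'
    have hm0 : (0 : ℝ) < m := by exact_mod_cast hm1
    set L := m ^ 7 + m ^ 2 * (m ^ 4 + 1) with hL
    have hL0 : 0 < L := by positivity
    set N := n i / L with hN
    set p := Q.real (maxEvent d L (s i)) with hp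
    have hp1 : p ≤ 1 := measureReal_le_one
    have hp0 : 0 ≤ p := measureReal_nonneg
    have hpb := hblock (s i) h1
    rw [← hmdef, ← hL, ← hp] at hpb
    have hNL : N * L ≤ n i := Nat.div_mul_le_self _ _
    have hQ : 1 - (1 + N * p)⁻¹ ≤ Q.real (maxEvent d (n i) (s i)) := by
      have h4 := measureReal_maxEvent_compl_le hd0 hT h L N (s := s i)
      rw [probReal_compl_eq_one_sub (measurableSet_maxEvent _ _)] at h4
      have h5 := measureReal_maxEvent_mono hd0 hT h hNL (s i)
      have h6 := one_sub_pow_le hp0 hp1 N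
      linarith
    set y := N * ((1 - r) * (m : ℝ) ^ 7 * T r (s i) * (1 - ε m)) with hy
    have hε1 : 0 < 1 - ε m := by linarith
    have hy0 : 0 ≤ y := by positivity
    have hyp : y ≤ N * p := by rw [hy]; gcongr
    have hQ2 : y * (1 + y)⁻¹ ≤ Q.real (maxEvent d (n i) (s i)) := by
      refine le_trans ?_ hQ
      have e : y * (1 + y)⁻¹ = 1 - (1 + y)⁻¹ := by
        field_simp
        ring
      rw [e]
      gcongr
    set w := (1 - r) * n i * T r (s i) with hw
    have hw0 : 0 < w := by positivity
    have hNm : (N : ℝ) * (m : ℝ) ^ 7 ≤ n i := by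
      have : m ^ 7 ≤ L := Nat.le_add_right _ _
      exact_mod_cast (Nat.mul_le_mul_left N this).trans hNL
    have hyw : y ≤ w := by
      calc y = ((N : ℝ) * (m : ℝ) ^ 7) * ((1 - r) * T r (s i)) * (1 - ε m) := by rw [hy]; ring
        _ ≤ n i * ((1 - r) * T r (s i)) * 1 := by
            gcongr
            linarith [hε0 m]
        _ = w := by rw [hw]; ring
    have hLm : (L : ℝ) = (m : ℝ) ^ 7 + (m : ℝ) ^ 6 + (m : ℝ) ^ 2 := by
      rw [hL]
      push_cast
      ring
    have hL0' : (0 : ℝ) < L := by exact_mod_cast hL0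
    have hA : (1 + (m : ℝ)⁻¹ + (m : ℝ)⁻¹ ^ 5)⁻¹ = (m : ℝ) ^ 7 / L := by
      rw [hLm]
      field_simp
    have hNge : (n i : ℝ) / L - 1 ≤ N := by
      have := Nat.lt_div_mul_add (a := n i) hL0
      rw [← hN] at this
      have h6 : (n i : ℝ) < N * L + L := by exact_mod_cast this
      rw [sub_le_iff_le_add, div_le_iff₀ hL0']
      linarith
    have hmain : ((m : ℝ) ^ 7 / L - (m : ℝ) ^ 7 / n i) * (1 - ε m) * w ≤ y := by
      calc ((m : ℝ) ^ 7 / L - (m : ℝ) ^ 7 / n i) * (1 - ε m) * w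
          = ((n i : ℝ) / L - 1) * ((1 - r) * (m : ℝ) ^ 7 * T r (s i) * (1 - ε m)) := by
            rw [hw]
            field_simp
        _ ≤ y := by
            rw [hy]
            gcongr
    rw [Pi.div_apply, le_div_iff₀ hw0, hA, show (1 - r) * (n i * T r (s i)) = w by rw [hw]; ring]
    calc _ = ((m : ℝ) ^ 7 / L - (m : ℝ) ^ 7 / n i) * (1 - ε m) * w * (1 + w)⁻¹ := by ring
      _ ≤ y * (1 + w)⁻¹ := by gcongr
      _ ≤ y * (1 + y)⁻¹ := by gcongr
      _ ≤ _ := hQ2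
  · filter_upwards [hpos] with i ⟨h1, h2⟩
    have hTi := hTpos _ h1
    have := measureReal_maxEvent_le hd0 hT h hr (n i) h1.le
    simp only [Pi.div_apply]
    rw [div_le_iff₀ (by positivity)]
    refine this.trans_eq ?_
    rw [← hrdef]
    field_simp

end Asymptotics

/-! ### Unit marks and exponential marks -/

section Marks

/-- Unit marks. -/
lemma isMarkTail_dirac :
    IsMarkTail (Measure.dirac (1 : ℝ)) fun θ s => θ ^ ⌊s⌋₊ where
  prob := inferInstance
  mark_nonneg := by simp [ae_dirac_eq]
  measurable θ := (Measurable.of_discrete (f := fun k : ℕ => θ ^ k)).comp Nat.measurable_floor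
  nonneg θ s hθ := pow_nonneg hθ _
  le_one θ s h0 h1 _ := pow_le_one₀ h0 h1.le
  renewal θ s _ _ hs := by
    rw [integral_dirac]
    split_ifs with h
    · rw [Nat.floor_eq_zero.2 h, pow_zero]
    · rw [Nat.floor_sub_one, ← pow_succ', Nat.sub_add_cancel]
      exact Nat.le_floor (by simpa using h)
  comparison θ r s h0 hr hr0 hr1 hs := by
    have hk : (⌊s⌋₊ : ℝ) ≤ s := Nat.floor_le hs
    set k := ⌊s⌋₊
    have hq : 0 ≤ θ / r := by positivity
    have h1 := one_add_mul_le_pow (a := θ / r - 1) (by linarith) k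
    have h2 : (r - θ) / r = 1 - θ / r := by field_simp
    have h3 : θ / r ≤ 1 := (div_le_one hr0).2 hr
    calc r ^ k * (1 - s * ((r - θ) / r)) ≤ r ^ k * (1 + (θ / r - 1)) ^ k := by
          gcongr
          rw [h2]
          nlinarith
      _ = θ ^ k := by
          rw [← mul_pow]
          congr 1
          field_simp
          ring
  exp_moment r hr0 hr1 := by
    have hlog : Real.log r < 0 := Real.log_neg hr0 hr1
    have hx : 0 < (1 + r) / (2 * r) := by positivity
    -- After doubling and exponentiating, this follows from `4 r < (1 + r) ^ 2`. It leaves room for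
    -- `c` with `-log r < 2 c` and `exp c * (2 r / (1 + r)) < 1`.
    have hlt : -Real.log r / 2 < Real.log ((1 + r) / (2 * r)) := by
      have h1 : Real.log r⁻¹ < Real.log (((1 + r) / (2 * r)) ^ 2) := by
        refine Real.log_lt_log (by positivity) ?_
        rw [div_pow, lt_div_iff₀ (by positivity)]
        have : r⁻¹ * (2 * r) ^ 2 = 4 * r := by field_simp; ring
        rw [this]
        nlinarith [mul_pos (sub_pos.2 hr1) (sub_pos.2 hr1)]
      rw [Real.log_inv, Real.log_pow] at h1
      push_cast at h1
      linarith
    obtain ⟨c, hc1, hc2⟩ := exists_between hlt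
    refine ⟨-Real.log r, c, Real.exp c, by linarith, by linarith, fun s hs => ?_,
      Real.one_le_exp (by linarith), ?_, ?_⟩
    · rw [neg_neg, mul_comm, ← Real.log_rpow hr0, Real.exp_log (by positivity),
        ← Real.rpow_natCast]
      exact Real.rpow_le_rpow_of_exponent_ge hr0 hr1.le (Nat.floor_le hs)
    · have h1 : Real.exp c < (1 + r) / (2 * r) := by
        rw [← Real.exp_log hx]
        exact Real.exp_lt_exp.2 hc2
      calc Real.exp c * (2 * r / (1 + r)) < (1 + r) / (2 * r) * (2 * r / (1 + r)) := by gcongr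
        _ = 1 := by field_simp
    · simp

lemma expMeasure_one_eq : expMeasure 1
    = (volume.restrict (Set.Ioi 0)).withDensity fun x => ENNReal.ofReal (Real.exp (-x)) := by
  rw [expMeasure, gammaMeasure, ← withDensity_indicator measurableSet_Ioi]
  refine withDensity_congr_ae ?_
  filter_upwards [Measure.ae_ne volume (0 : ℝ)] with x hx
  change exponentialPDF 1 x = _
  rw [exponentialPDF_eq]
  by_cases h : 0 < x
  · simp [h, h.le]
  · have : ¬ 0 ≤ x := fun h' => h (lt_of_le_of_ne h' (Ne.symm hx))
    simp [h, this]

lemma lintegral_expMeasure_one {f : ℝ → ℝ≥0∞} (hf : Measurable f) :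
    ∫⁻ x, f x ∂(expMeasure 1) = ∫⁻ x in Set.Ioi 0, ENNReal.ofReal (Real.exp (-x)) * f x := by
  rw [expMeasure_one_eq, lintegral_withDensity_eq_lintegral_mul _ (by fun_prop) hf]
  rfl

lemma integral_expMeasure_one (f : ℝ → ℝ) :
    ∫ x, f x ∂(expMeasure 1) = ∫ x in Set.Ioi 0, Real.exp (-x) * f x := by
  rw [expMeasure_one_eq, integral_withDensity_eq_integral_toReal_smul (by fun_prop)
    (.of_forall fun _ => ENNReal.ofReal_lt_top)]
  congr 1
  ext x
  rw [ENNReal.toReal_ofReal (Real.exp_pos _).le, smul_eq_mul]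

lemma lintegral_exp_mul_expMeasure_one {c : ℝ} (hc : c < 1) :
    ∫⁻ x, ENNReal.ofReal (Real.exp (c * x)) ∂(expMeasure 1) = ENNReal.ofReal (1 - c)⁻¹ := by
  rw [lintegral_expMeasure_one (by fun_prop)]
  have h1 (x : ℝ) : ENNReal.ofReal (Real.exp (-x)) * ENNReal.ofReal (Real.exp (c * x))
      = ENNReal.ofReal (Real.exp (-(1 - c) * x)) := by
    rw [← ENNReal.ofReal_mul (Real.exp_pos _).le, ← Real.exp_add]
    ring_nf
  simp_rw [h1]
  rw [← ofReal_integral_eq_lintegral_ofReal (exp_neg_integrableOn_Ioi 0 (by linarith))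
    (.of_forall fun x => (Real.exp_pos _).le), integral_exp_mul_Ioi (by linarith) 0]
  congr 1
  rw [mul_zero, Real.exp_zero, neg_div_neg_eq, one_div]

lemma ae_nonneg_expMeasure_one : ∀ᵐ x ∂(expMeasure 1), 0 ≤ x := by
  rw [expMeasure_one_eq]
  refine withDensity_absolutelyContinuous _ _ ?_
  exact (ae_restrict_mem measurableSet_Ioi).mono fun x hx => le_of_lt hx

/-- The first mark overshoots with probability `exp (-s)`, and the part `x ≤ s` contributes `exp
(-(1 - θ) s) - exp (-s)`: a geometric sum of `Exp(1)` marks is exponential with rate `1 - θ`. -/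
lemma renewal_exp {θ s : ℝ} (hs : 0 ≤ s) :
    ∫ x, (if s < x then 1 else θ * Real.exp (-(1 - θ) * (s - x))) ∂(expMeasure 1)
      = Real.exp (-(1 - θ) * s) := by
  rw [integral_expMeasure_one, ← Set.Ioc_union_Ioi_eq_Ioi hs]
  set F : ℝ → ℝ := fun x => Real.exp (-x)
    * (if s < x then 1 else θ * Real.exp (-(1 - θ) * (s - x)))
  have hF1 : Set.EqOn F (fun x => θ * Real.exp (-(1 - θ) * s) * Real.exp (-θ * x))
      (Set.Ioc 0 s) := by
    intro x hx
    simp only [F, if_neg (not_lt.2 hx.2)]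
    rw [mul_left_comm, ← Real.exp_add, mul_assoc, ← Real.exp_add]
    ring_nf
  have hF2 : Set.EqOn F (fun x => Real.exp (-x)) (Set.Ioi s) := by
    intro x hx
    simp only [F, if_pos (Set.mem_Ioi.1 hx), mul_one]
  have hi1 : IntegrableOn F (Set.Ioc 0 s) :=
    (integrableOn_congr_fun hF1 measurableSet_Ioc).2
      (by fun_prop : Continuous fun x =>
        θ * Real.exp (-(1 - θ) * s) * Real.exp (-θ * x)).integrableOn_Ioc
  have hi2 : IntegrableOn F (Set.Ioi s) :=
    (integrableOn_congr_fun hF2 measurableSet_Ioi).2 (integrableOn_exp_neg_Ioi s)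
  have hI1 : ∫ x in Set.Ioc 0 s, F x
      = Real.exp (-(1 - θ) * s) * (1 - Real.exp (-θ * s)) := by
    rw [setIntegral_congr_fun measurableSet_Ioc hF1, ← intervalIntegral.integral_of_le hs]
    have hderiv (x : ℝ) : HasDerivAt (fun x => -(Real.exp (-(1 - θ) * s) * Real.exp (-θ * x)))
        (θ * Real.exp (-(1 - θ) * s) * Real.exp (-θ * x)) x := by
      have h1 : HasDerivAt (fun x => Real.exp (-θ * x)) (Real.exp (-θ * x) * (-θ * 1)) x :=
        ((hasDerivAt_id x).const_mul (-θ)).exp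
      refine (h1.const_mul (Real.exp (-(1 - θ) * s))).neg.congr_deriv ?_
      ring
    rw [intervalIntegral.integral_eq_sub_of_hasDerivAt (fun x _ => hderiv x)
      ((by fun_prop : Continuous fun x =>
        θ * Real.exp (-(1 - θ) * s) * Real.exp (-θ * x)).intervalIntegrable _ _)]
    rw [mul_zero, Real.exp_zero]
    ring
  have hI2 : ∫ x in Set.Ioi s, F x = Real.exp (-s) := by
    rw [setIntegral_congr_fun measurableSet_Ioi hF2, integral_exp_neg_Ioi]
  rw [setIntegral_union (Set.Ioc_disjoint_Ioi le_rfl) measurableSet_Ioi hi1 hi2, hI1, hI2,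
    mul_sub, ← Real.exp_add, mul_one]
  ring_nf

/-- Standard exponential marks. -/
lemma isMarkTail_expMeasure :
    IsMarkTail (expMeasure 1) fun θ s => Real.exp (-(1 - θ) * s) where
  prob := isProbabilityMeasure_expMeasure one_pos
  mark_nonneg := ae_nonneg_expMeasure_one
  measurable θ := by fun_prop
  nonneg θ s _ := (Real.exp_pos _).le
  le_one θ s h0 h1 hs := Real.exp_le_one_iff.2 (by nlinarith)
  renewal θ s _ _ hs := renewal_exp hs
  comparison θ r s h0 hr hr0 hr1 hs := by
    have h1 : 1 - s * ((r - θ) / r) ≤ Real.exp (-(r - θ) * s) := by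
      refine le_trans ?_ (Real.add_one_le_exp _)
      have : r - θ ≤ (r - θ) / r := le_div_self (by linarith) hr0 hr1.le
      nlinarith
    calc Real.exp (-(1 - r) * s) * (1 - s * ((r - θ) / r))
        ≤ Real.exp (-(1 - r) * s) * Real.exp (-(r - θ) * s) := by gcongr
      _ = _ := by
          rw [← Real.exp_add]
          ring_nf
  exp_moment r hr0 hr1 := by
    -- With `b = 1 - r` and `Λ = (1 - c)⁻¹`, the requirements `b < 2 c` and `Λ * (2 r / (1 + r)) <
    -- 1` are exactly the two bounds on `c`.
    have hlt : (1 - r) / 2 < (1 - r) / (1 + r) :=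
      div_lt_div_of_pos_left (by linarith) (by linarith) (by linarith)
    obtain ⟨c, hc1, hc2⟩ := exists_between hlt
    have hc2' : c * (1 + r) < 1 - r := (lt_div_iff₀ (by linarith)).1 hc2
    have hcr : c < 1 - r := by nlinarith
    have hc0 : 0 < 1 - c := by linarith
    refine ⟨1 - r, c, (1 - c)⁻¹, by linarith, by linarith, fun s _ => le_rfl,
      (one_le_inv₀ hc0).2 (by linarith), ?_, (lintegral_exp_mul_expMeasure_one (by linarith)).le⟩
    rw [inv_mul_lt_iff₀ hc0, mul_one, div_lt_iff₀ (by linarith)]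
    nlinarith

end Marks

/-! ### From the two walks to marked paths -/

section Transfer

variable {Ω : Type*} {d : ℕ}

/-- The sequence of steps of `S`, marked with `H`. -/
def markedSteps (S : ℕ → Ω → (Fin d → ℤ)) (H : ℕ → Ω → ℝ) (ω : Ω) : ℕ → (Fin d → ℤ) × ℝ :=
  fun n => (S (n + 1) ω - S n ω, H n ω)

lemma pos_markedSteps {S : ℕ → Ω → (Fin d → ℤ)} (hS : ∀ ω, S 0 ω = 0) (H : ℕ → Ω → ℝ) (ω : Ω)
    (k : ℕ) : pos (markedSteps S H ω) k = S k ω := by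
  simp only [pos, markedSteps]
  rw [Finset.sum_range_sub (fun n => S n ω), hS, sub_zero]

lemma occ_markedSteps {S : ℕ → Ω → (Fin d → ℤ)} (hS : ∀ ω, S 0 ω = 0) (H : ℕ → Ω → ℝ) (ω : Ω)
    (n : ℕ) (f : (Fin d → ℤ) → ℝ) :
    occ (markedSteps S H ω) n f = ∑ k ∈ Finset.range n, f (S k ω) * H k ω := by
  simp only [occ, pos_markedSteps hS]
  rfl

variable {S : ℕ → Ω → (Fin d → ℤ)} {H : ℕ → Ω → ℝ}

/-- The index is `n + 1` because `ξ(n, x)` includes time `n`, whereas `occ z n` sums over times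
before `n`. -/
lemma lt_maxDiscreteLocalTime_iff (hS : ∀ ω, S 0 ω = 0) (n : ℕ) (s : ℝ) (ω : Ω) :
    s < (maxDiscreteLocalTime S n ω : ℝ)
      ↔ markedSteps S (fun _ _ => 1) ω ∈ maxEvent d (n + 1) s := by
  have e (x : Fin d → ℤ) : occ (markedSteps S (fun _ _ => 1) ω) (n + 1) (pt x)
      = discreteLocalTime S n x ω := by
    rw [occ_markedSteps hS]
    simp [discreteLocalTime, pt]
  have hbdd : BddAbove (Set.range fun x => discreteLocalTime S n x ω) := by
    refine ⟨n + 1, ?_⟩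
    rintro _ ⟨x, rfl⟩
    refine (Finset.sum_le_sum (g := fun _ => 1) fun k _ => ?_).trans (by simp)
    split_ifs <;> simp
  simp only [maxEvent, Set.mem_ofPred_eq, e]
  constructor
  · intro h
    obtain ⟨x, hx⟩ := Nat.sSup_mem (Set.range_nonempty fun x => discreteLocalTime S n x ω) hbdd
    refine ⟨x, ?_⟩
    rw [show discreteLocalTime S n x ω = maxDiscreteLocalTime S n ω from hx]
    exact h
  · rintro ⟨x, hx⟩
    exact hx.trans_le (Nat.cast_le.2 (le_ciSup hbdd x))

lemma jumpTime_mono {ω : Ω} (hH : ∀ k, 0 ≤ H k ω) : Monotone fun n => jumpTime H n ω :=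
  monotone_nat_of_le_succ fun n => by
    simp only [jumpTime, Finset.sum_range_succ]
    linarith [hH n]

lemma jumpCount_eq {ω : Ω} (hH : ∀ k, 0 ≤ H k ω) {k : ℕ} {t : ℝ} (h1 : jumpTime H k ω ≤ t)
    (h2 : t < jumpTime H (k + 1) ω) : jumpCount H t ω = k := by
  refine le_antisymm (Nat.sInf_le h2) (le_csInf ⟨k, h2⟩ fun n hn => ?_)
  by_contra! hlt
  have := jumpTime_mono hH (show n + 1 ≤ k by omega)
  have hn : t < jumpTime H (n + 1) ω := hn
  simp only at this
  linarith

/-- During the `k`-th holding time the walk sits at `S k`; the right endpoint, where it has already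
jumped, is null. -/
lemma integral_contWalk_step {ω : Ω} (hH : ∀ k, 0 ≤ H k ω) (x : Fin d → ℤ) (k : ℕ) :
    IntervalIntegrable (fun s => if contWalk S H s ω = x then (1 : ℝ) else 0) volume
        (jumpTime H k ω) (jumpTime H (k + 1) ω) ∧
      ∫ s in jumpTime H k ω..jumpTime H (k + 1) ω, (if contWalk S H s ω = x then (1 : ℝ) else 0)
        = pt x (S k ω) * H k ω := by
  have hle : jumpTime H k ω ≤ jumpTime H (k + 1) ω := jumpTime_mono hH (Nat.le_succ k)
  have hae : (fun s => if contWalk S H s ω = x then (1 : ℝ) else 0)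
      =ᵐ[volume.restrict (Set.Ioc (jumpTime H k ω) (jumpTime H (k + 1) ω))]
        fun _ => pt x (S k ω) := by
    filter_upwards [ae_restrict_mem measurableSet_Ioc,
      ae_restrict_of_ae (Measure.ae_ne volume (jumpTime H (k + 1) ω))] with s hs hne
    simp only [contWalk, jumpCount_eq hH hs.1.le (lt_of_le_of_ne hs.2 hne), pt]
  constructor
  · rw [intervalIntegrable_iff_integrableOn_Ioc_of_le hle]
    exact (integrable_const _).congr hae.symm
  · rw [intervalIntegral.integral_of_le hle, integral_congr_ae hae,
      ← intervalIntegral.integral_of_le hle, intervalIntegral.integral_const, smul_eq_mul, mul_comm]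
    simp [jumpTime, Finset.sum_range_succ]

lemma integral_contWalk {ω : Ω} (hS : ∀ ω, S 0 ω = 0) (hH : ∀ k, 0 ≤ H k ω) (x : Fin d → ℤ)
    (n : ℕ) :
    IntervalIntegrable (fun s => if contWalk S H s ω = x then (1 : ℝ) else 0) volume
        0 (jumpTime H n ω) ∧
      ∫ s in (0 : ℝ)..jumpTime H n ω, (if contWalk S H s ω = x then (1 : ℝ) else 0)
        = occ (markedSteps S H ω) n (pt x) := by
  have h0 : jumpTime H 0 ω = 0 := by simp [jumpTime]
  rw [occ_markedSteps hS]
  nth_rewrite 1 [← h0]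
  refine ⟨IntervalIntegrable.trans_iterate fun k _ => (integral_contWalk_step hH x k).1, ?_⟩
  have h1 := intervalIntegral.sum_integral_adjacent_intervals (n := n)
    fun k _ => (integral_contWalk_step (S := S) hH x k).1
  rw [h0] at h1
  rw [← h1]
  exact Finset.sum_congr rfl fun k _ => (integral_contWalk_step hH x k).2

lemma contLocalTime_le {ω : Ω} (hS : ∀ ω, S 0 ω = 0) (hH : ∀ k, 0 ≤ H k ω) (x : Fin d → ℤ)
    {n : ℕ} {t : ℝ} (ht : 0 ≤ t) (htn : t ≤ jumpTime H n ω) :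
    contLocalTime S H t x ω ≤ occ (markedSteps S H ω) n (pt x) := by
  obtain ⟨hi, he⟩ := integral_contWalk hS hH x n
  rw [← he]
  refine intervalIntegral.integral_mono_interval le_rfl ht htn (.of_forall fun s => ?_) hi
  simp only [Pi.zero_apply]
  split_ifs <;> simp

/-- The later jump time `n` serves only for integrability up to `t`, without which the integral
would take the default value 0. -/
lemma le_contLocalTime {ω : Ω} (hS : ∀ ω, S 0 ω = 0) (hH : ∀ k, 0 ≤ H k ω) (x : Fin d → ℤ)
    {m n : ℕ} {t : ℝ} (hmt : jumpTime H m ω ≤ t) (htn : t ≤ jumpTime H n ω) :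
    occ (markedSteps S H ω) m (pt x) ≤ contLocalTime S H t x ω := by
  obtain ⟨-, he⟩ := integral_contWalk hS hH x m
  obtain ⟨hi, -⟩ := integral_contWalk hS hH x n
  have h0 : 0 ≤ jumpTime H m ω := Finset.sum_nonneg fun k _ => hH k
  rw [← he]
  refine intervalIntegral.integral_mono_interval le_rfl h0 hmt (.of_forall fun s => ?_)
    (hi.mono_set ?_)
  · simp only [Pi.zero_apply]
    split_ifs <;> simp
  · rw [Set.uIcc_of_le (h0.trans hmt), Set.uIcc_of_le ((h0.trans hmt).trans htn)]
    exact Set.Icc_subset_Icc_right htn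

lemma maxEvent_of_lt_maxContLocalTime {ω : Ω} (hS : ∀ ω, S 0 ω = 0) (hH : ∀ k, 0 ≤ H k ω)
    {n : ℕ} {s t : ℝ} (ht : 0 ≤ t) (htn : t ≤ jumpTime H n ω)
    (hs : s < maxContLocalTime S H t ω) : markedSteps S H ω ∈ maxEvent d n s := by
  obtain ⟨x, hx⟩ := exists_lt_of_lt_ciSup hs
  exact ⟨x, hx.trans_le (contLocalTime_le hS hH x ht htn)⟩

/-- The bound by `jumpTime H n ω` also keeps the local times bounded in `x`; an unbounded real
supremum would be 0. -/
lemma lt_maxContLocalTime_of_maxEvent {ω : Ω} (hS : ∀ ω, S 0 ω = 0) (hH : ∀ k, 0 ≤ H k ω)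
    {m n : ℕ} {s t : ℝ} (ht : 0 ≤ t) (hmt : jumpTime H m ω ≤ t) (htn : t ≤ jumpTime H n ω)
    (hs : markedSteps S H ω ∈ maxEvent d m s) : s < maxContLocalTime S H t ω := by
  obtain ⟨x, hx⟩ := hs
  have hbdd : BddAbove (Set.range fun x => contLocalTime S H t x ω) := by
    refine ⟨jumpTime H n ω, ?_⟩
    rintro _ ⟨y, rfl⟩
    refine (contLocalTime_le hS hH y ht htn).trans ?_
    rw [occ_markedSteps hS]
    refine Finset.sum_le_sum fun k _ => mul_le_of_le_one_left (hH k) ?_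
    unfold pt
    split_ifs <;> simp
  exact (hx.trans_le (le_contLocalTime hS hH x hmt htn)).trans_le (le_ciSup hbdd x)

variable [MeasurableSpace Ω] {μ : Measure Ω}

lemma isIIDLaw_map [IsProbabilityMeasure μ] {E F : Type*} [MeasurableSpace E] [MeasurableSpace F]
    {X : Ω → ℕ → E}
    {Y : Ω → ℕ → F} {p : Measure E} {q : Measure F} [IsProbabilityMeasure p]
    [IsProbabilityMeasure q] (hXm : Measurable X) (hYm : Measurable Y)
    (hX : μ.map X = Measure.infinitePi fun _ => p) (hY : μ.map Y = Measure.infinitePi fun _ => q)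
    (hXY : IndepFun X Y μ) :
    IsIIDLaw (μ.map fun ω n => (X ω n, Y ω n)) (p.prod q) := by
  have h := (isIIDLaw_infinitePi p).zip (isIIDLaw_infinitePi q)
  rw [← hX, ← hY, ← (indepFun_iff_map_prod_eq_prod_map_map hXm.aemeasurable
    hYm.aemeasurable).1 hXY, Measure.map_map (by fun_prop) (hXm.prodMk hYm)] at h
  exact h

lemma IsSimpleRandomWalk.measurable_steps (hS : IsSimpleRandomWalk S μ) :
    Measurable fun ω (n : ℕ) => S (n + 1) ω - S n ω :=
  measurable_pi_iff.2 fun n => (hS.measurable (n + 1)).sub (hS.measurable n)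

lemma IsSimpleRandomWalk.map_steps [IsProbabilityMeasure μ] (hS : IsSimpleRandomWalk S μ) :
    μ.map (fun ω (n : ℕ) => S (n + 1) ω - S n ω) = Measure.infinitePi fun _ => stepLaw d := by
  have h := hS.indep.map_fun_eq_infinitePi_map fun n =>
    ((hS.measurable (n + 1)).sub (hS.measurable n) :
      Measurable fun ω => S (n + 1) ω - S n ω)
  exact h.trans (congrArg Measure.infinitePi (funext fun n => (hS.law n).map_eq))

/-- The law of the steps of the walk with unit marks. -/
lemma IsSimpleRandomWalk.isIIDLaw_unit [IsProbabilityMeasure μ] (hd : d ≠ 0)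
    (hS : IsSimpleRandomWalk S μ) :
    IsIIDLaw (μ.map (markedSteps S fun _ _ => 1)) ((stepLaw d).prod (Measure.dirac 1)) := by
  have := isProbabilityMeasure_stepLaw hd
  refine isIIDLaw_map (Y := fun _ _ => (1 : ℝ)) hS.measurable_steps measurable_const hS.map_steps
    ?_ (indepFun_const_right _ _)
  rw [Measure.map_const, measure_univ, one_smul, Measure.infinitePi_dirac]

/-- The law of the steps of the walk marked with the holding times. -/
lemma IsHoldingTimes.isIIDLaw [IsProbabilityMeasure μ] (hd : d ≠ 0) (hS : IsSimpleRandomWalk S μ)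
    (hH : IsHoldingTimes H S μ) :
    IsIIDLaw (μ.map (markedSteps S H)) ((stepLaw d).prod (expMeasure 1)) := by
  have := isProbabilityMeasure_stepLaw hd
  have := isProbabilityMeasure_expMeasure one_pos
  refine isIIDLaw_map (Y := fun ω n => H n ω) hS.measurable_steps
    (measurable_pi_iff.2 hH.measurable) hS.map_steps ?_ ?_
  · rw [hH.indep.map_fun_eq_infinitePi_map hH.measurable]
    simp only [(hH.law _).map_eq]
  · exact (hH.indep_walk.comp (φ := id) (ψ := fun (s : ℕ → Fin d → ℤ) (n : ℕ) => s (n + 1) - s n)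
      measurable_id (by fun_prop)).symm

lemma measurable_markedSteps (hS : ∀ n, Measurable (S n)) (hH : ∀ n, Measurable (H n)) :
    Measurable (markedSteps S H) :=
  measurable_pi_iff.2 fun n => ((hS (n + 1)).sub (hS n)).prodMk (hH n)

lemma IsSimpleRandomWalk.escapeProb_eq [IsProbabilityMeasure μ] (hd : d ≠ 0)
    (hS : IsSimpleRandomWalk S μ) :
    escapeProb S μ = 1 - returnProbTop d := by
  have h := hS.isIIDLaw_unit hd
  have hm := measurable_markedSteps hS.measurable
    (H := fun _ _ => 1) (fun _ => measurable_const)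
  have hmeas : MeasurableSet {z : ℕ → (Fin d → ℤ) × ℝ | ∃ k, pos z (k + 1) = 0} := by
    have : {z : ℕ → (Fin d → ℤ) × ℝ | ∃ k, pos z (k + 1) = 0}
        = ⋃ k, {z | pos z (k + 1) = 0} := by
      ext z
      simp
    rw [this]
    exact MeasurableSet.iUnion fun k => measurableSet_pos_eq _ _
  have := h.prob
  rw [← measureReal_return_top hd h, ← probReal_compl_eq_one_sub hmeas,
    map_measureReal_apply hm hmeas.compl, escapeProb]
  congr 1
  ext ω
  simp only [Set.mem_ofPred_eq, Set.mem_preimage, Set.mem_compl_iff, pos_markedSteps hS.start,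
    not_exists]
  exact ⟨fun h k => h (k + 1) (by omega), fun h n hn => by
    obtain ⟨k, rfl⟩ := Nat.exists_eq_add_of_le' hn
    exact h k⟩

lemma IsHoldingTimes.ae_nonneg (hH : IsHoldingTimes H S μ) : ∀ᵐ ω ∂μ, ∀ k, 0 ≤ H k ω :=
  ae_all_iff.2 fun k =>
    ((hH.law k).ae_iff (p := fun x => 0 ≤ x) (measurableSet_setOfPred.1 measurableSet_Ici)).2
      ae_nonneg_expMeasure_one

lemma IsHoldingTimes.mgf_eq (hH : IsHoldingTimes H S μ) {c : ℝ} (hc : c < 1) (k : ℕ) :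
    Integrable (fun ω => Real.exp (c * H k ω)) μ ∧ mgf (H k) μ c = (1 - c)⁻¹ := by
  have hm : Measurable fun x : ℝ => ENNReal.ofReal (Real.exp (c * x)) := by fun_prop
  have h1 : ∫⁻ ω, ENNReal.ofReal (Real.exp (c * H k ω)) ∂μ = ENNReal.ofReal (1 - c)⁻¹ := by
    rw [← lintegral_exp_mul_expMeasure_one hc, ← (hH.law k).map_eq, lintegral_map hm
      (hH.measurable k)]
  have hmeas : AEStronglyMeasurable (fun ω => Real.exp (c * H k ω)) μ :=
    (((hH.measurable k).const_mul c).exp).aestronglyMeasurable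
  have hnn : 0 ≤ᵐ[μ] fun ω => Real.exp (c * H k ω) := .of_forall fun _ => (Real.exp_pos _).le
  constructor
  · refine (lintegral_ofReal_ne_top_iff_integrable hmeas hnn).1 ?_
    rw [h1]
    exact ENNReal.ofReal_ne_top
  · rw [mgf, integral_eq_lintegral_of_nonneg_ae hnn hmeas, h1, ENNReal.toReal_ofReal]
    exact inv_nonneg.2 (by linarith)

lemma IsHoldingTimes.mgf_jumpTime [IsProbabilityMeasure μ] (hH : IsHoldingTimes H S μ) {c : ℝ}
    (hc : c < 1) (n : ℕ) :
    Integrable (fun ω => Real.exp (c * jumpTime H n ω)) μ ∧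
      mgf (jumpTime H n) μ c = (1 - c)⁻¹ ^ n := by
  have e : jumpTime H n = ∑ k ∈ Finset.range n, H k := by
    ext ω
    simp [jumpTime]
  rw [e]
  constructor
  · exact hH.indep.integrable_exp_mul_sum hH.measurable fun k _ => (hH.mgf_eq hc k).1
  · rw [hH.indep.mgf_sum hH.measurable, Finset.prod_congr rfl fun k _ => (hH.mgf_eq hc k).2]
    simp

/-- The jump times grow at least at rate `1 - ε`. -/
lemma IsHoldingTimes.exists_jumpTime_le [IsProbabilityMeasure μ] (hH : IsHoldingTimes H S μ)
    {ε : ℝ} (hε : 0 < ε) :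
    ∃ a > 0, ∀ t : ℝ, 0 ≤ t →
      μ.real {ω | jumpTime H ⌈(1 + ε) * t⌉₊ ω ≤ t} ≤ Real.exp (-a * t) := by
  have hlog : Real.log (1 + ε)⁻¹ < (1 + ε)⁻¹ - 1 :=
    Real.log_lt_sub_one_of_pos (by positivity) (inv_lt_one_of_one_lt₀ (by linarith)).ne
  rw [Real.log_inv] at hlog
  have hpos : 0 < (1 + ε) * Real.log (1 + ε) - ε := by
    have := mul_lt_mul_of_pos_left hlog (by linarith : 0 < 1 + ε)
    rw [mul_sub, mul_inv_cancel₀ (by linarith)] at this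
    linarith
  refine ⟨_, hpos, fun t ht => ?_⟩
  -- `-ε` is the optimal Chernoff exponent, with rate `(1 + ε) log (1 + ε) - ε`.
  obtain ⟨h1, h2⟩ := hH.mgf_jumpTime (c := -ε) (by linarith) ⌈(1 + ε) * t⌉₊
  refine (measure_le_le_exp_mul_mgf t (by linarith) h1).trans ?_
  have hl : 0 ≤ Real.log (1 + ε) := Real.log_nonneg (by linarith)
  have hc := Nat.le_ceil ((1 + ε) * t)
  rw [h2, sub_neg_eq_add, ← Real.exp_log (by positivity : (0 : ℝ) < (1 + ε)⁻¹), Real.log_inv,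
    ← Real.exp_nat_mul, ← Real.exp_add]
  refine Real.exp_le_exp.2 ?_
  nlinarith

/-- The jump times grow at most at rate `1 + ε`. -/
lemma IsHoldingTimes.exists_le_jumpTime [IsProbabilityMeasure μ] (hH : IsHoldingTimes H S μ)
    {ε : ℝ} (hε : 0 < ε)
    (hε1 : ε < 1) :
    ∃ a > 0, ∀ t : ℝ, 0 ≤ t →
      μ.real {ω | t ≤ jumpTime H ⌊(1 - ε) * t⌋₊ ω} ≤ Real.exp (-a * t) := by
  have h1ε : 0 < 1 - ε := by linarith
  have hlog : Real.log (1 - ε)⁻¹ < (1 - ε)⁻¹ - 1 :=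
    Real.log_lt_sub_one_of_pos (by positivity) ((one_lt_inv₀ h1ε).2 (by linarith)).ne'
  rw [Real.log_inv] at hlog
  have hpos : 0 < ε + (1 - ε) * Real.log (1 - ε) := by
    have := mul_lt_mul_of_pos_left hlog h1ε
    rw [mul_sub, mul_inv_cancel₀ h1ε.ne'] at this
    linarith
  refine ⟨_, hpos, fun t ht => ?_⟩
  -- The optimal exponent is now `ε`, with rate `ε + (1 - ε) log (1 - ε)`.
  obtain ⟨h1, h2⟩ := hH.mgf_jumpTime hε1 ⌊(1 - ε) * t⌋₊
  refine (measure_ge_le_exp_mul_mgf t hε.le h1).trans ?_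
  have hl : Real.log (1 - ε) ≤ 0 := Real.log_nonpos h1ε.le (by linarith)
  have hc := Nat.floor_le (mul_nonneg h1ε.le ht)
  rw [h2, ← Real.exp_log (by positivity : (0 : ℝ) < (1 - ε)⁻¹), Real.log_inv,
    ← Real.exp_nat_mul, ← Real.exp_add]
  refine Real.exp_le_exp.2 ?_
  nlinarith

end Transfer

/-! ### Logarithmic levels -/

section Levels

/-- Polynomials in logarithmic levels are negligible. -/
lemma tendsto_ceil_log_pow_div {a : ℝ} (ha : 0 < a) (u : ℝ) (p : ℕ) :
    Tendsto (fun t : ℝ => (⌈a * Real.log t + u⌉₊ : ℝ) ^ p / t) atTop (nhds 0) := by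
  have h1 : Tendsto (fun t : ℝ => (a + |u| + 1) ^ p * (Real.log t ^ p / t)) atTop (nhds 0) := by
    rw [← mul_zero ((a + |u| + 1) ^ p)]
    exact (Real.isLittleO_pow_log_id_atTop.tendsto_div_nhds_zero).const_mul _
  refine tendsto_of_tendsto_of_tendsto_of_le_of_le' tendsto_const_nhds h1 ?_ ?_
  · filter_upwards [eventually_gt_atTop 0] with t ht
    positivity
  · filter_upwards [eventually_gt_atTop 0, Real.tendsto_log_atTop.eventually_ge_atTop 1]
      with t ht hlog
    rw [← mul_div_assoc, ← mul_pow]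
    gcongr
    have h2 : a * Real.log t + u ≤ (a + |u|) * Real.log t := by
      have := mul_le_mul_of_nonneg_left hlog (abs_nonneg u)
      have := le_abs_self u
      linarith
    have h3 : 0 ≤ (a + |u|) * Real.log t := by positivity
    have h4 : (⌈a * Real.log t + u⌉₊ : ℝ) ≤ ⌈(a + |u|) * Real.log t⌉₊ := by
      exact_mod_cast Nat.ceil_mono h2
    have h5 := Nat.ceil_lt_add_one h3
    linarith

lemma tendsto_level {a : ℝ} (ha : 0 < a) (u : ℝ) :
    Tendsto (fun t : ℝ => a * Real.log t + u) atTop atTop :=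
  tendsto_atTop_add_const_right _ _ (Real.tendsto_log_atTop.const_mul_atTop ha)

end Levels

/-! ### The two deviation asymptotics -/

section Main

variable {Ω : Type*} [MeasurableSpace Ω] {μ : Measure Ω} {d : ℕ}
  {S : ℕ → Ω → (Fin d → ℤ)} {H : ℕ → Ω → ℝ}

lemma measureReal_lt_maxDiscreteLocalTime (hS : IsSimpleRandomWalk S μ) (n : ℕ) (s : ℝ) :
    μ.real {ω | s < (maxDiscreteLocalTime S n ω : ℝ)}
      = (μ.map (markedSteps S fun _ _ => 1)).real (maxEvent d (n + 1) s) := by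
  rw [map_measureReal_apply (measurable_markedSteps hS.measurable fun _ => measurable_const)
    (measurableSet_maxEvent _ _)]
  congr 1
  ext ω
  exact lt_maxDiscreteLocalTime_iff hS.start n s ω

/-- Upward deviations of the discrete maximal local time. -/
theorem isEquivalent_maxDiscreteLocalTime [IsProbabilityMeasure μ] (hd : 3 ≤ d)
    (hS : IsSimpleRandomWalk S μ) {β : ℝ} (hβ : 1 < β) (u : ℝ) :
    (fun n : ℕ => μ.real {ω | β * alpha S μ * Real.log (n : ℝ) + u
          < (maxDiscreteLocalTime S n ω : ℝ)})
      ~[atTop]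
      (fun n : ℕ => escapeProb S μ * (n : ℝ)
          * (1 - escapeProb S μ) ^ (⌊β * alpha S μ * Real.log (n : ℝ) + u⌋ : ℤ)) := by
  have hd0 : d ≠ 0 := by omega
  have hlaw := hS.isIIDLaw_unit hd0
  have hr := returnProbTop_lt_one hd hlaw
  have hr0 := returnProbTop_pos hd0
  rw [alpha, hS.escapeProb_eq hd0, sub_sub_cancel]
  simp only [measureReal_lt_maxDiscreteLocalTime hS]
  set r := returnProbTop d with hrdef
  have hlog : Real.log r < 0 := Real.log_neg hr0 hr
  set a := β * (-1 / Real.log r) with ha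
  have ha0 : 0 < a := mul_pos (by linarith) (div_pos_of_neg_of_neg (by norm_num) hlog)
  have hlr : a * Real.log r = -β := by
    rw [ha, mul_assoc, div_mul_cancel₀ _ hlog.ne]
    ring
  set s : ℕ → ℝ := fun n => a * Real.log (n : ℝ) + u with hs
  have hsinf : Tendsto s atTop atTop := (tendsto_level ha0 u).comp tendsto_natCast_atTop_atTop
  have hn1 : Tendsto (fun n : ℕ => ((n + 1 : ℕ) : ℝ) / n) atTop (nhds 1) := by
    have h1 : Tendsto (fun n : ℕ => 1 + (n : ℝ)⁻¹) atTop (nhds (1 + 0)) :=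
      (tendsto_inv_atTop_nhds_zero_nat (𝕜 := ℝ)).const_add 1
    rw [add_zero] at h1
    refine h1.congr' ?_
    filter_upwards [eventually_gt_atTop 0] with n hn
    have : (n : ℝ) ≠ 0 := by positivity
    push_cast
    field_simp
  have hequiv : (fun n : ℕ => ((n + 1 : ℕ) : ℝ)) ~[atTop] fun n : ℕ => (n : ℝ) := by
    refine (isEquivalent_iff_tendsto_one ?_).2 hn1
    filter_upwards [eventually_gt_atTop 0] with n hn
    positivity
  have hns : Tendsto (fun n : ℕ => (⌈s n⌉₊ : ℝ) ^ 7 / ((n + 1 : ℕ) : ℝ)) atTop (nhds 0) := by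
    refine tendsto_of_tendsto_of_tendsto_of_le_of_le' tendsto_const_nhds
      ((tendsto_ceil_log_pow_div ha0 u 7).comp tendsto_natCast_atTop_atTop)
      (.of_forall fun n => by positivity) ?_
    filter_upwards [eventually_gt_atTop 0] with n hn
    have : (0 : ℝ) < n := by exact_mod_cast hn
    simp only [Function.comp]
    gcongr
    omega
  have hnT : Tendsto (fun n : ℕ => ((n + 1 : ℕ) : ℝ) * r ^ ⌊s n⌋₊) atTop (nhds 0) := by
    have h1 : Tendsto (fun n : ℕ => ((n + 1 : ℕ) : ℝ) / n * (Real.exp ((u - 1) * Real.log r)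
        * (n : ℝ) ^ (-(β - 1)))) atTop (nhds 0) := by
      have := (tendsto_rpow_neg_atTop (y := β - 1) (by linarith)).comp
        (tendsto_natCast_atTop_atTop (R := ℝ))
      simpa using hn1.mul (this.const_mul (Real.exp ((u - 1) * Real.log r)))
    refine tendsto_of_tendsto_of_tendsto_of_le_of_le' tendsto_const_nhds h1
      (.of_forall fun n => by positivity) ?_
    filter_upwards [eventually_gt_atTop 0] with n hn
    have hn' : (0 : ℝ) < n := by exact_mod_cast hn
    -- The floor loses at most 1, hence the factor with `u - 1`; the power of `n` comes from `a *
    -- log r = -β`.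
    have h2 : r ^ ⌊s n⌋₊ ≤ Real.exp ((u - 1) * Real.log r) * (n : ℝ) ^ (-β) := by
      calc r ^ ⌊s n⌋₊ = r ^ ((⌊s n⌋₊ : ℕ) : ℝ) := (Real.rpow_natCast _ _).symm
        _ ≤ r ^ (s n - 1) :=
            Real.rpow_le_rpow_of_exponent_ge hr0 hr.le (Nat.sub_one_lt_floor _).le
        _ = Real.exp ((u - 1) * Real.log r) * (n : ℝ) ^ (-β) := by
            rw [Real.rpow_def_of_pos hr0, Real.rpow_def_of_pos hn', ← Real.exp_add, ← hlr, hs]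
            ring_nf
    have h3 : (n : ℝ) ^ (-(β - 1)) = n * (n : ℝ) ^ (-β) := by
      rw [neg_sub, sub_eq_add_neg, Real.rpow_add hn', Real.rpow_one]
    calc ((n + 1 : ℕ) : ℝ) * r ^ ⌊s n⌋₊
        ≤ ((n + 1 : ℕ) : ℝ) * (Real.exp ((u - 1) * Real.log r) * (n : ℝ) ^ (-β)) := by gcongr
      _ = _ := by
          rw [h3]
          field_simp
  have hmain := isEquivalent_measureReal_maxEvent hd isMarkTail_dirac hlaw
    (tendsto_add_atTop_nat 1) hsinf hns hnT
  refine hmain.trans ?_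
  -- The floors in `ℕ` and `ℤ` agree once the level is nonnegative.
  have h4 : (fun n : ℕ => (1 - r) * (n : ℝ) * r ^ ⌊s n⌋₊)
      =ᶠ[atTop] fun n : ℕ => (1 - r) * (n : ℝ) * r ^ (⌊s n⌋ : ℤ) := by
    filter_upwards [hsinf.eventually_ge_atTop 0] with n hn
    rw [← zpow_natCast, Int.natCast_floor_eq_floor hn]
  refine IsEquivalent.trans ?_ h4.isEquivalent
  exact (IsEquivalent.refl.mul hequiv).mul IsEquivalent.refl

lemma measureReal_lt_maxContLocalTime_le [IsProbabilityMeasure μ] (hS : IsSimpleRandomWalk S μ)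
    (hH : IsHoldingTimes H S μ) {n : ℕ} {s t : ℝ} (ht : 0 ≤ t) :
    μ.real {ω | s < maxContLocalTime S H t ω}
      ≤ (μ.map (markedSteps S H)).real (maxEvent d n s) + μ.real {ω | jumpTime H n ω ≤ t} := by
  rw [map_measureReal_apply (measurable_markedSteps hS.measurable hH.measurable)
    (measurableSet_maxEvent _ _)]
  refine le_trans (ENNReal.toReal_mono (measure_ne_top _ _) (measure_mono_ae ?_))
    (measureReal_union_le _ _)
  filter_upwards [hH.ae_nonneg] with ω hω hs
  rcases le_or_gt (jumpTime H n ω) t with h | h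
  · exact Or.inr h
  · exact Or.inl (maxEvent_of_lt_maxContLocalTime hS.start hω ht h.le hs)

/-- Two clock errors: `m` jumps may take at least time `t`, or `n` jumps may be over by time `t`,
where integrability and boundedness of the local times are not guaranteed. -/
lemma le_measureReal_lt_maxContLocalTime [IsProbabilityMeasure μ] (hS : IsSimpleRandomWalk S μ)
    (hH : IsHoldingTimes H S μ) {m n : ℕ} {s t : ℝ} (ht : 0 ≤ t) :
    (μ.map (markedSteps S H)).real (maxEvent d m s)
      ≤ μ.real {ω | s < maxContLocalTime S H t ω} + μ.real {ω | t ≤ jumpTime H m ω}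
        + μ.real {ω | jumpTime H n ω ≤ t} := by
  rw [map_measureReal_apply (measurable_markedSteps hS.measurable hH.measurable)
    (measurableSet_maxEvent _ _)]
  refine le_trans (ENNReal.toReal_mono (measure_ne_top _ _) (measure_mono_ae ?_))
    ((measureReal_union_le _ _).trans (add_le_add_left (measureReal_union_le _ _) _))
  filter_upwards [hH.ae_nonneg] with ω hω hs
  rcases le_or_gt (jumpTime H n ω) t with h | h
  · exact Or.inr h
  · rcases le_or_gt t (jumpTime H m ω) with h' | h'
    · exact Or.inl (Or.inr h')
    · exact Or.inl (Or.inl (lt_maxContLocalTime_of_maxEvent hS.start hω ht h'.le h.le hs))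

/-- Upward deviations of the continuous maximal local time. -/
theorem isEquivalent_maxContLocalTime [IsProbabilityMeasure μ] (hd : 3 ≤ d)
    (hS : IsSimpleRandomWalk S μ)
    (hH : IsHoldingTimes H S μ) {β : ℝ} (hβ : 1 < β) (u : ℝ) :
    (fun t : ℝ => μ.real {ω | β * (escapeProb S μ)⁻¹ * Real.log t + u
          < maxContLocalTime S H t ω})
      ~[atTop]
      (fun t : ℝ => escapeProb S μ * Real.exp (-escapeProb S μ * u) * t ^ (-(β - 1))) := by
  have hd0 : d ≠ 0 := by omega
  have := isProbabilityMeasure_expMeasure one_pos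
  have hlaw := hH.isIIDLaw hd0 hS
  have hr := returnProbTop_lt_one hd hlaw
  have hr0 := returnProbTop_pos hd0
  rw [hS.escapeProb_eq hd0]
  set r := returnProbTop d with hrdef
  have hγ : 0 < 1 - r := by linarith
  set a := β * (1 - r)⁻¹ with ha
  have ha0 : 0 < a := by positivity
  set s : ℝ → ℝ := fun t => a * Real.log t + u with hs
  have hsinf : Tendsto s atTop atTop := tendsto_level ha0 u
  set G : ℝ → ℝ := fun t => (1 - r) * Real.exp (-(1 - r) * u) * t ^ (-(β - 1)) with hG
  have hGpos (t : ℝ) (ht : 0 < t) : 0 < G t := by positivity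
  have hTG (t : ℝ) (ht : 0 < t) : (1 - r) * (t * Real.exp (-(1 - r) * s t)) = G t := by
    have h1 : Real.exp (-(1 - r) * s t) = Real.exp (-(1 - r) * u) * t ^ (-β) := by
      rw [Real.rpow_def_of_pos ht, ← Real.exp_add, hs, ha]
      congr 1
      field_simp
      ring
    have h2 : t ^ (-(β - 1)) = t * t ^ (-β) := by
      rw [neg_sub, sub_eq_add_neg, Real.rpow_add ht, Real.rpow_one]
    rw [hG, h1]
    simp only [h2]
    ring
  have hG0 : Tendsto G atTop (nhds 0) := by
    have := (tendsto_rpow_neg_atTop (y := β - 1) (by linarith)).const_mul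
      ((1 - r) * Real.exp (-(1 - r) * u))
    rwa [mul_zero] at this
  -- Used with `b = 1 - ε` and `b = 1 + ε`, the two deterministic substitutes for the random number
  -- of jumps.
  have hmain (n : ℝ → ℕ) (b : ℝ) (hb : 0 < b)
      (hn : Tendsto (fun t => (n t : ℝ) / t) atTop (nhds b)) :
      Tendsto (fun t => (μ.map (markedSteps S H)).real (maxEvent d (n t) (s t)) / G t) atTop
        (nhds b) := by
    have hntop : Tendsto (fun t => (n t : ℝ)) atTop atTop := by
      refine (hn.pos_mul_atTop hb tendsto_id).congr' ?_
      filter_upwards [eventually_gt_atTop 0] with t ht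
      simp only [id]
      field_simp
    have hntop' : Tendsto n atTop atTop := tendsto_natCast_atTop_iff.1 hntop
    have hns : Tendsto (fun t => (⌈s t⌉₊ : ℝ) ^ 7 / (n t : ℝ)) atTop (nhds 0) := by
      have := (tendsto_ceil_log_pow_div ha0 u 7).div hn hb.ne'
      rw [zero_div] at this
      refine this.congr' ?_
      filter_upwards [eventually_gt_atTop 0] with t ht
      simp only [Pi.div_apply, hs]
      field_simp
    have hnT : Tendsto (fun t => (n t : ℝ) * Real.exp (-(1 - r) * s t)) atTop (nhds 0) := by
      have := (hn.mul hG0).const_mul (1 - r)⁻¹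
      simp only [mul_zero] at this
      refine this.congr' ?_
      filter_upwards [eventually_gt_atTop 0] with t ht
      rw [← hTG t ht]
      field_simp
    have h1 := isEquivalent_measureReal_maxEvent hd isMarkTail_expMeasure hlaw hntop' hsinf hns hnT
    have h2 := (isEquivalent_iff_tendsto_one ?_).1 h1
    · have h3 := h2.mul hn
      rw [one_mul] at h3
      simp only [← hrdef] at h3
      refine h3.congr' ?_
      filter_upwards [eventually_gt_atTop 0, hntop.eventually_gt_atTop 0] with t ht hnt
      rw [← hTG t ht, Pi.div_apply]
      field_simp
    · filter_upwards [hntop.eventually_gt_atTop 0] with t hnt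
      positivity
  -- Clock errors are exponentially small, while `G` decays only like a power.
  have hexp (c : ℝ) (hc : 0 < c) : Tendsto (fun t => Real.exp (-c * t) / G t) atTop (nhds 0) := by
    have := (tendsto_rpow_mul_exp_neg_mul_atTop_nhds_zero (β - 1) c hc).const_mul
      ((1 - r) * Real.exp (-(1 - r) * u))⁻¹
    rw [mul_zero] at this
    refine this.congr' ?_
    filter_upwards [eventually_gt_atTop 0] with t ht
    rw [hG]
    simp only [Real.rpow_neg ht.le]
    have := Real.rpow_pos_of_pos ht (β - 1)
    field_simp
  set f : ℝ → ℝ := fun t => μ.real {ω | s t < maxContLocalTime S H t ω} with hf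
  refine (isEquivalent_iff_tendsto_one ?_).2 (tendsto_order.2 ⟨fun b hb => ?_, fun b hb => ?_⟩)
  · filter_upwards [eventually_gt_atTop 0] with t ht
    exact (hGpos t ht).ne'
  · obtain ⟨ε, hε0, hε⟩ := exists_between (lt_min (sub_pos.2 hb) one_pos)
    obtain ⟨hε1, hε2⟩ := lt_min_iff.1 hε
    obtain ⟨c, hc, hcb⟩ := hH.exists_le_jumpTime hε0 hε2
    -- The value 1 is arbitrary: it only makes `⌈2 t⌉₊` jumps outlast time `t` with overwhelming
    -- probability.
    obtain ⟨c', hc', hcb'⟩ := hH.exists_jumpTime_le one_pos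
    have h1 := ((hmain (fun t => ⌊(1 - ε) * t⌋₊) (1 - ε) (by linarith)
      (tendsto_nat_floor_mul_div_atTop (by linarith))).sub (hexp c hc)).sub (hexp c' hc')
    have h2 : b < 1 - ε - 0 - 0 := by linarith
    filter_upwards [h1.eventually_const_lt h2, eventually_gt_atTop 0] with t hbt ht
    refine hbt.trans_le ?_
    have h3 := le_measureReal_lt_maxContLocalTime hS hH (m := ⌊(1 - ε) * t⌋₊)
      (n := ⌈(1 + 1) * t⌉₊) (s := s t) ht.le
    have h4 := hcb t ht.le
    have h5 := hcb' t ht.le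
    rw [Pi.div_apply, ← sub_div, ← sub_div]
    refine div_le_div_of_nonneg_right ?_ (hGpos t ht).le
    simp only [hf]
    linarith
  · obtain ⟨ε, hε0, hε⟩ := exists_between (sub_pos.2 hb)
    obtain ⟨c, hc, hcb⟩ := hH.exists_jumpTime_le hε0
    have h1 := (hmain (fun t => ⌈(1 + ε) * t⌉₊) (1 + ε) (by linarith)
      (tendsto_nat_ceil_mul_div_atTop (by linarith))).add (hexp c hc)
    have h2 : 1 + ε + 0 < b := by linarith
    filter_upwards [h1.eventually_lt_const h2, eventually_gt_atTop 0] with t hbt ht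
    refine lt_of_le_of_lt ?_ hbt
    have h3 := measureReal_lt_maxContLocalTime_le hS hH (n := ⌈(1 + ε) * t⌉₊) (s := s t) ht.le
    have h4 := hcb t ht.le
    rw [Pi.div_apply, ← add_div]
    refine div_le_div_of_nonneg_right ?_ (hGpos t ht).le
    simp only [hf]
    linarith

end Main

end RandomWalk

theorem theorem1p1 {Ω : Type*} [MeasurableSpace Ω] (μ : Measure Ω) [IsProbabilityMeasure μ]
    (d : ℕ) (hd : 3 ≤ d)
    (S : ℕ → Ω → (Fin d → ℤ)) (hS : RandomWalk.IsSimpleRandomWalk S μ)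
    (H : ℕ → Ω → ℝ) (hH : RandomWalk.IsHoldingTimes H S μ)
    (β : ℝ) (hβ : 1 < β) (u : ℝ) :
    ((fun t : ℝ => μ.real {ω | β * (RandomWalk.escapeProb S μ)⁻¹ * Real.log t + u
          < RandomWalk.maxContLocalTime S H t ω})
      ~[atTop]
      (fun t : ℝ => RandomWalk.escapeProb S μ * Real.exp (-RandomWalk.escapeProb S μ * u)
          * t ^ (-(β - 1)))) ∧
    ((fun n : ℕ => μ.real {ω | β * RandomWalk.alpha S μ * Real.log (n : ℝ) + u
          < (RandomWalk.maxDiscreteLocalTime S n ω : ℝ)})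
      ~[atTop]
      (fun n : ℕ => RandomWalk.escapeProb S μ * (n : ℝ)
          * (1 - RandomWalk.escapeProb S μ)
            ^ (⌊β * RandomWalk.alpha S μ * Real.log (n : ℝ) + u⌋ : ℤ))) :=
  ⟨RandomWalk.isEquivalent_maxContLocalTime hd hS hH hβ u,
    RandomWalk.isEquivalent_maxDiscreteLocalTime hd hS hβ u⟩
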